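/- Theorem (provability in $\mathsf{RCA}_0$). Let $\mathsf{RCA}_0$ be the theory in the language of second order arithmetic (number variables, set variables, $+,\cdot,0,1,=,<,\in$, classical two-sorted first order logic) whose axioms are the basic arithmetical axioms, the induction axiom for sets, the induction scheme for $\Sigma^0_1$ formulas and the comprehension scheme for $\Delta^0_1$ formulas (parameters allowed). Then $\mathsf{RCA}_0$ proves the sentence: *every complete separable metric space which is perfect and Lebesgue is Heine–Borel compact.* Here, inside $\mathsf{RCA}_0$: a real number is coded by a sequence of rationals with $|q_n-q_{n+1}|<2^{-n}$ for all $n$. A (code for a) complete separable metric space $\widehat A$ is a set $A\subseteq\mathbb N$ with a function $d:A\times A\to\mathbb R$ such that $d(a,a)=0$, $d(a,b)=d(b,a)\ge 0$ and $d(a,b)\le d(a,c)+d(c,b)$ for all $a,b,c\in A$. A point $x\in\widehat A$ is a sequence $\langle a_n:n\in\mathbb N\rangle$ of elements of $A$ with $d(a_n,a_{n+1})<2^{-n}$ for all $n$; $d$ is extended to points by limits, and $a\in A$ is identified with the constant sequence. A (code for an) open set is a sequence $U=\langle (a_m,q_m):m\in\mathbb N\rangle$ of elements of $A\times\mathbb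 Q^+$, and $x\in U$ means $\exists m\; d(x,a_m)<q_m$. An open covering of $\widehat A$ is a sequence $\langle U_n:n\in\mathbb N\rangle$ of open sets such that $\forall x\in\widehat A\;\exists n\; x\in U_n$. * $\widehat A$ is *perfect* if no point $x\in\widehat A$ is isolated, where $x$ is isolated if for some $q\in\mathbb R^+$ there is no $y\in\widehat A$ with $0<d(x,y)<q$. * $\widehat A$ is *Lebesgue* if for every open covering $\langle U_n:n\in\mathbb N\rangle$ of $\widehat A$ there is $q\in\mathbb R^+$ such that for every $x\in\widehat A$ there is $n$ with $\{y\in\widehat A: d(x,y)<q\}\subseteq U_n$. * $\widehat A$ is *Heine–Borel compact* if for every open covering $\langle U_n:n\in\mathbb N\rangle$ of $\widehat A$ there is a finite set $F\subseteq\mathbb N$ such that every $x\in\widehat A$ lies in $U_n$ for some $n\in F$. -/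

import Mathlib

/-!
The language of second order arithmetic and its classical two-sorted first order logic, the theory
`RCA0`, and the codings of complete separable metric spaces, their points and their open sets by
sets of natural numbers.  Everything is syntax: the result is a sentence of the language, and the
claim is that this sentence is derivable from the axioms of `RCA0`.
-/

namespace SecondOrderArithmetic

/-! ### Language -/

/-- Numerical terms.  Number variables are de Bruijn indices. -/
inductive Term : Type
  | var (i : ℕ) : Term
  | zero : Term
  | one : Term
  | add (s t : Term) : Term
  | mul (s t : Term) : Term

/-- Formulas of second order arithmetic.  Number variables and set variables are de Bruijn indices,
counted separately: `all` binds number variable `0` and `allSet` binds set variable `0`.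
There is no equality between sets. -/
inductive Formula : Type
  | eq (s t : Term) : Formula
  | lt (s t : Term) : Formula
  | mem (t : Term) (X : ℕ) : Formula
  | bot : Formula
  | imp (φ ψ : Formula) : Formula
  | all (φ : Formula) : Formula
  | allSet (φ : Formula) : Formula

namespace Term

/-- Simultaneous substitution of terms for the number variables. -/
def subst (σ : ℕ → Term) : Term → Term
  | var i => σ i
  | zero => zero
  | one => one
  | add s t => add (s.subst σ) (t.subst σ)
  | mul s t => mul (s.subst σ) (t.subst σ)

/-- Renaming `i ↦ i + 1` of all number variables. -/
def shift (t : Term) : Term := t.subst fun i => var (i + 1)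

/-- The substitution `σ` carried under a quantifier over numbers. -/
def up (σ : ℕ → Term) : ℕ → Term
  | 0 => var 0
  | i + 1 => (σ i).shift

end Term

namespace Formula

/-- The renaming `ρ` carried under a quantifier over sets. -/
def upSet (ρ : ℕ → ℕ) : ℕ → ℕ
  | 0 => 0
  | i + 1 => ρ i + 1

/-- Simultaneous capture-avoiding substitution: terms for the free number variables, set variables
for the free set variables. -/
def subst : Formula → (ℕ → Term) → (ℕ → ℕ) → Formula
  | eq s t, σ, _ => eq (s.subst σ) (t.subst σ)
  | lt s t, σ, _ => lt (s.subst σ) (t.subst σ)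
  | mem t X, σ, ρ => mem (t.subst σ) (ρ X)
  | bot, _, _ => bot
  | imp φ ψ, σ, ρ => imp (φ.subst σ ρ) (ψ.subst σ ρ)
  | all φ, σ, ρ => all (φ.subst (Term.up σ) ρ)
  | allSet φ, σ, ρ => allSet (φ.subst σ (upSet ρ))

/-- Renaming `i ↦ i + 1` of the free number variables. -/
def shift (φ : Formula) : Formula := φ.subst (fun i => .var (i + 1)) id

/-- Renaming `i ↦ i + 1` of the free set variables. -/
def shiftSet (φ : Formula) : Formula := φ.subst .var (· + 1)

/-- `φ(t)`: the body `φ` of a quantifier over numbers, with the term `t` for number variable `0`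
(and every other free number variable lowered by one). -/
def inst (φ : Formula) (t : Term) : Formula :=
  φ.subst (fun i => match i with | 0 => t | j + 1 => .var j) id

/-- `φ(X)`: the body `φ` of a quantifier over sets, with the set variable `X` for set
variable `0`. -/
def instSet (φ : Formula) (X : ℕ) : Formula :=
  φ.subst .var (fun i => match i with | 0 => X | j + 1 => j)

def neg (φ : Formula) : Formula := imp φ bot
def and (φ ψ : Formula) : Formula := neg (imp φ (neg ψ))
def or (φ ψ : Formula) : Formula := imp (neg φ) ψ
def iff (φ ψ : Formula) : Formula := and (imp φ ψ) (imp ψ φ)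
def ex (φ : Formula) : Formula := neg (all (neg φ))
def exSet (φ : Formula) : Formula := neg (allSet (neg φ))

/-- The bounded quantifier `∀ n < t`; the bound `t` does not contain the bound variable. -/
def ballLt (t : Term) (φ : Formula) : Formula := all (imp (lt (.var 0) t.shift) φ)

/-- The formulas all of whose quantifiers are bounded number quantifiers.  (Conjunction,
disjunction and `∃ n < t`, i.e. `¬ ∀ n < t ¬`, are available through `imp`, `bot` and
`ballLt`.)  Free variables of both sorts are allowed. -/
inductive IsBounded : Formula → Prop
  | eq (s t : Term) : IsBounded (eq s t)
  | lt (s t : Term) : IsBounded (lt s t)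
  | mem (t : Term) (X : ℕ) : IsBounded (mem t X)
  | bot : IsBounded bot
  | imp {φ ψ : Formula} : IsBounded φ → IsBounded ψ → IsBounded (imp φ ψ)
  | ballLt (t : Term) {φ : Formula} : IsBounded φ → IsBounded (ballLt t φ)

/-- `Σ⁰₁` formulas. -/
def IsSigma01 (φ : Formula) : Prop := ∃ θ : Formula, IsBounded θ ∧ φ = ex θ

/-- `Π⁰₁` formulas. -/
def IsPi01 (φ : Formula) : Prop := ∃ θ : Formula, IsBounded θ ∧ φ = all θ

end Formula

/-! ### Derivability -/

/-- Natural deduction for classical two-sorted first order logic with equality between numbers.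
`Derives T Γ φ`: the formula `φ` is derivable from the non-logical axioms `T` and the open
assumptions `Γ`.  The free variables of a member of `T` count as universally quantified, those of
a member of `Γ` as fixed. -/
inductive Derives (T : Set Formula) : Set Formula → Formula → Prop
  | ax {Γ : Set Formula} {φ : Formula} : φ ∈ T → Derives T Γ φ
  | hyp {Γ : Set Formula} {φ : Formula} : φ ∈ Γ → Derives T Γ φ
  | impI {Γ : Set Formula} {φ ψ : Formula} :
      Derives T (insert φ Γ) ψ → Derives T Γ (.imp φ ψ)
  | impE {Γ : Set Formula} {φ ψ : Formula} :
      Derives T Γ (.imp φ ψ) → Derives T Γ φ → Derives T Γ ψ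
  | raa {Γ : Set Formula} {φ : Formula} :
      Derives T (insert (.neg φ) Γ) .bot → Derives T Γ φ
  | allI {Γ : Set Formula} {φ : Formula} :
      Derives T (Formula.shift '' Γ) φ → Derives T Γ (.all φ)
  | allE {Γ : Set Formula} {φ : Formula} (t : Term) :
      Derives T Γ (.all φ) → Derives T Γ (φ.inst t)
  | allSetI {Γ : Set Formula} {φ : Formula} :
      Derives T (Formula.shiftSet '' Γ) φ → Derives T Γ (.allSet φ)
  | allSetE {Γ : Set Formula} {φ : Formula} (X : ℕ) :
      Derives T Γ (.allSet φ) → Derives T Γ (φ.instSet X)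
  | eqRefl {Γ : Set Formula} (t : Term) : Derives T Γ (.eq t t)
  | eqSubst {Γ : Set Formula} {φ : Formula} {s t : Term} :
      Derives T Γ (.eq s t) → Derives T Γ (φ.inst s) → Derives T Γ (φ.inst t)

/-- The theory `T` proves the sentence `φ`. -/
def Proves (T : Set Formula) (φ : Formula) : Prop := Derives T ∅ φ

/-! ### The axioms of `RCA0` -/

/-- The basic arithmetical axioms. -/
inductive BasicAx : Formula → Prop
  | succ_ne_zero : BasicAx (.neg (.eq (.add (.var 0) .one) .zero))
  | succ_inj : BasicAx (.imp (.eq (.add (.var 0) .one) (.add (.var 1) .one))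
      (.eq (.var 0) (.var 1)))
  | add_zero : BasicAx (.eq (.add (.var 0) .zero) (.var 0))
  | add_succ : BasicAx (.eq (.add (.var 0) (.add (.var 1) .one))
      (.add (.add (.var 0) (.var 1)) .one))
  | mul_zero : BasicAx (.eq (.mul (.var 0) .zero) .zero)
  | mul_succ : BasicAx (.eq (.mul (.var 0) (.add (.var 1) .one))
      (.add (.mul (.var 0) (.var 1)) (.var 0)))
  | not_lt_zero : BasicAx (.neg (.lt (.var 0) .zero))
  | lt_succ : BasicAx (.iff (.lt (.var 0) (.add (.var 1) .one))
      (.or (.lt (.var 0) (.var 1)) (.eq (.var 0) (.var 1))))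

/-- The induction axiom for `φ(n)`, where `n` is number variable `0`:
`φ(0) ∧ ∀ n (φ(n) → φ(n + 1)) → ∀ n φ(n)`.  All other free variables are parameters. -/
def inductionFor (φ : Formula) : Formula :=
  .imp
    (.and (φ.inst .zero)
      (.all (.imp φ
        (φ.subst (fun i => match i with | 0 => .add (.var 0) .one | j + 1 => .var (j + 1)) id))))
    (.all φ)

/-- The `Δ⁰₁` comprehension axiom for `φ(n)` and `ψ(n)`, where `n` is number variable `0`:
`∀ n (φ(n) ↔ ψ(n)) → ∃ X ∀ n (n ∈ X ↔ φ(n))`.  All other free variables are parameters; the set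
`X` does not occur in `φ`, as the set variables of `φ` are shifted. -/
def comprehensionFor (φ ψ : Formula) : Formula :=
  .imp (.all (.iff φ ψ)) (.exSet (.all (.iff (.mem (.var 0) 0) φ.shiftSet)))

/-- The theory `RCA₀`. -/
inductive RCA0 : Set Formula
  | basic {φ : Formula} : BasicAx φ → RCA0 φ
  | setInduction : RCA0 (inductionFor (.mem (.var 0) 0))
  | sigmaInduction {φ : Formula} : φ.IsSigma01 → RCA0 (inductionFor φ)
  | comprehension {φ ψ : Formula} : φ.IsSigma01 → ψ.IsPi01 → RCA0 (comprehensionFor φ ψ)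

/-! ### Writing sentences with bound variables as Lean variables

An expression below is a function of the number `d` of number quantifiers (and, for statements,
the number `e` of set quantifiers) in whose scope it stands.  The variable bound by the quantifier
that has `d` quantifiers of its sort outside it has the index `d' - (d + 1)` in the scope of `d'`
quantifiers.  This is a way to write down concrete formulas, and nothing else. -/

/-- A numerical term. -/
abbrev Num : Type := ℕ → Term
/-- A set variable. -/
abbrev SetVar : Type := ℕ → ℕ
/-- A formula. -/
abbrev Stmt : Type := ℕ → ℕ → Formula

/-- `∀ n` over numbers. -/
def allN (φ : Num → Stmt) : Stmt :=
  fun d e => .all (φ (fun d' => .var (d' - (d + 1))) (d + 1) e)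
/-- `∃ n` over numbers. -/
def exN (φ : Num → Stmt) : Stmt :=
  fun d e => .ex (φ (fun d' => .var (d' - (d + 1))) (d + 1) e)
/-- `∀ X` over sets. -/
def allS (φ : SetVar → Stmt) : Stmt :=
  fun d e => .allSet (φ (fun e' => e' - (e + 1)) d (e + 1))
/-- `∃ X` over sets. -/
def exS (φ : SetVar → Stmt) : Stmt :=
  fun d e => .exSet (φ (fun e' => e' - (e + 1)) d (e + 1))

def nZero : Num := fun _ => .zero
def nOne : Num := fun _ => .one
def nAdd (s t : Num) : Num := fun d => .add (s d) (t d)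
def nMul (s t : Num) : Num := fun d => .mul (s d) (t d)
def sEq (s t : Num) : Stmt := fun d _ => .eq (s d) (t d)
def sLt (s t : Num) : Stmt := fun d _ => .lt (s d) (t d)
def sMem (t : Num) (X : SetVar) : Stmt := fun d e => .mem (t d) (X e)
def sNot (φ : Stmt) : Stmt := fun d e => .neg (φ d e)
def sImp (φ ψ : Stmt) : Stmt := fun d e => .imp (φ d e) (ψ d e)
def sAnd (φ ψ : Stmt) : Stmt := fun d e => .and (φ d e) (ψ d e)

local infixl:65 " +' " => nAdd
local infixl:70 " *' " => nMul
local infix:50 " =' " => sEq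
local infix:50 " <' " => sLt
local infix:50 " ∈' " => sMem
local prefix:40 "¬' " => sNot
local infixr:35 " ∧' " => sAnd
local infixr:25 " →' " => sImp

/-! ### Numbers, functions and rationals -/

/-- The numeral `k`. -/
def nLit : ℕ → Num
  | 0 => nZero
  | k + 1 => nLit k +' nOne

/-- The code `(i + j)² + i` of the pair `(i, j)`. -/
def nPair (i j : Num) : Num := (i +' j) *' (i +' j) +' i

/-- `f(i) = j`, for a function coded as a set of pairs. -/
def sApp (f : SetVar) (i j : Num) : Stmt := nPair i j ∈' f

/-- A sequence given by its graph: `G n z` says that its `n`-th term is `z`. -/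
abbrev Graph : Type := Num → Num → Stmt

/-- For every `n` there is exactly one `z` with `G n z`. -/
def sTotal (G : Graph) : Stmt :=
  allN fun n => exN fun z => G n z ∧' allN fun w => G n w →' w =' z

/-- `f` is a function from numbers to numbers. -/
def sFun (f : SetVar) : Stmt :=
  (allN fun u => u ∈' f →' exN fun i => exN fun j => u =' nPair i j) ∧' sTotal (sApp f)

/-- `2 ^ n = p`: the function `f` with `f(0) = 1` and `f(i + 1) = 2 f(i)` takes the value `p`
at `n`. -/
def sPow2 (n p : Num) : Stmt :=
  exS fun f => sFun f ∧' sApp f nZero nOne ∧'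
    (allN fun i => allN fun j => sApp f i j →' sApp f (i +' nOne) (nLit 2 *' j)) ∧' sApp f n p

/-- The rational number `(pos - neg) / den`; always used with `den > 0`. -/
structure RatTerm where
  pos : Num
  neg : Num
  den : Num

/-- Addition of rational numbers. -/
def RatTerm.add (x y : RatTerm) : RatTerm :=
  ⟨x.pos *' y.den +' y.pos *' x.den, x.neg *' y.den +' y.neg *' x.den, x.den *' y.den⟩

/-- The rational number `k / p`. -/
def RatTerm.frac (k p : Num) : RatTerm := ⟨k, nZero, p⟩

/-- `x < y` for rational numbers. -/
def RatTerm.lt (x y : RatTerm) : Stmt :=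
  x.pos *' y.den +' y.neg *' x.den <' y.pos *' x.den +' x.neg *' y.den

/-- The code of the rational number `(p - q) / (r + 1)`. -/
def nRat (p q r : Num) : Num := nPair (nPair p q) r

/-- `z` codes a rational number that has the property `φ`. -/
def sRat (z : Num) (φ : RatTerm → Stmt) : Stmt :=
  exN fun p => exN fun q => exN fun r => z =' nRat p q r ∧' φ ⟨p, q, r +' nOne⟩

/-! ### Reals

A real is a sequence of rationals with `|x_n - x_{n+1}| < 2^{-n}`, so that the `n`-th term differs
from the limit by at most `2 * 2^{-n}`. -/

/-- The sequence with graph `G` is a real number. -/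
def sIsReal (G : Graph) : Stmt :=
  sTotal G ∧' allN fun n => exN fun z => exN fun w => exN fun p =>
    G n z ∧' G (n +' nOne) w ∧' sPow2 n p ∧' sRat z fun x => sRat w fun y =>
      x.lt (y.add (.frac nOne p)) ∧' y.lt (x.add (.frac nOne p))

/-- A real quantity: `approx n φ` says that its `n`-th rational approximation has the property `φ`;
this approximation differs from the quantity by at most `err * 2^{-n}`. -/
structure Quantity where
  approx : Num → (RatTerm → Stmt) → Stmt
  err : ℕ

/-- The real coded by the sequence with graph `G`. -/
def Quantity.ofGraph (G : Graph) : Quantity :=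
  ⟨fun n φ => exN fun z => G n z ∧' sRat z φ, 2⟩

/-- A rational number as a real. -/
def Quantity.ofRat (x : RatTerm) : Quantity := ⟨fun _ φ => φ x, 0⟩

def Quantity.zero : Quantity := .ofRat (.frac nZero nOne)

def Quantity.add (x y : Quantity) : Quantity :=
  ⟨fun n φ => x.approx n fun u => y.approx n fun v => φ (u.add v), x.err + y.err⟩

/-- `x < y`: for some `n` the `n`-th approximations prove it. -/
def Quantity.lt (x y : Quantity) : Stmt :=
  exN fun n => exN fun p => sPow2 n p ∧' x.approx n fun u => y.approx n fun v =>
    (u.add (.frac (nLit (x.err + y.err)) p)).lt v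

def Quantity.le (x y : Quantity) : Stmt := ¬' y.lt x

def Quantity.eq (x y : Quantity) : Stmt := x.le y ∧' y.le x

/-- The real coded by the set `q`. -/
def Quantity.ofSet (q : SetVar) : Quantity := .ofGraph (sApp q)

/-- `q ∈ ℝ⁺`. -/
def sPosReal (q : SetVar) : Stmt :=
  sFun q ∧' sIsReal (sApp q) ∧' Quantity.zero.lt (.ofSet q)

/-! ### Complete separable metric spaces

`A` is the set and `D` the function `A × A → ℝ` of the code; `D` consists of the codes of
`(((a, b), n), z)` such that `z` is the `n`-th rational of the real `d(a, b)`. -/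

/-- The sequence of rationals that is the real `d(a, b)`. -/
def dGraph (D : SetVar) (a b : Num) : Graph := fun n z => sApp D (nPair (nPair a b) n) z

/-- `d(a, b)` for `a, b ∈ A`. -/
def dA (D : SetVar) (a b : Num) : Quantity := .ofGraph (dGraph D a b)

/-- `(A, D)` is a code for a complete separable metric space. -/
def sSpace (A D : SetVar) : Stmt :=
  (allN fun u => u ∈' D →' exN fun a => exN fun b => exN fun n => exN fun z =>
    a ∈' A ∧' b ∈' A ∧' u =' nPair (nPair (nPair a b) n) z) ∧'
  (allN fun a => allN fun b => a ∈' A →' b ∈' A →' sIsReal (dGraph D a b)) ∧'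
  (allN fun a => a ∈' A →' (dA D a a).eq .zero) ∧'
  (allN fun a => allN fun b => a ∈' A →' b ∈' A →'
    (dA D a b).eq (dA D b a) ∧' Quantity.zero.le (dA D b a)) ∧'
  (allN fun a => allN fun b => allN fun c => a ∈' A →' b ∈' A →' c ∈' A →'
    (dA D a b).le ((dA D a c).add (dA D c b)))

/-- `x` is a point of the space: a sequence of elements of `A` with
`d(x_n, x_{n+1}) < 2^{-n}`. -/
def sPoint (A D x : SetVar) : Stmt :=
  sFun x ∧' allN fun n => exN fun a => exN fun b => exN fun p =>
    sApp x n a ∧' sApp x (n +' nOne) b ∧' a ∈' A ∧' b ∈' A ∧' sPow2 n p ∧'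
    (dA D a b).lt (.ofRat (.frac nOne p))

/-- The point `a ∈ A`, i.e. the constant sequence `a, a, …`. -/
def constGraph (a : Num) : Graph := fun _ b => b =' a

/-- The distance of two points.  Its `n`-th approximation is that of `d(x_n, y_n)`; as `x_n` and
`y_n` are within `2 * 2^{-n}` of `x` and `y`, the error is at most `(2 + 2 + 2) * 2^{-n}`. -/
def dist (D : SetVar) (x y : Graph) : Quantity :=
  ⟨fun n φ => exN fun a => exN fun b => x n a ∧' y n b ∧' (dA D a b).approx n φ, 6⟩

/-- `y ∈ B(x, q)`. -/
def sBall (D x q y : SetVar) : Stmt := (dist D (sApp x) (sApp y)).lt (.ofSet q)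

/-- `y ∈ P(x, q)`, the punctured ball. -/
def sPunctured (D x q y : SetVar) : Stmt :=
  Quantity.zero.lt (dist D (sApp x) (sApp y)) ∧' sBall D x q y

/-- `x` is an isolated point. -/
def sIsolated (A D x : SetVar) : Stmt :=
  exS fun q => sPosReal q ∧' ¬' exS fun y => sPoint A D y ∧' sPunctured D x q y

/-- The space is perfect. -/
def sPerfect (A D : SetVar) : Stmt := allS fun x => sPoint A D x →' ¬' sIsolated A D x

/-- `U` is a sequence `⟨U_n⟩` of open sets, each `U_n` being a sequence `⟨(a_{n,m}, q_{n,m})⟩` of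
elements of `A × ℚ⁺`; `U` is the function that maps `(n, m)` to `(a_{n,m}, q_{n,m})`. -/
def sOpenSeq (A U : SetVar) : Stmt :=
  (allN fun u => u ∈' U →' exN fun n => exN fun m => exN fun z => u =' nPair (nPair n m) z) ∧'
  (allN fun n => sTotal fun m z => sApp U (nPair n m) z) ∧'
  (allN fun n => allN fun m => exN fun a => exN fun z =>
    sApp U (nPair n m) (nPair a z) ∧' a ∈' A ∧' sRat z fun r => (RatTerm.frac nZero nOne).lt r)

/-- `x ∈ U_n`: there is an `m` with `d(x, a_{n,m}) < q_{n,m}`. -/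
def sMemOpen (D U : SetVar) (n : Num) (x : SetVar) : Stmt :=
  exN fun m => exN fun a => exN fun z => sApp U (nPair n m) (nPair a z) ∧'
    sRat z fun r => (dist D (sApp x) (constGraph a)).lt (.ofRat r)

/-- `U` is an open covering of the space. -/
def sCovering (A D U : SetVar) : Stmt :=
  sOpenSeq A U ∧' allS fun x => sPoint A D x →' exN fun n => sMemOpen D U n x

/-- The space is Lebesgue: every open covering `U` has a Lebesgue number `q`. -/
def sLebesgue (A D : SetVar) : Stmt :=
  allS fun U => sCovering A D U →' exS fun q => sPosReal q ∧'
    allS fun x => sPoint A D x →' exN fun n =>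
      allS fun y => sPoint A D y →' sBall D x q y →' sMemOpen D U n y

/-- The space is Heine-Borel compact: for every open covering `U` there is a finite set `F` of
indices such that the `U_n` with `n ∈ F` cover the space. -/
def sHeineBorel (A D : SetVar) : Stmt :=
  allS fun U => sCovering A D U →' exS fun F =>
    (exN fun k => allN fun n => n ∈' F →' n <' k) ∧'
    allS fun x => sPoint A D x →' exN fun n => n ∈' F ∧' sMemOpen D U n x

/-- The sentence "every complete separable metric space which is perfect and Lebesgue is
Heine-Borel compact". -/
def perfectLebesgueHeineBorel : Formula :=
  (allS fun A => allS fun D =>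
    sSpace A D →' sPerfect A D →' sLebesgue A D →' sHeineBorel A D) 0 0

end SecondOrderArithmetic

/-! Let `U_n` be the union over `m` of the balls `B(a_{n,m}, q_{n,m})`, and suppose that no finitely
many `U_n` cover. For each `k` some point avoids `U_0, …, U_{k-1}`. Approximating it in `A` and
using perfectness gives distinct `b_k, b'_k ∈ A` with `d(b_k, b'_k) < 2^{-k}` and `d(b_k, a_{n,m}) >
q_{n,m} - 2^{-k}` for all `n, m < k`. These conditions are `Σ⁰₁`, so by `Sig.exists_choice` the
pairs can be chosen as a sequence of the model (`exists_isEscape`).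

Call a ball `B(a, s)` good if for some `n, m, j` it satisfies `d(a, a_{n,m}) + s < q_{n,m} -
2^{-j}`, and `2s < d(b_k, b'_k)` for all `k ≤ n + m + j`. The good balls cover the space
(`exists_isGoodBall`): a point lies in some `B(a_{n,m}, q_{n,m})` with room to spare, and then only
finitely many pairs restrict the radius; `Σ⁰₁` collection bounds them all at once. Being a good ball
is `Σ⁰₁`, so the good balls can be listed as an open covering. If `2^{-k}` is below a Lebesgue
number of that covering, then `b_k` and `b'_k` lie in one good ball, whence `d(b_k, b'_k) < 2s` and
so `k > n + m + j`. But then `d(b_k, a_{n,m}) < q_{n,m} - 2^{-j} ≤ q_{n,m} - 2^{-k}`, which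
contradicts the choice of `b_k` (`false_of_isEscape`).

Derivability is reduced to truth in all countable models of `RCA₀` by a Henkin completeness theorem
(`derives_of_forall_model`), and `eval_perfectLebesgueHeineBorel` unfolds the sentence in a model.
There the argument is ordinary mathematics, except that induction, choice and comprehension apply
only to relations defined in the model. Definability is tracked by closure lemmas for `Bdd`
(bounded), `Sig` (`Σ⁰₁`), `Fn` (functions with `Σ⁰₁` graph) and `RatFn`. Real numbers are replaced
by germs of rational sequences along an ultrafilter. These live outside the model, form an ordered
field and are compared up to infinitesimals. Whatever enters an induction or a comprehension is
stated through the `Σ⁰₁` relations `Near` and `Far` on rational approximations. -/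

namespace SecondOrderArithmetic

/-! ### Substitution -/

/-- The sequence `x, v 0, v 1, …`. -/
def cons {α : Type*} (x : α) (v : ℕ → α) : ℕ → α
  | 0 => x
  | i + 1 => v i

@[simp] theorem cons_zero {α : Type*} (x : α) (v : ℕ → α) : cons x v 0 = x := rfl

@[simp] theorem cons_succ {α : Type*} (x : α) (v : ℕ → α) (i : ℕ) : cons x v (i + 1) = v i := rfl

namespace Term

theorem subst_subst (t : Term) (σ τ : ℕ → Term) :
    (t.subst σ).subst τ = t.subst fun i => (σ i).subst τ := by
  induction t <;> simp_all [subst]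

@[simp] theorem subst_var (t : Term) : t.subst var = t := by
  induction t <;> simp_all [subst]

theorem shift_subst (t : Term) (σ : ℕ → Term) : t.shift.subst σ = t.subst fun i => σ (i + 1) := by
  simp [shift, subst_subst, subst]

@[simp] theorem shift_subst_cons (s t : Term) : t.shift.subst (cons s var) = t := by
  simp [shift_subst]

theorem up_subst_up (σ τ : ℕ → Term) :
    (fun i => (up σ i).subst (up τ)) = up fun i => (σ i).subst τ := by
  funext i
  cases i with
  | zero => rfl
  | succ i => simp [up, shift_subst]; simp [shift, subst_subst]

theorem up_var : up var = var := by
  funext i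
  cases i <;> rfl

theorem exists_bound (t : Term) :
    ∃ N, ∀ σ τ : ℕ → Term, (∀ i < N, σ i = τ i) → t.subst σ = t.subst τ := by
  induction t with
  | var i => exact ⟨i + 1, fun σ τ h => h i (Nat.lt_succ_self i)⟩
  | zero => exact ⟨0, fun _ _ _ => rfl⟩
  | one => exact ⟨0, fun _ _ _ => rfl⟩
  | add s t hs ht | mul s t hs ht =>
    obtain ⟨a, ha⟩ := hs
    obtain ⟨b, hb⟩ := ht
    refine ⟨max a b, fun σ τ h => ?_⟩
    simp only [subst]
    rw [ha σ τ fun i hi => h i (lt_max_of_lt_left hi),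
      hb σ τ fun i hi => h i (lt_max_of_lt_right hi)]

end Term

namespace Formula

theorem upSet_upSet (ρ π : ℕ → ℕ) : (fun i => upSet π (upSet ρ i)) = upSet fun i => π (ρ i) := by
  funext i
  cases i <;> rfl

theorem upSet_id : upSet (fun i => i) = fun i => i := by
  funext i
  cases i <;> rfl

theorem subst_subst (φ : Formula) (σ τ : ℕ → Term) (ρ π : ℕ → ℕ) :
    (φ.subst σ ρ).subst τ π = φ.subst (fun i => (σ i).subst τ) fun i => π (ρ i) := by
  induction φ generalizing σ τ ρ π with
  | all φ ih => simp only [subst, ih, Term.up_subst_up]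
  | allSet φ ih => simp only [subst, ih, upSet_upSet]
  | _ => simp_all [subst, Term.subst_subst]

theorem subst_var_id (φ : Formula) : φ.subst .var (fun i => i) = φ := by
  induction φ with
  | all φ ih => simp only [subst, Term.up_var, ih]
  | allSet φ ih => simp only [subst, upSet_id, ih]
  | _ => simp_all [subst]

theorem inst_eq (φ : Formula) (t : Term) : φ.inst t = φ.subst (cons t .var) fun i => i := by
  unfold inst
  congr 1

theorem instSet_eq (φ : Formula) (X : ℕ) :
    φ.instSet X = φ.subst .var (cons X fun i => i) := by
  unfold instSet
  congr 1

theorem subst_up_inst (φ : Formula) (σ : ℕ → Term) (ρ : ℕ → ℕ) (t : Term) :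
    (φ.subst (Term.up σ) ρ).inst t = φ.subst (cons t σ) ρ := by
  rw [inst_eq, subst_subst]
  congr 1
  funext i
  cases i <;> simp [Term.up, Term.subst]

theorem subst_upSet_instSet (φ : Formula) (σ : ℕ → Term) (ρ : ℕ → ℕ) (X : ℕ) :
    (φ.subst σ (upSet ρ)).instSet X = φ.subst σ (cons X ρ) := by
  rw [instSet_eq, subst_subst]
  simp only [Term.subst_var]
  congr 1
  funext i
  cases i <;> rfl

theorem inst_subst (φ : Formula) (σ : ℕ → Term) (ρ : ℕ → ℕ) (t : Term) :
    (φ.inst t).subst σ ρ = (φ.subst (Term.up σ) ρ).inst (t.subst σ) := by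
  rw [subst_up_inst, inst_eq, subst_subst]
  congr 1
  funext i
  cases i <;> rfl

theorem instSet_subst (φ : Formula) (σ : ℕ → Term) (ρ : ℕ → ℕ) (X : ℕ) :
    (φ.instSet X).subst σ ρ = (φ.subst σ (upSet ρ)).instSet (ρ X) := by
  rw [subst_upSet_instSet, instSet_eq, subst_subst]
  simp only [Term.subst]
  congr 1
  funext i
  cases i <;> rfl

theorem shift_subst_up (φ : Formula) (σ : ℕ → Term) (ρ : ℕ → ℕ) :
    φ.shift.subst (Term.up σ) ρ = (φ.subst σ ρ).shift := by
  simp only [shift, subst_subst, Term.subst, Term.up, id]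
  rfl

theorem shiftSet_subst_upSet (φ : Formula) (σ : ℕ → Term) (ρ : ℕ → ℕ) :
    φ.shiftSet.subst σ (upSet ρ) = (φ.subst σ ρ).shiftSet := by
  simp only [shiftSet, subst_subst, Term.subst_var, Term.subst, upSet]

/-- Only finitely many variables occur free. This provides fresh variables for finite sets of
formulas, and universal closures by finitely many quantifiers. -/
theorem exists_bound (φ : Formula) :
    ∃ N, ∀ (σ τ : ℕ → Term) (ρ π : ℕ → ℕ), (∀ i < N, σ i = τ i) → (∀ i < N, ρ i = π i) →
      φ.subst σ ρ = φ.subst τ π := by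
  induction φ with
  | eq s t | lt s t =>
    obtain ⟨a, ha⟩ := s.exists_bound
    obtain ⟨b, hb⟩ := t.exists_bound
    refine ⟨max a b, fun σ τ ρ π h _ => ?_⟩
    simp only [subst]
    rw [ha σ τ fun i hi => h i (lt_max_of_lt_left hi),
      hb σ τ fun i hi => h i (lt_max_of_lt_right hi)]
  | mem t X =>
    obtain ⟨a, ha⟩ := t.exists_bound
    refine ⟨max a (X + 1), fun σ τ ρ π h h' => ?_⟩
    simp only [subst]
    rw [ha σ τ fun i hi => h i (lt_max_of_lt_left hi), h' X (by simp)]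
  | bot => exact ⟨0, fun _ _ _ _ _ _ => rfl⟩
  | imp φ ψ hφ hψ =>
    obtain ⟨a, ha⟩ := hφ
    obtain ⟨b, hb⟩ := hψ
    refine ⟨max a b, fun σ τ ρ π h h' => ?_⟩
    simp only [subst]
    rw [ha σ τ ρ π (fun i hi => h i (lt_max_of_lt_left hi)) fun i hi => h' i (lt_max_of_lt_left hi),
      hb σ τ ρ π (fun i hi => h i (lt_max_of_lt_right hi)) fun i hi => h' i (lt_max_of_lt_right hi)]
  | all φ hφ =>
    obtain ⟨a, ha⟩ := hφ
    refine ⟨a, fun σ τ ρ π h h' => ?_⟩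
    simp only [subst]
    rw [ha _ _ ρ π (fun i hi => ?_) h']
    cases i with
    | zero => rfl
    | succ i => simp only [Term.up, h i (by omega)]
  | allSet φ hφ =>
    obtain ⟨a, ha⟩ := hφ
    refine ⟨a, fun σ τ ρ π h h' => ?_⟩
    simp only [subst]
    rw [ha σ τ _ _ h fun i hi => ?_]
    cases i with
    | zero => rfl
    | succ i => simp only [upSet, h' i (by omega)]

end Formula

/-! ### Derivations -/

namespace Derives

open Formula

variable {T Γ Δ : Set Formula} {φ ψ : Formula}

theorem weaken (h : Derives T Γ φ) : ∀ {Δ}, Γ ⊆ Δ → Derives T Δ φ := by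
  induction h with
  | ax h => exact fun _ => ax h
  | hyp h => exact fun hs => hyp (hs h)
  | impI _ ih => exact fun hs => impI (ih (Set.insert_subset_insert hs))
  | impE _ _ ih₁ ih₂ => exact fun hs => impE (ih₁ hs) (ih₂ hs)
  | raa _ ih => exact fun hs => raa (ih (Set.insert_subset_insert hs))
  | allI _ ih => exact fun hs => allI (ih (Set.image_mono hs))
  | allE t _ ih => exact fun hs => allE t (ih hs)
  | allSetI _ ih => exact fun hs => allSetI (ih (Set.image_mono hs))
  | allSetE X _ ih => exact fun hs => allSetE X (ih hs)
  | eqRefl t => exact fun _ => eqRefl t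
  | eqSubst _ _ ih₁ ih₂ => exact fun hs => eqSubst (ih₁ hs) (ih₂ hs)

theorem iterate_all (h : Derives T ∅ φ) (N : ℕ) : Derives T ∅ (Formula.all^[N] φ) := by
  induction N with
  | zero => exact h
  | succ N ih =>
    rw [Function.iterate_succ_apply']
    exact allI (by simpa using ih)

theorem iterate_allSet (h : Derives T ∅ φ) (N : ℕ) : Derives T ∅ (Formula.allSet^[N] φ) := by
  induction N with
  | zero => exact h
  | succ N ih =>
    rw [Function.iterate_succ_apply']
    exact allSetI (by simpa using ih)

/-- Instantiating the quantifiers one after the other amounts to one simultaneous substitution,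
since terms are inserted capture-free. -/
theorem of_iterate_all (N : ℕ) : ∀ (φ : Formula) (t : ℕ → Term),
    Derives T Γ (Formula.all^[N] φ) →
    Derives T Γ (φ.subst (fun i => if i < N then t i else .var (i - N)) fun i => i) := by
  induction N with
  | zero => intro φ t h; simpa [subst_var_id] using h
  | succ N ih =>
    intro φ t h
    rw [Function.iterate_succ_apply] at h
    have := allE (t 0) (ih _ (fun i => t (i + 1)) h)
    rw [subst_up_inst] at this
    convert this using 2
    funext i
    cases i <;> simp

theorem of_iterate_allSet (N : ℕ) : ∀ (φ : Formula) (X : ℕ → ℕ),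
    Derives T Γ (Formula.allSet^[N] φ) →
    Derives T Γ (φ.subst .var fun i => if i < N then X i else i - N) := by
  induction N with
  | zero => intro φ t h; simpa [subst_var_id] using h
  | succ N ih =>
    intro φ X h
    rw [Function.iterate_succ_apply] at h
    have := allSetE (X 0) (ih _ (fun i => X (i + 1)) h)
    rw [subst_upSet_instSet] at this
    convert this using 2
    funext i
    cases i <;> simp

/-- An axiom is derivable without assumptions, so all its free variables may be generalized and then
instantiated; assumptions are added only afterwards by weakening. -/
theorem ax_subst (h : φ ∈ T) (σ : ℕ → Term) (ρ : ℕ → ℕ) : Derives T Γ (φ.subst σ ρ) := by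
  obtain ⟨N, hN⟩ := φ.exists_bound
  have h₁ : Derives T ∅ φ := ax h
  have h₂ := of_iterate_allSet N _ ρ (iterate_allSet h₁ N)
  have h₃ := of_iterate_all N _ σ (iterate_all h₂ N)
  rw [subst_subst] at h₃
  rw [hN σ _ ρ _ _ _]
  · exact h₃.weaken (Set.empty_subset _)
  · intro i hi; simp [Term.subst, hi]
  · intro i hi; simp [hi]

/-- Every rule commutes with substitution; only the axioms, which are not themselves substituted,
need `ax_subst`. The purpose is renaming a fresh variable into the bound one. -/
theorem subst (h : Derives T Γ φ) : ∀ (σ : ℕ → Term) (ρ : ℕ → ℕ),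
    Derives T ((fun ψ => ψ.subst σ ρ) '' Γ) (φ.subst σ ρ) := by
  induction h with
  | ax h => exact fun σ ρ => ax_subst h σ ρ
  | hyp h => exact fun σ ρ => hyp (Set.mem_image_of_mem _ h)
  | impI _ ih => exact fun σ ρ => impI (by simpa [Set.image_insert_eq] using ih σ ρ)
  | impE _ _ ih₁ ih₂ => exact fun σ ρ => impE (ih₁ σ ρ) (ih₂ σ ρ)
  | raa _ ih =>
    intro σ ρ
    have := ih σ ρ
    rw [Set.image_insert_eq] at this
    exact raa this
  | allI _ ih =>
    refine fun σ ρ => allI ?_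
    simpa [Set.image_image, shift_subst_up] using ih (Term.up σ) ρ
  | allE t _ ih => exact fun σ ρ => inst_subst _ σ ρ t ▸ allE _ (ih σ ρ)
  | allSetI _ ih =>
    refine fun σ ρ => allSetI ?_
    simpa [Set.image_image, shiftSet_subst_upSet] using ih σ (upSet ρ)
  | allSetE X _ ih => exact fun σ ρ => instSet_subst _ σ ρ X ▸ allSetE _ (ih σ ρ)
  | eqRefl t => exact fun σ ρ => eqRefl _
  | eqSubst _ _ ih₁ ih₂ =>
    intro σ ρ
    have h₂ := ih₂ σ ρ
    rw [inst_subst] at h₂ ⊢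
    exact eqSubst (ih₁ σ ρ) h₂

theorem exists_common_bound (hΓ : Γ.Finite) :
    ∃ N, ∀ φ ∈ Γ, ∀ (σ τ : ℕ → Term) (ρ π : ℕ → ℕ), (∀ i < N, σ i = τ i) → (∀ i < N, ρ i = π i) →
      φ.subst σ ρ = φ.subst τ π := by
  choose b hb using Formula.exists_bound
  obtain ⟨N, hN⟩ := (hΓ.image b).bddAbove
  refine ⟨N, fun φ hφ σ τ ρ π h h' => hb φ σ τ ρ π (fun i hi => h i ?_) fun i hi => h' i ?_⟩ <;>
  exact hi.trans_le (hN (Set.mem_image_of_mem b hφ))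

theorem exists_all_fresh (hΓ : Γ.Finite) (φ : Formula) :
    ∃ t, Derives T Γ (φ.inst t) → Derives T Γ (.all φ) := by
  obtain ⟨N, hN⟩ := exists_common_bound (hΓ.insert φ)
  refine ⟨.var N, fun h => allI ?_⟩
  -- The fresh variable `N` becomes variable `0` and all others move up by one. On the assumptions,
  -- where `N` does not occur, this is `shift`, as the premise of `allI` requires.
  have := h.subst (fun i => if i = N then .var 0 else .var (i + 1)) fun i => i
  convert this using 1
  · refine Set.image_congr fun ψ hψ => ?_
    refine hN ψ (Set.mem_insert_of_mem _ hψ) _ _ _ _ (fun i hi => ?_) fun _ _ => rfl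
    simp [hi.ne]
  · rw [inst_eq, subst_subst]
    conv_lhs => rw [← subst_var_id φ]
    refine hN φ (Set.mem_insert _ _) _ _ _ _ (fun i hi => ?_) fun _ _ => rfl
    cases i with
    | zero => simp [Term.subst]
    | succ i => simp [Term.subst, show i ≠ N by omega]

theorem exists_allSet_fresh (hΓ : Γ.Finite) (φ : Formula) :
    ∃ X, Derives T Γ (φ.instSet X) → Derives T Γ (.allSet φ) := by
  obtain ⟨N, hN⟩ := exists_common_bound (hΓ.insert φ)
  refine ⟨N, fun h => allSetI ?_⟩
  have := h.subst .var fun i => if i = N then 0 else i + 1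
  convert this using 1
  · refine Set.image_congr fun ψ hψ => ?_
    refine hN ψ (Set.mem_insert_of_mem _ hψ) _ _ _ _ (fun _ _ => rfl) fun i hi => ?_
    simp [hi.ne]
  · rw [instSet_eq, subst_subst]
    conv_lhs => rw [← subst_var_id φ]
    refine hN φ (Set.mem_insert _ _) _ _ _ _ (fun i _ => by simp) fun i hi => ?_
    cases i with
    | zero => simp
    | succ i => simp [show i ≠ N by omega]

theorem mono_left (h : Derives T Γ φ) : Derives T (insert ψ Γ) φ := h.weaken (Set.subset_insert _ _)

theorem hyp_head : Derives T (insert φ Γ) φ := hyp (Set.mem_insert _ _)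

theorem hyp_snd : Derives T {φ, ψ} ψ := hyp (Set.mem_insert_of_mem _ rfl)

theorem cut (h : Derives T Γ φ) (h' : Derives T (insert φ Γ) ψ) : Derives T Γ ψ := impE (impI h') h

theorem efq (h : Derives T Γ .bot) : Derives T Γ φ := raa h.mono_left

theorem eq_symm {s t : Term} (h : Derives T Γ (.eq s t)) : Derives T Γ (.eq t s) := by
  have := eqSubst (φ := .eq (.var 0) s.shift) h
  simp only [inst_eq, Formula.subst, Term.subst, cons_zero, Term.shift_subst_cons] at this
  exact this (eqRefl s)

theorem eq_trans {r s t : Term} (h : Derives T Γ (.eq r s)) (h' : Derives T Γ (.eq s t)) :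
    Derives T Γ (.eq r t) := by
  have := eqSubst (φ := .eq r.shift (.var 0)) h'
  simp only [inst_eq, Formula.subst, Term.subst, cons_zero, Term.shift_subst_cons] at this
  exact this h

theorem eq_add {s s' t t' : Term} (h : Derives T Γ (.eq s s')) (h' : Derives T Γ (.eq t t')) :
    Derives T Γ (.eq (.add s t) (.add s' t')) := by
  have h₁ := eqSubst (φ := .eq (Term.add s t).shift (.add (.var 0) t.shift)) h
  have h₂ := eqSubst (φ := .eq (Term.add s t).shift (.add s'.shift (.var 0))) h'
  simp only [inst_eq, Formula.subst, Term.subst, cons_zero, Term.shift_subst_cons] at h₁ h₂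
  exact h₂ (h₁ (eqRefl _))

theorem eq_mul {s s' t t' : Term} (h : Derives T Γ (.eq s s')) (h' : Derives T Γ (.eq t t')) :
    Derives T Γ (.eq (.mul s t) (.mul s' t')) := by
  have h₁ := eqSubst (φ := .eq (Term.mul s t).shift (.mul (.var 0) t.shift)) h
  have h₂ := eqSubst (φ := .eq (Term.mul s t).shift (.mul s'.shift (.var 0))) h'
  simp only [inst_eq, Formula.subst, Term.subst, cons_zero, Term.shift_subst_cons] at h₁ h₂
  exact h₂ (h₁ (eqRefl _))

theorem lt_congr {s s' t t' : Term} (h : Derives T Γ (.eq s s')) (h' : Derives T Γ (.eq t t'))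
    (hl : Derives T Γ (.lt s t)) : Derives T Γ (.lt s' t') := by
  have h₁ := eqSubst (φ := .lt (.var 0) t.shift) h
  have h₂ := eqSubst (φ := .lt s'.shift (.var 0)) h'
  simp only [inst_eq, Formula.subst, Term.subst, cons_zero, Term.shift_subst_cons] at h₁ h₂
  exact h₂ (h₁ hl)

theorem mem_congr {s s' : Term} {X : ℕ} (h : Derives T Γ (.eq s s'))
    (hl : Derives T Γ (.mem s X)) : Derives T Γ (.mem s' X) := by
  have h₁ := eqSubst (φ := .mem (.var 0) X) h
  simp only [inst_eq, Formula.subst, Term.subst, cons_zero] at h₁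
  exact h₁ hl

end Derives

/-! ### Countability of the syntax -/

namespace Term

/-- A number that determines the term. -/
def code : Term → ℕ
  | var i => Nat.pair 0 i
  | zero => Nat.pair 1 0
  | one => Nat.pair 2 0
  | add s t => Nat.pair 3 (Nat.pair s.code t.code)
  | mul s t => Nat.pair 4 (Nat.pair s.code t.code)

theorem code_injective : Function.Injective code := by
  intro s
  induction s <;> intro t h <;> cases t <;> simp [code] at h <;> grind

instance : Countable Term := code_injective.countable

end Term

namespace Formula

/-- A number that determines the formula. -/
def code : Formula → ℕ
  | eq s t => Nat.pair 0 (Nat.pair s.code t.code)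
  | lt s t => Nat.pair 1 (Nat.pair s.code t.code)
  | mem t X => Nat.pair 2 (Nat.pair t.code X)
  | bot => Nat.pair 3 0
  | imp φ ψ => Nat.pair 4 (Nat.pair φ.code ψ.code)
  | all φ => Nat.pair 5 φ.code
  | allSet φ => Nat.pair 6 φ.code

theorem code_injective : Function.Injective code := by
  intro φ
  induction φ <;> intro ψ h <;> cases ψ <;> simp [code, Term.code_injective.eq_iff] at h <;> grind

instance : Nonempty Formula := ⟨bot⟩

instance : Countable Formula := code_injective.countable

end Formula

/-! ### Structures -/

section Eval

variable {M S : Type} [Zero M] [One M] [Add M] [Mul M]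

/-- The value of a term. -/
def Term.eval (v : ℕ → M) : Term → M
  | var i => v i
  | zero => 0
  | one => 1
  | add s t => s.eval v + t.eval v
  | mul s t => s.eval v * t.eval v

/-- Truth of a formula, set variables ranging over `S`. -/
def Formula.eval [LT M] [Membership M S] : Formula → (ℕ → M) → (ℕ → S) → Prop
  | eq s t, v, _ => s.eval v = t.eval v
  | lt s t, v, _ => s.eval v < t.eval v
  | mem t X, v, w => t.eval v ∈ w X
  | bot, _, _ => False
  | imp φ ψ, v, w => φ.eval v w → ψ.eval v w
  | all φ, v, w => ∀ x, φ.eval (cons x v) w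
  | allSet φ, v, w => ∀ X, φ.eval v (cons X w)

end Eval

/-! ### Completeness -/

section Completeness

open Formula Derives

variable {T : Set Formula}

/-- Finite sets of assumptions always leave fresh variables, so the variables themselves serve as
Henkin constants and the language is not extended. -/
theorem exists_henkin_step {Γ : Set Formula} (hΓ : Γ.Finite) (hc : ¬ Derives T Γ .bot)
    (φ : Formula) :
    ∃ Δ : Set Formula, Γ ⊆ Δ ∧ Δ.Finite ∧ ¬ Derives T Δ .bot ∧
      (φ ∈ Δ ∨ neg φ ∈ Δ ∧ (∀ ψ, φ = .all ψ → ∃ t, neg (ψ.inst t) ∈ Δ) ∧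
        ∀ ψ, φ = .allSet ψ → ∃ X, neg (ψ.instSet X) ∈ Δ) := by
  by_cases h : Derives T (insert φ Γ) .bot
  · have hc' : ¬ Derives T (insert (neg φ) Γ) .bot := fun h' => hc (cut (impI h) h')
    have hf := hΓ.insert (neg φ)
    -- Here `χ` is an instance of `φ` at a fresh variable. Were its negation refutable, `χ` and
    -- hence the quantified `φ` would be derivable, against `neg φ`.
    have key : ∀ χ, (Derives T (insert (neg φ) Γ) χ → Derives T (insert (neg φ) Γ) φ) →
        ¬ Derives T (insert (neg χ) (insert (neg φ) Γ)) .bot := fun χ hχ hb =>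
      hc' (impE hyp_head (hχ (raa hb)))
    have sub : ∀ χ, Γ ⊆ insert (neg χ) (insert (neg φ) Γ) := fun χ x hx => by simp [hx]
    cases φ with
    | all ψ =>
      obtain ⟨t, ht⟩ := exists_all_fresh (T := T) hf ψ
      refine ⟨_, sub (ψ.inst t), hf.insert _, key _ ht, Or.inr ⟨by simp, ?_, by simp⟩⟩
      rintro _ ⟨⟩
      exact ⟨t, Set.mem_insert _ _⟩
    | allSet ψ =>
      obtain ⟨t, ht⟩ := exists_allSet_fresh (T := T) hf ψ
      refine ⟨_, sub (ψ.instSet t), hf.insert _, key _ ht, Or.inr ⟨by simp, by simp, ?_⟩⟩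
      rintro _ ⟨⟩
      exact ⟨t, Set.mem_insert _ _⟩
    | _ => exact ⟨_, Set.subset_insert _ _, hf, hc', Or.inr ⟨Set.mem_insert _ _, by simp, by simp⟩⟩
  · exact ⟨_, Set.subset_insert _ _, hΓ.insert φ, h, Or.inl (Set.mem_insert _ _)⟩

/-- A complete consistent theory with witnesses. -/
structure IsHenkin (T Th : Set Formula) : Prop where
  closed {Γ : Set Formula} {φ : Formula} : Γ.Finite → Γ ⊆ Th → Derives T Γ φ → φ ∈ Th
  bot : Formula.bot ∉ Th
  total (φ : Formula) : φ ∈ Th ∨ neg φ ∈ Th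
  all (φ : Formula) : (∀ t, φ.inst t ∈ Th) → Formula.all φ ∈ Th
  allSet (φ : Formula) : (∀ X, φ.instSet X ∈ Th) → Formula.allSet φ ∈ Th

/-- All formulas are decided along an enumeration, and the union of the stages is taken. A finite
subset of the union lies in one stage. As `IsHenkin.closed` asks only about finite sets of
assumptions, compactness of derivations is not needed. -/
theorem exists_isHenkin {χ : Formula} (h : ¬ Derives T ∅ χ) : ∃ Th, IsHenkin T Th ∧ neg χ ∈ Th := by
  classical
  obtain ⟨f, hf⟩ := exists_surjective_nat Formula
  let C := {Γ : Set Formula // Γ.Finite ∧ ¬ Derives T Γ .bot}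
  have hstep : ∀ (Γ : C) (φ : Formula), ∃ Δ : C, Γ.1 ⊆ Δ.1 ∧
      (φ ∈ Δ.1 ∨ neg φ ∈ Δ.1 ∧ (∀ ψ, φ = .all ψ → ∃ t, neg (ψ.inst t) ∈ Δ.1) ∧
        ∀ ψ, φ = .allSet ψ → ∃ X, neg (ψ.instSet X) ∈ Δ.1) := by
    rintro ⟨Γ, hΓ, hc⟩ φ
    obtain ⟨Δ, h₁, h₂, h₃, h₄⟩ := exists_henkin_step hΓ hc φ
    exact ⟨⟨Δ, h₂, h₃⟩, h₁, h₄⟩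
  choose next hsub hnext using hstep
  have h0 : ¬ Derives T (insert (neg χ) ∅) .bot := fun h' => h (raa h')
  let G : ℕ → C := fun n =>
    Nat.rec ⟨insert (neg χ) ∅, Set.finite_empty.insert _, h0⟩ (fun n Γ => next Γ (f n)) n
  have mono : Monotone fun n => (G n).1 := monotone_nat_of_le_succ fun n => hsub _ _
  have con : ∀ n, ¬ Derives T (G n).1 .bot := fun n => (G n).2.2
  have fin : ∀ Γ : Set Formula, Γ.Finite → Γ ⊆ ⋃ n, (G n).1 → ∃ n, Γ ⊆ (G n).1 := fun Γ hΓ hs => by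
    simpa using DirectedOn.exists_mem_subset_of_finite_of_subset_sUnion
      (c := Set.range fun n => (G n).1) (Set.range_nonempty _)
      (directedOn_range.2 mono.directed_le) hΓ (by simpa [Set.sUnion_range] using hs)
  have not_both : ∀ φ, φ ∈ ⋃ n, (G n).1 → neg φ ∉ ⋃ n, (G n).1 := fun φ h₁ h₂ => by
    obtain ⟨n, hn⟩ := fin {φ, neg φ} (by simp) (by intro x; simp; rintro (rfl | rfl) <;> simp_all)
    exact con n (impE (hyp (hn (Set.mem_insert_of_mem _ rfl))) (hyp (hn (Set.mem_insert _ _))))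
  have hdec : ∀ φ, (φ ∈ ⋃ n, (G n).1) ∨ neg φ ∈ (⋃ n, (G n).1) ∧
      (∀ ψ, φ = .all ψ → ∃ t, neg (ψ.inst t) ∈ ⋃ n, (G n).1) ∧
        ∀ ψ, φ = .allSet ψ → ∃ X, neg (ψ.instSet X) ∈ ⋃ n, (G n).1 := fun φ => by
    obtain ⟨n, rfl⟩ := hf φ
    have up : ∀ x, x ∈ (next (G n) (f n)).1 → x ∈ ⋃ n, (G n).1 := fun x hx =>
      Set.mem_iUnion.2 ⟨n + 1, hx⟩
    rcases hnext (G n) (f n) with h | ⟨h₁, h₂, h₃⟩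
    · exact Or.inl (up _ h)
    · exact Or.inr ⟨up _ h₁, fun ψ hψ => (h₂ ψ hψ).imp fun t => up _,
        fun ψ hψ => (h₃ ψ hψ).imp fun t => up _⟩
  refine ⟨⋃ n, (G n).1, ⟨fun {Γ φ} hΓ hs hd => ?_, fun hb => ?_, fun φ => ?_, fun φ ha => ?_,
    fun φ ha => ?_⟩, Set.mem_iUnion.2 ⟨0, Set.mem_insert _ _⟩⟩
  · refine (hdec φ).resolve_right fun h' => ?_
    obtain ⟨n, hn⟩ := fin (insert (neg φ) Γ) (hΓ.insert _) (Set.insert_subset h'.1 hs)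
    exact con n (impE (hyp (hn (Set.mem_insert _ _)))
      (hd.weaken ((Set.subset_insert _ _).trans hn)))
  · obtain ⟨n, hn⟩ := Set.mem_iUnion.1 hb
    exact con n (hyp hn)
  · exact (hdec φ).imp id fun h => h.1
  · refine (hdec _).resolve_right fun h' => ?_
    obtain ⟨t, ht⟩ := h'.2.1 φ rfl
    exact not_both _ (ha t) ht
  · refine (hdec _).resolve_right fun h' => ?_
    obtain ⟨t, ht⟩ := h'.2.2 φ rfl
    exact not_both _ (ha t) ht

namespace IsHenkin

variable {Th : Set Formula}

theorem closed₁ (H : IsHenkin T Th) {φ ψ : Formula} (h : Derives T {φ} ψ) (hφ : φ ∈ Th) : ψ ∈ Th :=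
  H.closed (Set.finite_singleton φ) (by simpa using hφ) h

theorem closed₂ (H : IsHenkin T Th) {φ χ ψ : Formula} (h : Derives T {φ, χ} ψ) (hφ : φ ∈ Th)
    (hχ : χ ∈ Th) : ψ ∈ Th :=
  H.closed (by simp) (by simp [Set.insert_subset_iff, hφ, hχ]) h

theorem mem_imp (H : IsHenkin T Th) {φ ψ : Formula} : .imp φ ψ ∈ Th ↔ (φ ∈ Th → ψ ∈ Th) := by
  refine ⟨H.closed₂ (impE (hyp (by simp)) (hyp (by simp : φ ∈ _))), fun h => ?_⟩
  rcases H.total φ with hφ | hφ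
  · exact H.closed₁ (impI (mono_left (hyp rfl))) (h hφ)
  · exact H.closed₁ (impI (efq (impE (mono_left (hyp rfl)) (hyp_head (φ := φ))))) hφ

/-- Provable equality of terms. -/
def setoid (H : IsHenkin T Th) : Setoid Term where
  r s t := .eq s t ∈ Th
  iseqv :=
    { refl := fun t => H.closed Set.finite_empty (Set.empty_subset _) (eqRefl t)
      symm := fun {s t} => H.closed₁ (φ := .eq s t) (eq_symm (hyp rfl))
      trans := H.closed₂ (eq_trans hyp_head hyp_snd) }

/-- The numbers of the term model. -/
def Carrier (H : IsHenkin T Th) : Type := Quotient H.setoid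

variable (H : IsHenkin T Th)

instance : Countable H.Carrier := inferInstanceAs (Countable (Quotient _))

instance : Zero H.Carrier := ⟨Quotient.mk _ .zero⟩

instance : One H.Carrier := ⟨Quotient.mk _ .one⟩

instance : Add H.Carrier := ⟨Quotient.map₂ Term.add fun s s' h t t' h' =>
  H.closed₂ (φ := .eq s s') (χ := .eq t t') (eq_add hyp_head hyp_snd) h h'⟩

instance : Mul H.Carrier := ⟨Quotient.map₂ Term.mul fun s s' h t t' h' =>
  H.closed₂ (φ := .eq s s') (χ := .eq t t') (eq_mul hyp_head hyp_snd) h h'⟩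

instance : LT H.Carrier := ⟨Quotient.lift₂ (fun s t => .lt s t ∈ Th) fun s t s' t' h hh => by
  have key : ∀ {s t s' t' : Term}, Formula.eq s s' ∈ Th → Formula.eq t t' ∈ Th →
      Formula.lt s t ∈ Th → Formula.lt s' t' ∈ Th :=
    fun {s t s' t'} h h' hl => H.closed₂ (φ := .imp (.lt s t) (.lt s' t')) (impE hyp_head hyp_snd)
      (H.closed₂ (φ := Formula.eq s s') (χ := Formula.eq t t')
        (impI (lt_congr (mono_left hyp_head) (mono_left hyp_snd) hyp_head)) h h') hl
  exact propext ⟨key h hh, key (H.setoid.symm h) (H.setoid.symm hh)⟩⟩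

/-- The sets of the term model: the set variables. -/
def SetCarrier (_ : IsHenkin T Th) : Type := ℕ

instance : Countable H.SetCarrier := inferInstanceAs (Countable ℕ)

instance : Nonempty H.SetCarrier := inferInstanceAs (Nonempty ℕ)

instance : Membership H.Carrier H.SetCarrier :=
  ⟨fun (X : ℕ) => Quotient.lift (fun t => .mem t X ∈ Th) fun s t h => propext
    ⟨H.closed₂ (φ := .eq s t) (mem_congr hyp_head hyp_snd) h,
      H.closed₂ (φ := .eq t s) (mem_congr hyp_head hyp_snd) (H.setoid.symm h)⟩⟩

/-- The value of a term. -/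
def den (t : Term) : H.Carrier := Quotient.mk H.setoid t

theorem eval_term (t : Term) (σ : ℕ → Term) :
    t.eval (fun i => H.den (σ i)) = H.den (t.subst σ) := by
  induction t with
  | var i => rfl
  | zero => rfl
  | one => rfl
  | add s t hs ht => simp only [Term.eval, hs, ht]; rfl
  | mul s t hs ht => simp only [Term.eval, hs, ht]; rfl

/-- The truth lemma. Numbers are terms modulo provable equality; set variables need no quotient
because the language has no equality of sets. -/
theorem eval_iff (φ : Formula) (σ : ℕ → Term) (ρ : ℕ → ℕ) :
    φ.eval (S := H.SetCarrier) (fun i => H.den (σ i)) ρ ↔ φ.subst σ ρ ∈ Th := by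
  induction φ generalizing σ ρ with
  | eq s t => simp only [Formula.eval, eval_term]; exact Quotient.eq (r := H.setoid)
  | lt s t => simp only [Formula.eval, eval_term]; rfl
  | mem t X => simp only [Formula.eval, eval_term]; rfl
  | bot => exact iff_of_false id H.bot
  | imp φ ψ hφ hψ => simp only [Formula.eval, Formula.subst, hφ, hψ, H.mem_imp]
  | all φ ih =>
    have hc : ∀ t, (cons (H.den t) fun i => H.den (σ i)) =
        fun i => H.den (cons t σ i) := fun t => by
      funext i; cases i <;> rfl
    constructor
    · refine fun h => H.all _ fun t => ?_
      rw [subst_up_inst, ← ih, ← hc]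
      exact h _
    · intro h x
      induction x using Quotient.inductionOn with
      | h t =>
      refine Eq.mpr (congrArg (fun v => φ.eval (S := H.SetCarrier) v ρ) (hc t)) ((ih _ _).2 ?_)
      rw [← subst_up_inst]
      exact H.closed₁ (allE t (hyp rfl)) h
  | allSet φ ih =>
    constructor
    · refine fun h => H.allSet _ fun X => ?_
      rw [subst_upSet_instSet, ← ih]
      exact h X
    · intro h
      have key : ∀ X : ℕ, φ.subst σ (cons X ρ) ∈ Th := fun X => by
        rw [← subst_upSet_instSet]
        exact H.closed₁ (allSetE X (hyp rfl)) h
      exact fun X => (ih σ (cons (α := ℕ) X ρ)).2 (key X)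

end IsHenkin

/-- Completeness: a formula that is true in all countable models of `T` is derivable from `T`. -/
theorem derives_of_forall_model {χ : Formula}
    (h : ∀ (M S : Type) [Zero M] [One M] [Add M] [Mul M] [LT M] [Membership M S] [Countable M]
      [Countable S] [Nonempty S],
      (∀ φ ∈ T, ∀ (v : ℕ → M) (w : ℕ → S), φ.eval v w) → ∀ (v : ℕ → M) (w : ℕ → S), χ.eval v w) :
    Derives T ∅ χ := by
  by_contra hχ
  obtain ⟨Th, H, hn⟩ := exists_isHenkin hχ
  -- A valuation in the term model is a substitution of representatives, so an axiom holds under it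
  -- because its substitution instances are derivable.
  have h₁ := h H.Carrier H.SetCarrier (fun φ hφ v w => by
    choose σ hσ using fun i => Quotient.exists_rep (v i)
    obtain rfl : (fun i => H.den (σ i)) = v := funext hσ
    exact (H.eval_iff φ σ w).2 (H.closed Set.finite_empty (Set.empty_subset _) (ax_subst hφ σ w)))
    (fun i => H.den (.var i)) fun i : ℕ => i
  have h₂ := (H.eval_iff χ .var fun i => i).1 h₁
  rw [subst_var_id] at h₂
  exact H.bot (H.mem_imp.1 hn h₂)

end Completeness

/-! ### Models of `RCA₀` -/

section Models

variable {M S : Type} [Zero M] [One M] [Add M] [Mul M]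

namespace Term

theorem eval_subst (t : Term) (σ : ℕ → Term) (v : ℕ → M) :
    (t.subst σ).eval v = t.eval fun i => (σ i).eval v := by
  induction t <;> simp_all [subst, eval]

theorem eval_shift (t : Term) (x : M) (v : ℕ → M) : t.shift.eval (cons x v) = t.eval v := by
  rw [shift, eval_subst]; rfl

theorem eval_up (σ : ℕ → Term) (x : M) (v : ℕ → M) :
    (fun i => (up σ i).eval (cons x v)) = cons x fun i => (σ i).eval v := by
  funext i
  cases i with
  | zero => rfl
  | succ i => exact eval_shift _ _ _

end Term

variable [LT M] [Membership M S]

namespace Formula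

variable {v : ℕ → M} {w : ℕ → S} {φ ψ : Formula}

@[simp] theorem eval_neg : (neg φ).eval v w ↔ ¬ φ.eval v w := Iff.rfl

@[simp] theorem eval_imp : (imp φ ψ).eval v w ↔ (φ.eval v w → ψ.eval v w) := Iff.rfl

@[simp] theorem eval_all : (all φ).eval v w ↔ ∀ x, φ.eval (cons x v) w := Iff.rfl

@[simp] theorem eval_and : (and φ ψ).eval v w ↔ φ.eval v w ∧ ψ.eval v w := by simp [and]

@[simp] theorem eval_or : (or φ ψ).eval v w ↔ φ.eval v w ∨ ψ.eval v w := by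
  simp [or, or_iff_not_imp_left]

@[simp] theorem eval_iff : (iff φ ψ).eval v w ↔ (φ.eval v w ↔ ψ.eval v w) := by
  simp [iff, iff_def]

@[simp] theorem eval_ex : (ex φ).eval v w ↔ ∃ x, φ.eval (cons x v) w := by simp [ex]

@[simp] theorem eval_exSet : (exSet φ).eval v w ↔ ∃ X, φ.eval v (cons X w) := by
  have : (neg (allSet (neg φ))).eval v w ↔ ¬ ∀ X, ¬ φ.eval v (cons X w) := Iff.rfl
  simp [exSet, this]

theorem eval_ballLt {t : Term} :
    (ballLt t φ).eval v w ↔ ∀ x, x < t.eval v → φ.eval (cons x v) w := by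
  simp [ballLt, Formula.eval, Term.eval, Term.eval_shift]

theorem cons_upSet (ρ : ℕ → ℕ) (X : S) (w : ℕ → S) :
    (fun i => cons X w (upSet ρ i)) = cons X fun i => w (ρ i) := by
  funext i
  cases i <;> rfl

theorem eval_subst (φ : Formula) (σ : ℕ → Term) (ρ : ℕ → ℕ) (v : ℕ → M) (w : ℕ → S) :
    (φ.subst σ ρ).eval v w ↔ φ.eval (fun i => (σ i).eval v) fun i => w (ρ i) := by
  induction φ generalizing σ ρ v w with
  | all φ ih => simp only [subst, eval, ih, Term.eval_up]
  | allSet φ ih => simp only [subst, eval, ih, cons_upSet]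
  | _ => simp_all [subst, eval, Term.eval_subst]

theorem eval_inst (φ : Formula) (t : Term) (v : ℕ → M) (w : ℕ → S) :
    (φ.inst t).eval v w ↔ φ.eval (cons (t.eval v) v) w := by
  rw [inst_eq, eval_subst]
  have : (fun i => (cons t Term.var i).eval v) = cons (t.eval v) v := by
    funext i
    cases i <;> rfl
  rw [this]

theorem IsBounded.subst {φ : Formula} (h : IsBounded φ) (σ : ℕ → Term) (ρ : ℕ → ℕ) :
    IsBounded (φ.subst σ ρ) := by
  induction h generalizing σ with
  | eq s t => exact .eq _ _
  | lt s t => exact .lt _ _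
  | mem t X => exact .mem _ _
  | bot => exact .bot
  | imp _ _ ih₁ ih₂ => exact .imp (ih₁ σ) (ih₂ σ)
  | @ballLt t φ _ ih =>
    have : (Formula.ballLt t φ).subst σ ρ =
        Formula.ballLt (t.subst σ) (φ.subst (Term.up σ) ρ) := by
      simp only [Formula.ballLt, Formula.subst, Term.subst, Term.shift_subst, Term.up]
      simp only [Term.shift, Term.subst_subst]
    rw [this]
    exact .ballLt _ (ih _)

end Formula

/-- A countable model of `RCA₀`. -/
class IsModel (M S : Type) [Zero M] [One M] [Add M] [Mul M] [LT M] [Membership M S] : Prop where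
  eval_of_mem : ∀ φ ∈ RCA0, ∀ (v : ℕ → M) (w : ℕ → S), φ.eval v w
  countable : Countable M
  countable_set : Countable S
  nonempty_set : Nonempty S

variable [IsModel M S]

theorem IsModel.exists_enum (M S : Type) [Zero M] [One M] [Add M] [Mul M] [LT M] [Membership M S]
    [IsModel M S] : ∃ e : ℕ → M, Function.Surjective e := by
  have : Countable M := IsModel.countable S
  have : Nonempty M := ⟨0⟩
  exact exists_surjective_nat M

theorem IsModel.exists_enumSet (M S : Type) [Zero M] [One M] [Add M] [Mul M] [LT M]
    [Membership M S] [IsModel M S] : ∃ e : ℕ → S, Function.Surjective e := by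
  have : Countable S := IsModel.countable_set M
  have : Nonempty S := IsModel.nonempty_set M
  exact exists_surjective_nat S

variable (M S) in
/-- An enumeration of the numbers of the model. -/
noncomputable def enum : ℕ → M := (IsModel.exists_enum M S).choose

variable (M S) in
/-- An enumeration of the sets of the model. -/
noncomputable def enumSet : ℕ → S := (IsModel.exists_enumSet M S).choose

variable (S) in
/-- The valuation with the arguments `v` at the even and all possible parameters at the odd
places. -/
noncomputable def mix (v : ℕ → M) (i : ℕ) : M := if i % 2 = 0 then v (i / 2) else enum M S (i / 2)

/-! ### Definable relations

A relation is given as a predicate of sequences, which depends on finitely many of its terms. -/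

variable (S) in
/-- `f` is a polynomial function with parameters. -/
def Poly (f : (ℕ → M) → M) : Prop := ∃ t : Term, ∀ v, t.eval (mix S v) = f v

variable (S) in
/-- `P` is defined by a bounded formula with parameters. -/
def Bdd (P : (ℕ → M) → Prop) : Prop :=
  ∃ φ : Formula, φ.IsBounded ∧ ∀ v, φ.eval (mix S v) (enumSet M S) ↔ P v

variable (S) in
/-- `P` is defined by a `Σ⁰₁` formula with parameters. -/
def Sig (P : (ℕ → M) → Prop) : Prop :=
  ∃ θ : (ℕ → M) → Prop, Bdd S θ ∧ ∀ v, P v ↔ ∃ x, θ (cons x v)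

namespace Poly

variable {f g : (ℕ → M) → M}

theorem var (i : ℕ) : Poly S fun v : ℕ → M => v i :=
  ⟨.var (2 * i), fun v => by simp [Term.eval, mix]⟩

theorem const (c : M) : Poly S fun _ : ℕ → M => c := by
  obtain ⟨i, hi⟩ := (IsModel.exists_enum M S).choose_spec c
  exact ⟨.var (2 * i + 1), fun v => by
    simp [Term.eval, mix, Nat.add_mod, Nat.mul_add_div, enum, hi]⟩

theorem add (hf : Poly S f) (hg : Poly S g) : Poly S fun v => f v + g v := by
  obtain ⟨s, hs⟩ := hf
  obtain ⟨t, ht⟩ := hg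
  exact ⟨.add s t, fun v => by simp [Term.eval, hs, ht]⟩

theorem mul (hf : Poly S f) (hg : Poly S g) : Poly S fun v => f v * g v := by
  obtain ⟨s, hs⟩ := hf
  obtain ⟨t, ht⟩ := hg
  exact ⟨.mul s t, fun v => by simp [Term.eval, hs, ht]⟩

end Poly

/-- The substitution that turns a formula on `mix (cons x v)` into one on `cons x (mix v)`. -/
def mixShift (i : ℕ) : Term := .var (if i = 0 then 0 else if i % 2 = 0 then i - 1 else i + 1)

theorem eval_mixShift (x : M) (v : ℕ → M) :
    (fun i => (mixShift i).eval (cons x (mix S v))) = mix S (cons x v) := by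
  funext i
  -- At an even place `2(k + 1)` stands `v k`, which has the index `2k + 1` once `x` is put in front
  -- of `mix v`; at an odd place stands a parameter, which moves up by one.
  rcases Nat.even_or_odd' i with ⟨k, rfl | rfl⟩
  · cases k with
    | zero => rfl
    | succ k =>
      have : 2 * (k + 1) - 1 = 2 * k + 1 := by omega
      simp [mixShift, Term.eval, mix, this]
  · simp [mixShift, Term.eval, mix, Nat.add_mod, Nat.mul_add_div]

namespace Bdd

variable {f g : (ℕ → M) → M} {P Q : (ℕ → M) → Prop}

theorem congr (hP : Bdd S P) (h : ∀ v, P v ↔ Q v) : Bdd S Q := by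
  obtain ⟨φ, hφ, hφ'⟩ := hP
  exact ⟨φ, hφ, fun v => (hφ' v).trans (h v)⟩

theorem eq (hf : Poly S f) (hg : Poly S g) : Bdd S fun v => f v = g v := by
  obtain ⟨s, hs⟩ := hf
  obtain ⟨t, ht⟩ := hg
  exact ⟨.eq s t, .eq _ _, fun v => by simp [Formula.eval, hs, ht]⟩

theorem lt (hf : Poly S f) (hg : Poly S g) : Bdd S fun v => f v < g v := by
  obtain ⟨s, hs⟩ := hf
  obtain ⟨t, ht⟩ := hg
  exact ⟨.lt s t, .lt _ _, fun v => by simp [Formula.eval, hs, ht]⟩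

theorem mem (hf : Poly S f) (X : S) : Bdd S fun v => f v ∈ X := by
  obtain ⟨s, hs⟩ := hf
  obtain ⟨i, hi⟩ := (IsModel.exists_enumSet M S).choose_spec X
  exact ⟨.mem s i, .mem _ _, fun v => by simp [Formula.eval, hs, enumSet, hi]⟩

theorem imp (hP : Bdd S P) (hQ : Bdd S Q) : Bdd S fun v => P v → Q v := by
  obtain ⟨φ, hφ, hφ'⟩ := hP
  obtain ⟨ψ, hψ, hψ'⟩ := hQ
  exact ⟨.imp φ ψ, .imp hφ hψ, fun v => by simp [hφ', hψ']⟩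

theorem not (hP : Bdd S P) : Bdd S fun v => ¬ P v :=
  hP.imp ⟨.bot, .bot, fun _ => Iff.rfl⟩

theorem and (hP : Bdd S P) (hQ : Bdd S Q) : Bdd S fun v => P v ∧ Q v :=
  (hP.imp hQ.not).not.congr fun v => by simp

theorem or (hP : Bdd S P) (hQ : Bdd S Q) : Bdd S fun v => P v ∨ Q v :=
  (hP.not.imp hQ).congr fun v => by simp [or_iff_not_imp_left]

theorem ball {P : M → (ℕ → M) → Prop} (hf : Poly S f)
    (hP : Bdd S fun v => P (v 0) fun i => v (i + 1)) : Bdd S fun v => ∀ x, x < f v → P x v := by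
  obtain ⟨t, ht⟩ := hf
  obtain ⟨φ, hφ, hφ'⟩ := hP
  refine ⟨.ballLt t (φ.subst mixShift fun i => i), .ballLt _ (hφ.subst _ _), fun v => ?_⟩
  rw [Formula.eval_ballLt]
  refine forall_congr' fun x => ?_
  rw [ht, Formula.eval_subst, eval_mixShift, hφ']
  rfl

theorem bex {P : M → (ℕ → M) → Prop} (hf : Poly S f)
    (hP : Bdd S fun v => P (v 0) fun i => v (i + 1)) : Bdd S fun v => ∃ x, x < f v ∧ P x v :=
  (ball (P := fun x v => ¬ P x v) hf hP.not).not.congr fun v => by simp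

theorem subst {f : ℕ → (ℕ → M) → M} (hP : Bdd S P) (hf : ∀ i, Poly S (f i)) :
    Bdd S fun v => P fun i => f i v := by
  obtain ⟨φ, hφ, hφ'⟩ := hP
  choose t ht using hf
  refine ⟨φ.subst (fun i => if i % 2 = 0 then t (i / 2) else .var i) fun i => i, hφ.subst _ _,
    fun v => ?_⟩
  refine Iff.trans ?_ (hφ' _)
  rw [Formula.eval_subst]
  have : (fun i => (if i % 2 = 0 then t (i / 2) else .var i).eval (mix S v)) =
      mix S fun i => f i v := by
    funext i
    by_cases h : i % 2 = 0 <;> simp [mix, h, ht, Term.eval]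
  rw [this]

theorem sig (hP : Bdd S P) : Sig S P :=
  ⟨fun v => P fun i => v (i + 1), hP.subst fun _ => Poly.var _, fun _ => ⟨fun h => ⟨0, h⟩,
    fun ⟨_, h⟩ => h⟩⟩

end Bdd

/-! ### `Σ⁰₁` induction and `Δ⁰₁` comprehension for definable relations of a model. -/

theorem Sig.exists_formula {P : (ℕ → M) → Prop} (h : Sig S P) :
    ∃ θ : Formula, θ.IsBounded ∧
      ∀ v, P v ↔ ∃ x, θ.eval (cons x (mix S v)) (enumSet M S) := by
  obtain ⟨θ, ⟨φ, hφ, hφ'⟩, h⟩ := h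
  refine ⟨φ.subst mixShift fun i => i, hφ.subst _ _, fun v => ?_⟩
  simp only [Formula.eval_subst, eval_mixShift, hφ', h]

/-- The argument `x` stands only at place `0`, so the rest of the valuation is a fixed list of
parameters. This is the form of the axiom schemes, whose distinguished variable is variable `0`. -/
theorem exists_tail : ∃ u : ℕ → M, ∀ x, cons x u = mix S (cons x fun _ => 0) :=
  ⟨fun i => mix S (fun _ => 0) (i + 1), fun x => by
    funext i
    rcases i with _ | _ | i
    · rfl
    · simp [mix]
    · have : (i + 1 + 1) / 2 = i / 2 + 1 := by omega
      simp [mix, this]⟩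

theorem Sig.induction {P : M → Prop} (h : Sig S fun v => P (v 0)) (h0 : P 0)
    (hs : ∀ x, P x → P (x + 1)) (x : M) : P x := by
  obtain ⟨θ, hθ, hP⟩ := h.exists_formula
  obtain ⟨u, hu⟩ := exists_tail (M := M) (S := S)
  have key : ∀ x, (Formula.ex θ).eval (cons x u) (enumSet M S) ↔ P x := fun x => by
    rw [hu, Formula.eval_ex, ← hP]; rfl
  have ind := IsModel.eval_of_mem _ (RCA0.sigmaInduction ⟨θ, hθ, rfl⟩) u (enumSet M S)
  rw [inductionFor, Formula.eval_imp, Formula.eval_and, Formula.eval_inst, Formula.eval_all,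
    Formula.eval_all] at ind
  refine (key x).1 (ind ⟨(key _).2 h0, fun y hy => ?_⟩ x)
  rw [Formula.eval_subst]
  convert (key _).2 (hs y ((key y).1 hy)) using 1
  · funext i
    cases i <;> rfl
  · rfl

/-- The `Π⁰₁` formula that the scheme requires is the negated `Σ⁰₁` definition of the complement. -/
theorem Sig.comprehension {P : M → Prop} (h : Sig S fun v => P (v 0))
    (h' : Sig S fun v => ¬ P (v 0)) : ∃ X : S, ∀ x, x ∈ X ↔ P x := by
  obtain ⟨θ, hθ, hP⟩ := h.exists_formula
  obtain ⟨η, hη, hP'⟩ := h'.exists_formula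
  obtain ⟨u, hu⟩ := exists_tail (M := M) (S := S)
  have key : ∀ x, (Formula.ex θ).eval (cons x u) (enumSet M S) ↔ P x := fun x => by
    rw [hu, Formula.eval_ex, ← hP]; rfl
  have key' : ∀ x, (Formula.all (.neg η)).eval (cons x u) (enumSet M S) ↔ P x := fun x => by
    have := hP' (cons x fun _ => 0)
    rw [hu, Formula.eval_all]
    simp only [Formula.eval_neg, ← not_exists, ← this]
    exact not_not
  have comp := IsModel.eval_of_mem _
    (RCA0.comprehension (φ := .ex θ) (ψ := .all (.neg η)) ⟨θ, hθ, rfl⟩ ⟨_, hη.imp .bot, rfl⟩)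
    u (enumSet M S)
  rw [comprehensionFor, Formula.eval_imp, Formula.eval_exSet] at comp
  obtain ⟨X, hX⟩ := comp fun x => Formula.eval_iff.2 ((key x).trans (key' x).symm)
  refine ⟨X, fun x => ?_⟩
  have := Formula.eval_iff.1 (hX x)
  rw [Formula.shiftSet, Formula.eval_subst] at this
  exact this.trans (key x)

/-! ### Arithmetic -/

namespace IsModel

theorem eval_of_basicAx (S : Type) [Membership M S] [IsModel M S]
    {φ : Formula} (h : BasicAx φ) (v : ℕ → M) : φ.eval v (enumSet M S) :=
  eval_of_mem φ (.basic h) v _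

theorem add_zero (S : Type) [Membership M S] [IsModel M S]
    (x : M) : x + 0 = x := eval_of_basicAx S .add_zero fun _ => x

theorem add_succ (S : Type) [Membership M S] [IsModel M S]
    (x y : M) : x + (y + 1) = x + y + 1 :=
  eval_of_basicAx S .add_succ (cons x fun _ => y)

theorem mul_zero (S : Type) [Membership M S] [IsModel M S]
    (x : M) : x * 0 = 0 := eval_of_basicAx S .mul_zero fun _ => x

theorem mul_succ (S : Type) [Membership M S] [IsModel M S]
    (x y : M) : x * (y + 1) = x * y + x :=
  eval_of_basicAx S .mul_succ (cons x fun _ => y)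

theorem not_lt_zero (S : Type) [Membership M S] [IsModel M S]
    (x : M) : ¬ x < 0 := eval_of_basicAx S .not_lt_zero fun _ => x

theorem lt_succ (S : Type) [Membership M S] [IsModel M S]
    {x y : M} : x < y + 1 ↔ x < y ∨ x = y := by
  have := eval_of_basicAx S .lt_succ (cons x fun _ => y)
  rwa [Formula.eval_iff, Formula.eval_or] at this

/-- A bounded formula is `Σ⁰₁` with a vacuous quantifier. The laws of arithmetic that follow use
only this induction. -/
theorem ind (S : Type) [Membership M S] [IsModel M S]
    {P : M → Prop} (h : Bdd S fun v => P (v 0)) (h0 : P 0)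
    (hs : ∀ x, P x → P (x + 1)) (x : M) : P x := h.sig.induction h0 hs x

theorem zero_add (S : Type) [Membership M S] [IsModel M S]
    (x : M) : 0 + x = x :=
  ind S (P := fun x => 0 + x = x) (.eq (.add (.const _) (.var 0)) (.var 0)) (add_zero S 0)
    (fun x h => by rw [add_succ S, h]) x

theorem succ_add (S : Type) [Membership M S] [IsModel M S]
    (x y : M) : x + 1 + y = x + y + 1 :=
  ind S (P := fun y => x + 1 + y = x + y + 1)
    (.eq (.add (.const _) (.var 0)) (.add (.add (.const _) (.var 0)) (.const _)))
    (by rw [add_zero S, add_zero S])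
    (fun y h => by rw [add_succ S (x + 1), h, add_succ S x]) y

theorem add_comm (S : Type) [Membership M S] [IsModel M S]
    (x y : M) : x + y = y + x :=
  ind S (P := fun y => x + y = y + x) (.eq (.add (.const _) (.var 0)) (.add (.var 0) (.const _)))
    (by rw [add_zero S, zero_add S]) (fun y h => by rw [add_succ S, h, succ_add S]) y

theorem add_assoc (S : Type) [Membership M S] [IsModel M S]
    (x y z : M) : x + y + z = x + (y + z) :=
  ind S (P := fun z => x + y + z = x + (y + z))
    (.eq (.add (.const _) (.var 0)) (.add (.const _) (.add (.const _) (.var 0))))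
    (by rw [add_zero S, add_zero S]) (fun z h => by rw [add_succ S, h, add_succ S, add_succ S]) z

theorem zero_mul (S : Type) [Membership M S] [IsModel M S]
    (x : M) : 0 * x = 0 :=
  ind S (P := fun x => 0 * x = 0) (.eq (.mul (.const _) (.var 0)) (.const _)) (mul_zero S 0)
    (fun x h => by rw [mul_succ S, h, add_zero S]) x

theorem succ_mul (S : Type) [Membership M S] [IsModel M S]
    (x y : M) : (x + 1) * y = x * y + y :=
  ind S (P := fun y => (x + 1) * y = x * y + y)
    (.eq (.mul (.const _) (.var 0)) (.add (.mul (.const _) (.var 0)) (.var 0)))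
    (by rw [mul_zero S, mul_zero S, add_zero S])
    (fun y h => by
      have : x * y + y + x = x * y + x + y := by
        rw [add_assoc S, add_comm S y, ← add_assoc S]
      rw [mul_succ S (x + 1), h, mul_succ S x, add_succ S (x * y + y), add_succ S (x * y + x),
        this]) y

theorem mul_comm (S : Type) [Membership M S] [IsModel M S]
    (x y : M) : x * y = y * x :=
  ind S (P := fun y => x * y = y * x) (.eq (.mul (.const _) (.var 0)) (.mul (.var 0) (.const _)))
    (by rw [mul_zero S, zero_mul S]) (fun y h => by rw [mul_succ S, h, succ_mul S]) y

theorem mul_add (S : Type) [Membership M S] [IsModel M S]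
    (x y z : M) : x * (y + z) = x * y + x * z :=
  ind S (P := fun z => x * (y + z) = x * y + x * z)
    (.eq (.mul (.const _) (.add (.const _) (.var 0)))
      (.add (.const _) (.mul (.const _) (.var 0))))
    (by rw [mul_zero S, add_zero S, add_zero S])
    (fun z h => by rw [add_succ S, mul_succ S, h, mul_succ S, add_assoc S]) z

theorem mul_assoc (S : Type) [Membership M S] [IsModel M S]
    (x y z : M) : x * y * z = x * (y * z) :=
  ind S (P := fun z => x * y * z = x * (y * z))
    (.eq (.mul (.const _) (.var 0)) (.mul (.const _) (.mul (.const _) (.var 0))))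
    (by rw [mul_zero S, mul_zero S, mul_zero S])
    (fun z h => by rw [mul_succ S, h, mul_succ S, mul_add S]) z

theorem mul_one (S : Type) [Membership M S] [IsModel M S]
    (x : M) : x * 1 = x := by
  rw [← zero_add S (1 : M), mul_succ S, mul_zero S, zero_add S]

/-- The numbers of a model form a commutative semiring. -/
@[reducible] def commSemiring (S : Type) [Membership M S] [IsModel M S] : CommSemiring M where
  add_assoc := add_assoc S
  zero_add := zero_add S
  add_zero := add_zero S
  add_comm := add_comm S
  mul_assoc := mul_assoc S
  mul_comm := mul_comm S
  one_mul x := (mul_comm S 1 x).trans (mul_one S x)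
  mul_one := mul_one S
  zero_mul := zero_mul S
  mul_zero := mul_zero S
  left_distrib := mul_add S
  right_distrib x y z := by rw [mul_comm S, mul_add S, mul_comm S z, mul_comm S z]
  nsmul := nsmulRec

theorem lt_succ_self (S : Type) [Membership M S] [IsModel M S]
    (x : M) : x < x + 1 := (lt_succ S).2 (.inr rfl)

theorem lt_trans (S : Type) [Membership M S] [IsModel M S]
    {x y z : M} (h : x < y) (h' : y < z) : x < z :=
  ind S (P := fun z => y < z → x < z) (.imp (.lt (.const _) (.var 0)) (.lt (.const _) (.var 0)))
    (fun h' => (not_lt_zero S _ h').elim)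
    (fun z ih h' => by
      rcases (lt_succ S).1 h' with h' | rfl
      · exact (lt_succ S).2 (.inl (ih h'))
      · exact (lt_succ S).2 (.inl h)) z h'

theorem succ_lt_succ (S : Type) [Membership M S] [IsModel M S]
    {x y : M} (h : x < y) : x + 1 < y + 1 :=
  ind S (P := fun y => x < y → x + 1 < y + 1)
    (.imp (.lt (.const _) (.var 0)) (.lt (.const _) (.add (.var 0) (.const _))))
    (fun h => (not_lt_zero S _ h).elim)
    (fun y ih h => by
      rcases (lt_succ S).1 h with h | rfl
      · exact lt_trans S (ih h) (lt_succ_self S _)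
      · exact lt_succ_self S _) y h

theorem lt_irrefl (S : Type) [Membership M S] [IsModel M S]
    (x : M) : ¬ x < x :=
  ind S (P := fun x => ¬ x < x) (.not (.lt (.var 0) (.var 0))) (not_lt_zero S 0)
    (fun x ih h => by
      rcases (lt_succ S).1 h with h | h
      · exact ih (lt_trans S (lt_succ_self S x) h)
      · exact ih (by have := lt_succ_self S x; rwa [h] at this)) x

theorem zero_le (S : Type) [Membership M S] [IsModel M S]
    (x : M) : 0 < x ∨ 0 = x :=
  ind S (P := fun x => 0 < x ∨ 0 = x) (.or (.lt (.const _) (.var 0)) (.eq (.const _) (.var 0)))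
    (.inr rfl) (fun _ h => .inl ((lt_succ S).2 h)) x

theorem lt_trichotomy (S : Type) [Membership M S] [IsModel M S]
    (x y : M) : x < y ∨ x = y ∨ y < x :=
  ind S (P := fun x => x < y ∨ x = y ∨ y < x)
    (.or (.lt (.var 0) (.const _)) (.or (.eq (.var 0) (.const _)) (.lt (.const _) (.var 0))))
    ((zero_le S y).elim .inl fun h => .inr (.inl h))
    (fun x h => by
      rcases h with h | rfl | h
      · rcases (lt_succ S).1 (succ_lt_succ S h) with h | h
        · exact .inl h
        · exact .inr (.inl h)
      · exact .inr (.inr (lt_succ_self S x))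
      · exact .inr (.inr (lt_trans S h (lt_succ_self S x)))) x

open Classical in
/-- The numbers of a model are linearly ordered. -/
@[reducible] noncomputable def linearOrder (S : Type) [Membership M S] [IsModel M S] :
    LinearOrder M where
  le x y := x < y ∨ x = y
  lt := (· < ·)
  le_refl x := .inr rfl
  le_trans := by
    rintro x y z (h | rfl) (h' | rfl)
    · exact .inl (lt_trans S h h')
    · exact .inl h
    · exact .inl h'
    · exact .inr rfl
  lt_iff_le_not_ge x y := by
    refine ⟨fun h => ⟨.inl h, ?_⟩, ?_⟩
    · rintro (h' | rfl)
      · exact lt_irrefl S _ (lt_trans S h h')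
      · exact lt_irrefl S _ h
    · rintro ⟨h | rfl, h'⟩
      · exact h
      · exact (h' (.inr rfl)).elim
  le_antisymm := by
    rintro x y (h | h) (h' | h')
    · exact (lt_irrefl S _ (lt_trans S h h')).elim
    all_goals simp_all
  le_total x y := by
    rcases lt_trichotomy S x y with h | h | h
    · exact .inl (.inl h)
    · exact .inl (.inr h)
    · exact .inr (.inl h)
  toDecidableLE := Classical.decRel _

theorem add_lt_add_right (S : Type) [Membership M S] [IsModel M S]
    {x y : M} (h : x < y) (z : M) : x + z < y + z :=
  ind S (P := fun z => x + z < y + z) (.lt (.add (.const _) (.var 0)) (.add (.const _) (.var 0)))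
    (by rwa [add_zero S, add_zero S])
    (fun z ih => by rw [add_succ S, add_succ S]; exact succ_lt_succ S ih) z

theorem mul_lt_mul_right (S : Type) [Membership M S] [IsModel M S]
    {x y z : M} (h : x < y) (hz : 0 < z) : x * z < y * z :=
  ind S (P := fun z => 0 < z → x * z < y * z)
    (.imp (.lt (.const _) (.var 0)) (.lt (.mul (.const _) (.var 0)) (.mul (.const _) (.var 0))))
    (fun h => (lt_irrefl S _ h).elim)
    (fun z ih _ => by
      rw [mul_succ S, mul_succ S]
      rcases zero_le S z with hz | rfl
      · refine lt_trans S (add_lt_add_right S (ih hz) x) ?_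
        rw [add_comm S, add_comm S _ y]
        exact add_lt_add_right S h _
      · rwa [mul_zero S, mul_zero S, zero_add S, zero_add S]) z hz

/-- Induction on `y`. Bounding the difference by `y + 1` keeps the induction predicate bounded. -/
theorem exists_add_of_lt (S : Type) [Membership M S] [IsModel M S]
    {x y : M} (h : x < y) : ∃ z, y = x + z := by
  have : x < y → ∃ z, z < y + 1 ∧ y = x + z :=
    ind S (P := fun y => x < y → ∃ z, z < y + 1 ∧ y = x + z)
      (.imp (.lt (.const _) (.var 0)) (.bex (.add (.var 0) (.const _))
        (P := fun z v => v 0 = x + z) (.eq (.var 1) (.add (.const _) (.var 0)))))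
      (fun h => (not_lt_zero S _ h).elim)
      (fun y ih h => by
        rcases (lt_succ S).1 h with h | rfl
        · obtain ⟨z, hz, hy⟩ := ih h
          exact ⟨z + 1, succ_lt_succ S hz, by rw [add_succ S, ← hy]⟩
        · exact ⟨1, (lt_succ S).2 (by
            rcases (lt_succ S).1 (succ_lt_succ S (lt_succ_self S x)) with h | h
            · rcases zero_le S x with h' | rfl
              · have := succ_lt_succ S h'
                rw [zero_add S] at this
                exact .inl this
              · exact .inr (zero_add S 1).symm
            · rcases zero_le S x with h' | rfl
              · have := succ_lt_succ S h'
                rw [zero_add S] at this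
                exact .inl this
              · exact .inr (zero_add S 1).symm), rfl⟩) y
  obtain ⟨z, -, hz⟩ := this h
  exact ⟨z, hz⟩

end IsModel

end Models

/-! ### `Σ⁰₁` relations and functions with `Σ⁰₁` graphs -/

theorem isStrictOrderedRing_of_isModel {M : Type} (S : Type) [Zero M] [One M] [Add M] [Mul M] [LT M]
    [Membership M S] [IsModel M S] :
    letI := IsModel.commSemiring (M := M) S
    letI := IsModel.linearOrder (M := M) S
    IsStrictOrderedRing M := by
  let _ := IsModel.commSemiring (M := M) S
  let _ := IsModel.linearOrder (M := M) S
  have hadd : ∀ {x y : M}, x < y → ∀ z, x + z < y + z := fun h z =>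
    IsModel.add_lt_add_right S h z
  have hmul : ∀ {x y z : M}, x < y → 0 < z → x * z < y * z := fun h hz =>
    IsModel.mul_lt_mul_right S h hz
  have hle : ∀ x y z : M, x ≤ y → x + z ≤ y + z := fun x y z h => by
    rcases h.lt_or_eq with h | rfl
    · exact (hadd h z).le
    · exact le_rfl
  have h01 : (0 : M) < 1 := by
    have := IsModel.lt_succ_self S (0 : M)
    rwa [IsModel.zero_add S] at this
  exact
    { add_le_add_left := fun x y h z => hle x y z h
      le_of_add_le_add_left := fun x y z h => by
        by_contra! h'
        have := hadd h' x
        rw [add_comm, add_comm y] at this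
        exact absurd h (not_le.2 this)
      zero_le_one := h01.le
      exists_pair_ne := ⟨0, 1, h01.ne⟩
      mul_lt_mul_of_pos_left := fun x hx y z h => by
        show x * y < x * z
        rw [mul_comm x, mul_comm x]
        exact hmul h hx
      mul_lt_mul_of_pos_right := fun x hx y z h => hmul h hx }

theorem canonicallyOrderedAdd_of_isModel {M : Type} (S : Type) [Zero M] [One M] [Add M]
    [Mul M] [LT M]
    [Membership M S] [IsModel M S] :
    letI := IsModel.commSemiring (M := M) S
    letI := IsModel.linearOrder (M := M) S
    CanonicallyOrderedAdd M := by
  let _ := IsModel.commSemiring (M := M) S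
  let _ := IsModel.linearOrder (M := M) S
  have := isStrictOrderedRing_of_isModel (M := M) S
  have h0 : ∀ x : M, 0 ≤ x := IsModel.zero_le S
  exact
    { exists_add_of_le := fun {x y} h => by
        rcases h.lt_or_eq with h | rfl
        · exact IsModel.exists_add_of_lt S h
        · exact ⟨0, (add_zero x).symm⟩
      le_add_self := fun x y => by simpa using add_le_add_left (h0 y) x
      le_self_add := fun x y => by simpa using add_le_add_right (h0 y) x }

section Sigma

set_option linter.unusedSectionVars false

variable {M S : Type} [CommSemiring M] [LinearOrder M] [IsStrictOrderedRing M]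
  [CanonicallyOrderedAdd M] [Membership M S] [IsModel M S]

/-! ### Least elements and collection for bounded relations. -/

theorem lt_add_one_iff' (S : Type) [Membership M S] [IsModel M S] {x y : M} : x < y + 1 ↔ x ≤ y :=
  (IsModel.lt_succ S).trans le_iff_lt_or_eq.symm

theorem Poly.cons' {f : (ℕ → M) → M} {g : ℕ → (ℕ → M) → M} (hf : Poly S f) (hg : ∀ i, Poly S (g i))
    (i : ℕ) : Poly S fun v => cons (f v) (fun j => g j v) i := by
  cases i with
  | zero => exact hf
  | succ i => exact hg i

theorem Poly.tail {f : (ℕ → M) → M} (hf : Poly S f) : Poly S fun v => f fun i => v (i + 1) := by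
  obtain ⟨t, ht⟩ := hf
  refine ⟨t.subst fun i => if i % 2 = 0 then .var (i + 2) else .var i, fun v => ?_⟩
  dsimp only
  rw [Term.eval_subst, ← ht]
  congr 1
  funext i
  have : (i + 2) / 2 = i / 2 + 1 := by omega
  by_cases h : i % 2 = 0 <;> simp [mix, h, Term.eval, this]

/-- Without a least element, induction on `x` shows that `P` fails everywhere below `x`; that
predicate is again bounded. -/
theorem Bdd.exists_least {P : M → Prop} (h : Bdd S fun v => P (v 0)) {x : M} (hx : P x) :
    ∃ y, P y ∧ ∀ z < y, ¬ P z := by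
  by_contra! hc
  have key : ∀ x, ∀ z, z < x → ¬ P z := by
    refine Sig.induction (S := S) (P := fun x => ∀ z, z < x → ¬ P z)
      (Bdd.ball (P := fun z _ => ¬ P z) (.var 0)
        (h.subst (f := fun i v => v i) fun i => .var i).not).sig ?_ ?_
    · intro z hz
      exact absurd hz (not_lt.2 zero_le)
    · intro x ih z hz hPz
      obtain ⟨y, hy, hP⟩ := hc z hPz
      refine ih y (hy.trans_le ((lt_add_one_iff' S).1 hz)) hP
  exact key _ x (lt_add_one x) hx

theorem exists_bound_of_forall_lt {R : M → M → Prop} (h : Bdd S fun u => R (u 0) (u 1)) {a : M}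
    (ha : ∀ x < a, ∃ y, R x y) : ∃ b, ∀ x < a, ∃ y < b, R x y := by
  -- The existence of a common bound is `Σ⁰₁` and can be proved by induction on `c`. The alternative
  -- `a < c` makes the claim trivial where no witnesses are assumed.
  have key : ∀ c, ∃ b, a < c ∨ ∀ x, x < c → ∃ y, y < b ∧ R x y := by
    refine Sig.induction (S := S) (P := fun c => ∃ b, a < c ∨ ∀ x, x < c → ∃ y, y < b ∧ R x y)
      ⟨fun w => a < w 1 ∨ ∀ x, x < w 1 → ∃ y, y < w 0 ∧ R x y, ?_, fun v => Iff.rfl⟩ ?_ ?_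
    · refine .or (.lt (.const _) (.var _)) (.ball (P := fun x w => ∃ y, y < w 0 ∧ R x y) (.var 1)
        (.bex (P := fun y w => R (w 0) y) (.var 1) ?_))
      exact h.subst (f := fun i w => cons (w 1) (fun _ => w 0) i) fun i => .cons' (.var _)
        (fun _ => .var _) i
    · exact ⟨0, .inr fun x hx => absurd hx (not_lt.2 zero_le)⟩
    · rintro c ⟨b, hb⟩
      rcases hb with hb | hb
      · exact ⟨0, .inl (hb.trans (lt_add_one c))⟩
      rcases lt_or_ge c a with hc | hc
      · obtain ⟨y, hy⟩ := ha c hc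
        refine ⟨max b (y + 1), .inr fun x hx => ?_⟩
        rcases ((lt_add_one_iff' S).1 hx).lt_or_eq with hx | rfl
        · obtain ⟨z, hz, hR⟩ := hb x hx
          exact ⟨z, lt_max_of_lt_left hz, hR⟩
        · exact ⟨y, lt_max_of_lt_right (lt_add_one y), hy⟩
      · exact ⟨0, .inl (hc.trans_lt (lt_add_one c))⟩
  obtain ⟨b, hb⟩ := key a
  exact ⟨b, hb.resolve_left (lt_irrefl a)⟩

namespace Sig

variable {P Q : (ℕ → M) → Prop}

theorem congr (hP : Sig S P) (h : ∀ v, P v ↔ Q v) : Sig S Q := by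
  obtain ⟨θ, hθ, hP⟩ := hP
  exact ⟨θ, hθ, fun v => (h v).symm.trans (hP v)⟩

theorem subst {f : ℕ → (ℕ → M) → M} (hP : Sig S P) (hf : ∀ i, Poly S (f i)) :
    Sig S fun v => P fun i => f i v := by
  obtain ⟨θ, hθ, hP⟩ := hP
  refine ⟨fun w => θ (fun j => cons (w 0) (fun i => f i fun i => w (i + 1)) j),
    hθ.subst (Poly.cons' (.var 0) fun i => (hf i).tail), fun v => hP _⟩

theorem and (hP : Sig S P) (hQ : Sig S Q) : Sig S fun v => P v ∧ Q v := by
  obtain ⟨θ, hθ, hP⟩ := hP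
  obtain ⟨η, hη, hQ⟩ := hQ
  refine ⟨fun w => (∃ x, x < w 0 ∧ θ (cons x fun i => w (i + 1))) ∧
    ∃ x, x < w 0 ∧ η (cons x fun i => w (i + 1)), ?_, fun v => ?_⟩
  · exact .and
      (.bex (P := fun x w => θ (cons x fun i => w (i + 1))) (.var 0)
        (hθ.subst (Poly.cons' (.var 0) fun i => .var (i + 2))))
      (.bex (P := fun x w => η (cons x fun i => w (i + 1))) (.var 0)
        (hη.subst (Poly.cons' (.var 0) fun i => .var (i + 2))))
  · dsimp only
    rw [hP, hQ]
    constructor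
    · rintro ⟨⟨x, hx⟩, y, hy⟩
      exact ⟨max x y + 1, ⟨x, (le_max_left x y).trans_lt (lt_add_one _), hx⟩,
        y, (le_max_right x y).trans_lt (lt_add_one _), hy⟩
    · rintro ⟨b, ⟨x, -, hx⟩, y, -, hy⟩
      exact ⟨⟨x, hx⟩, y, hy⟩

theorem or (hP : Sig S P) (hQ : Sig S Q) : Sig S fun v => P v ∨ Q v := by
  obtain ⟨θ, hθ, hP⟩ := hP
  obtain ⟨η, hη, hQ⟩ := hQ
  exact ⟨fun w => θ w ∨ η w, hθ.or hη, fun v => by dsimp only; rw [hP, hQ, exists_or]⟩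

/-- Two existential quantifiers merge into one over a common strict bound, which leaves both as
bounded quantifiers in the matrix. -/
theorem ex {P : M → (ℕ → M) → Prop} (hP : Sig S fun v => P (v 0) fun i => v (i + 1)) :
    Sig S fun v => ∃ x, P x v := by
  obtain ⟨θ, hθ, hP⟩ := hP
  refine ⟨fun w => ∃ x, x < w 0 ∧ ∃ y, y < w 0 ∧ θ (cons y (cons x fun i => w (i + 1))), ?_,
    fun v => ?_⟩
  · exact .bex (P := fun x w => ∃ y, y < w 0 ∧ θ (cons y (cons x fun i => w (i + 1)))) (.var 0)
      (.bex (P := fun y w => θ (cons y (cons (w 0) fun i => w (i + 2)))) (.var 1)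
        (hθ.subst (Poly.cons' (.var 0) (Poly.cons' (.var 1) fun i => .var (i + 3)))))
  · constructor
    · rintro ⟨x, hx⟩
      obtain ⟨y, hy⟩ := (hP (cons x v)).1 hx
      exact ⟨max x y + 1, x, (le_max_left x y).trans_lt (lt_add_one _),
        y, (le_max_right x y).trans_lt (lt_add_one _), hy⟩
    · rintro ⟨b, x, -, y, -, h⟩
      exact ⟨x, (hP (cons x v)).2 ⟨y, h⟩⟩

/-- By collection the witnesses for all `x < f v` have one bound, so the unbounded quantifier can be
moved in front of the bounded one. -/
theorem ball {P : M → (ℕ → M) → Prop} {f : (ℕ → M) → M} (hf : Poly S f)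
    (hP : Sig S fun v => P (v 0) fun i => v (i + 1)) : Sig S fun v => ∀ x, x < f v → P x v := by
  obtain ⟨θ, hθ, hP⟩ := hP
  refine ⟨fun w => ∀ x, x < f (fun i => w (i + 1)) →
    ∃ y, y < w 0 ∧ θ (cons y (cons x fun i => w (i + 1))), ?_, fun v => ?_⟩
  · refine .ball (P := fun x w => ∃ y, y < w 0 ∧ θ (cons y (cons x fun i => w (i + 1))))
      (f := fun w => f (fun i => w (i + 1))) hf.tail
      (.bex (P := fun y w => θ (cons y (cons (w 0) fun i => w (i + 2)))) (.var 1)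
        (hθ.subst (Poly.cons' (.var 0) (Poly.cons' (.var 1) fun i => .var (i + 3)))))
  · have hb : Bdd S fun u => θ (cons (u 1) (cons (u 0) v)) :=
      hθ.subst (Poly.cons' (.var 1) (Poly.cons' (.var 0) fun i => .const (v i)))
    constructor
    · intro h
      exact exists_bound_of_forall_lt (R := fun x y => θ (cons y (cons x v))) hb
        fun x hx => (hP (cons x v)).1 (h x hx)
    · rintro ⟨b, h⟩ x hx
      obtain ⟨y, -, hy⟩ := h x hx
      exact (hP (cons x v)).2 ⟨y, hy⟩

end Sig

/-- Collection for the bounded matrix, with one bound both for `y` and for the witness that `R x y`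
holds. -/
theorem Sig.exists_bound_of_forall_lt {R : M → M → Prop} (h : Sig S fun u => R (u 0) (u 1)) {a : M}
    (ha : ∀ x < a, ∃ y, R x y) : ∃ b, ∀ x < a, ∃ y < b, R x y := by
  obtain ⟨θ, hθ, h⟩ := h
  have hR : ∀ x y, R x y ↔ ∃ z, θ (cons z (cons x (cons y fun _ => 0))) := fun x y =>
    h (cons x (cons y fun _ => 0))
  have hB : Bdd S fun u : ℕ → M => ∃ y, y < u 1 ∧ ∃ z, z < u 1 ∧
      θ (cons z (cons (u 0) (cons y fun _ => 0))) :=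
    .bex (P := fun y u => ∃ z, z < u 1 ∧ θ (cons z (cons (u 0) (cons y fun _ => 0)))) (.var 1)
      (.bex (P := fun z u => θ (cons z (cons (u 1) (cons (u 0) fun _ => 0)))) (.var 2)
        (hθ.subst (Poly.cons' (.var 0) (Poly.cons' (.var 2) (Poly.cons' (.var 1)
          fun _ => .const 0)))))
  obtain ⟨b, hb⟩ := SecondOrderArithmetic.exists_bound_of_forall_lt (a := a)
    (R := fun x b => ∃ y, y < b ∧ ∃ z, z < b ∧ θ (cons z (cons x (cons y fun _ => 0)))) hB
    fun x hx => by
      obtain ⟨y, hy⟩ := ha x hx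
      obtain ⟨z, hz⟩ := (hR x y).1 hy
      exact ⟨max y z + 1, y, (le_max_left y z).trans_lt (lt_add_one _), z,
        (le_max_right y z).trans_lt (lt_add_one _), hz⟩
  refine ⟨b, fun x hx => ?_⟩
  obtain ⟨c, hc, y, hy, z, -, h⟩ := hb x hx
  exact ⟨y, hy.trans hc, (hR x y).2 ⟨z, h⟩⟩

/-! Functions -/

variable (S) in
/-- The graph of `f` is `Σ⁰₁`. -/
def Fn (f : (ℕ → M) → M) : Prop := Sig S fun v => v 0 = f fun i => v (i + 1)

theorem Fn.of_graph {f : (ℕ → M) → M} {R : M → (ℕ → M) → Prop}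
    (h : Sig S fun v => R (v 0) fun i => v (i + 1)) (hR : ∀ y v, R y v ↔ y = f v) : Fn S f :=
  h.congr fun _ => hR _ _

theorem Poly.fn {f : (ℕ → M) → M} (hf : Poly S f) : Fn S f := (Bdd.eq (.var 0) hf.tail).sig

theorem Fn.var (i : ℕ) : Fn S fun v : ℕ → M => v i := (Poly.var i).fn

theorem Fn.const (c : M) : Fn S fun _ : ℕ → M => c := (Poly.const c).fn

theorem Fn.subst {f : (ℕ → M) → M} {g : ℕ → (ℕ → M) → M} (hf : Fn S f) (hg : ∀ i, Poly S (g i)) :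
    Fn S fun v => f fun i => g i v := by
  refine (Sig.subst hf (Poly.cons' (.var 0) fun i => (hg i).tail)).congr fun v => ?_
  rfl

theorem Fn.tail {f : (ℕ → M) → M} (hf : Fn S f) : Fn S fun v => f fun i => v (i + 1) :=
  hf.subst fun i => .var (i + 1)

/-- The value is named by an existential quantifier: `P (f v) v` says that some `y` equals `f v` and
satisfies `P y v`. All composition lemmas rest on this. -/
theorem Sig.let {P : M → (ℕ → M) → Prop} {f : (ℕ → M) → M} (hf : Fn S f)
    (hP : Sig S fun v => P (v 0) fun i => v (i + 1)) : Sig S fun v => P (f v) v :=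
  (Sig.ex (P := fun y v => y = f v ∧ P y v) (.and hf hP)).congr fun v => by simp

theorem Sig.comp₁ {P : M → Prop} {f : (ℕ → M) → M} (hP : Sig S fun v => P (v 0)) (hf : Fn S f) :
    Sig S fun v => P (f v) :=
  Sig.let (P := fun y _ => P y) hf hP

theorem Sig.comp₂ {P : M → M → Prop} {f g : (ℕ → M) → M} (hP : Sig S fun v => P (v 0) (v 1))
    (hf : Fn S f) (hg : Fn S g) : Sig S fun v => P (f v) (g v) :=
  Sig.let (P := fun y v => P y (g v)) hf (Sig.let (P := fun z v => P (v 0) z) hg.tail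
    (hP.subst (f := fun i => cons (fun v => v 1) (fun _ v => v 0) i) fun i => by
      cases i <;> exact .var _))

theorem Sig.comp₃ {P : M → M → M → Prop} {f g h : (ℕ → M) → M}
    (hP : Sig S fun v => P (v 0) (v 1) (v 2)) (hf : Fn S f) (hg : Fn S g) (hh : Fn S h) :
    Sig S fun v => P (f v) (g v) (h v) :=
  Sig.let (P := fun y v => P y (g v) (h v)) hf
    (Sig.let (P := fun z v => P (v 0) z (h fun i => v (i + 1))) hg.tail
      (Sig.let (P := fun z v => P (v 1) (v 0) z) hh.tail.tail
        (hP.subst (f := fun i v => cons (v 2) (cons (v 1) fun _ => v 0) i)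
          (Poly.cons' (.var 2) (Poly.cons' (.var 1) fun _ => .var 0)))))

theorem Fn.comp₁ {F : M → M} {f : (ℕ → M) → M} (hF : Fn S fun v => F (v 0)) (hf : Fn S f) :
    Fn S fun v => F (f v) :=
  Sig.comp₂ (P := fun y x => y = F x) hF (.var 0) hf.tail

theorem Fn.comp₂ {F : M → M → M} {f g : (ℕ → M) → M} (hF : Fn S fun v => F (v 0) (v 1))
    (hf : Fn S f) (hg : Fn S g) : Fn S fun v => F (f v) (g v) :=
  Sig.comp₃ (P := fun y x z => y = F x z) hF (.var 0) hf.tail hg.tail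

theorem Fn.add {f g : (ℕ → M) → M} (hf : Fn S f) (hg : Fn S g) : Fn S fun v => f v + g v :=
  Fn.comp₂ (F := fun x y => x + y) (Poly.add (.var 0) (.var 1)).fn hf hg

theorem Fn.mul {f g : (ℕ → M) → M} (hf : Fn S f) (hg : Fn S g) : Fn S fun v => f v * g v :=
  Fn.comp₂ (F := fun x y => x * y) (Poly.mul (.var 0) (.var 1)).fn hf hg

theorem Sig.eq {f g : (ℕ → M) → M} (hf : Fn S f) (hg : Fn S g) : Sig S fun v => f v = g v :=
  Sig.comp₂ (P := fun x y => x = y) (Bdd.eq (.var 0) (.var 1)).sig hf hg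

theorem Sig.ne {f g : (ℕ → M) → M} (hf : Fn S f) (hg : Fn S g) : Sig S fun v => f v ≠ g v :=
  Sig.comp₂ (P := fun x y => x ≠ y) (Bdd.eq (.var 0) (.var 1)).not.sig hf hg

theorem Sig.lt {f g : (ℕ → M) → M} (hf : Fn S f) (hg : Fn S g) : Sig S fun v => f v < g v :=
  Sig.comp₂ (P := fun x y => x < y) (Bdd.lt (.var 0) (.var 1)).sig hf hg

theorem Sig.le {f g : (ℕ → M) → M} (hf : Fn S f) (hg : Fn S g) : Sig S fun v => f v ≤ g v :=
  (Sig.comp₂ (P := fun x y => ¬ y < x) (Bdd.lt (.var 1) (.var 0)).not.sig hf hg).congr fun v => by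
    simp

theorem Sig.mem {f : (ℕ → M) → M} (hf : Fn S f) (X : S) : Sig S fun v => f v ∈ X :=
  Sig.comp₁ (P := fun x => x ∈ X) (Bdd.mem (.var 0) X).sig hf

theorem Sig.not_mem {f : (ℕ → M) → M} (hf : Fn S f) (X : S) : Sig S fun v => f v ∉ X :=
  Sig.comp₁ (P := fun x => x ∉ X) (Bdd.mem (.var 0) X).not.sig hf

theorem Sig.ball' {P : M → (ℕ → M) → Prop} {f : (ℕ → M) → M} (hf : Fn S f)
    (hP : Sig S fun v => P (v 0) fun i => v (i + 1)) : Sig S fun v => ∀ x, x < f v → P x v := by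
  refine Sig.let (P := fun y v => ∀ x, x < y → P x v) hf ?_
  exact Sig.ball (P := fun x v => P x fun i => v (i + 1)) (.var 0)
    (hP.subst (f := fun i v => cons (v 0) (fun i => v (i + 2)) i)
      (Poly.cons' (.var 0) fun i => .var (i + 2)))

/-- The least `y` with `R y x` need not have a `Σ⁰₁` graph. Instead the least `u` is taken below
which both some `y` and a witness for `R y x` exist, and then the least such `y` for this `u`. Both
minimizations concern bounded relations, so the graph `G` is `Σ⁰₁`. -/
theorem Sig.exists_choice {R : M → M → Prop} (h : Sig S fun v => R (v 0) (v 1))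
    (hR : ∀ x, ∃ y, R y x) : ∃ g : M → M, (Fn S fun v => g (v 0)) ∧ ∀ x, R (g x) x := by
  obtain ⟨θ, hθ, h⟩ := h
  let T : M → M → M → Prop := fun z y x => θ (cons z (cons y (cons x fun _ => 0)))
  have hT : ∀ {f g h : (ℕ → M) → M}, Poly S f → Poly S g → Poly S h →
      Bdd S fun v => T (f v) (g v) (h v) := fun hf hg hh =>
    hθ.subst (Poly.cons' hf (Poly.cons' hg (Poly.cons' hh fun _ => .const 0)))
  have hRT : ∀ y x, R y x ↔ ∃ z, T z y x := fun y x => h (cons y (cons x fun _ => 0))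
  let C : M → M → M → Prop := fun y u x => ∃ z, z < u ∧ T z y x
  have hC : ∀ {f g h : (ℕ → M) → M}, Poly S f → Poly S g → Poly S h →
      Bdd S fun v => C (f v) (g v) (h v) := fun {f g h} hf hg hh =>
    .bex (P := fun z v => T z (f v) (h v)) hg (hT (.var 0) hf.tail hh.tail)
  let B : M → M → Prop := fun u x => ∃ y, y < u ∧ C y u x
  have hB : ∀ {f g : (ℕ → M) → M}, Poly S f → Poly S g →
      Bdd S fun v => B (f v) (g v) := fun {f g} hf hg =>
    .bex (P := fun y v => C y (f v) (g v)) hf (hC (.var 0) hf.tail hg.tail)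
  let G : M → M → Prop := fun y x => ∃ u, (B u x ∧ ∀ u', u' < u → ¬ B u' x) ∧
    C y u x ∧ ∀ y', y' < y → ¬ C y' u x
  have hG : Sig S fun v => G (v 0) (v 1) := by
    refine Sig.ex (P := fun u v => (B u (v 1) ∧ ∀ u', u' < u → ¬ B u' (v 1)) ∧
      C (v 0) u (v 1) ∧ ∀ y', y' < v 0 → ¬ C y' u (v 1)) (Bdd.sig ?_)
    exact .and (.and (hB (.var 0) (.var 2))
      (.ball (P := fun u' v => ¬ B u' (v 2)) (.var 0) (hB (.var 0) (.var 3)).not))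
      (.and (hC (.var 1) (.var 0) (.var 2))
      (.ball (P := fun y' v => ¬ C y' (v 0) (v 2)) (.var 1) (hC (.var 0) (.var 1) (.var 3)).not))
  have hex : ∀ x, ∃ y, G y x := fun x => by
    obtain ⟨y, hy⟩ := hR x
    obtain ⟨z, hz⟩ := (hRT y x).1 hy
    have hBx : B (max y z + 1) x := ⟨y, (le_max_left y z).trans_lt (lt_add_one _), z,
      (le_max_right y z).trans_lt (lt_add_one _), hz⟩
    obtain ⟨u, hu, hu'⟩ := Bdd.exists_least (P := fun u => B u x) (hB (.var 0) (.const x)) hBx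
    obtain ⟨y, -, hy⟩ := id hu
    obtain ⟨y, hy, hy'⟩ := Bdd.exists_least (P := fun y => C y u x)
      (hC (.var 0) (.const u) (.const x)) hy
    exact ⟨y, u, ⟨hu, hu'⟩, hy, hy'⟩
  have huniq : ∀ {x y y'}, G y x → G y' x → y = y' := by
    rintro x y y' ⟨u, ⟨hu, hu'⟩, hy, hy'⟩ ⟨w, ⟨hw, hw'⟩, hz, hz'⟩
    obtain rfl : u = w := le_antisymm (not_lt.1 fun h => hu' _ h hw) (not_lt.1 fun h => hw' _ h hu)
    exact le_antisymm (not_lt.1 fun h => hy' _ h hz) (not_lt.1 fun h => hz' _ h hy)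
  choose g hg using hex
  refine ⟨g, Fn.of_graph (R := fun y v => G y (v 0)) hG fun y v =>
    ⟨fun h => huniq h (hg _), fun h => h ▸ hg _⟩, fun x => ?_⟩
  obtain ⟨u, -, ⟨z, -, hz⟩, -⟩ := hg x
  exact (hRT _ _).2 ⟨z, hz⟩

/-! Pairs -/

/-- The code of a pair. -/
def pair (x y : M) : M := (x + y) * (x + y) + x

theorem Fn.pair' {f g : (ℕ → M) → M} (hf : Fn S f) (hg : Fn S g) : Fn S fun v => pair (f v) (g v) :=
  ((hf.add hg).mul (hf.add hg)).add hf

theorem le_mul_self_of_isModel (S : Type) [Membership M S] [IsModel M S] (x : M) : x ≤ x * x := by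
  rcases eq_zero_or_pos x with rfl | h
  · simp
  · have : 1 ≤ x := by
      have := (lt_add_one_iff' S (x := 1) (y := x)).1 (by simpa using h)
      exact this
    exact le_mul_of_one_le_left' this

theorem left_le_pair (x y : M) : x ≤ pair x y := le_add_self

theorem right_le_pair (S : Type) [Membership M S] [IsModel M S] (x y : M) : y ≤ pair x y :=
  (le_add_self.trans (le_mul_self_of_isModel S (x + y))).trans le_self_add

/-- Since `(x + y)² + x < (x + y + 1)²`, codes of pairs with different sums lie in disjoint
intervals; for equal sums `x` is found by cancellation. -/
theorem pair_inj (S : Type) [Membership M S] [IsModel M S] {x y x' y' : M}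
    (h : pair x y = pair x' y') : x = x' ∧ y = y' := by
  have key : ∀ {x y x' y' : M}, x + y < x' + y' → pair x y < pair x' y' := fun {x y x' y'} h => by
    have h₁ : x + y + 1 ≤ x' + y' := by
      refine (lt_add_one_iff' S).1 ?_
      simpa using h
    calc pair x y < (x + y + 1) * (x + y + 1) := by
          unfold pair
          have : (x + y + 1) * (x + y + 1) = (x + y) * (x + y) + x + (x + 2 * y) + 1 := by ring
          rw [this]
          exact (le_self_add.trans_lt (lt_add_one _))
      _ ≤ (x' + y') * (x' + y') := mul_le_mul' h₁ h₁
      _ ≤ pair x' y' := le_self_add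
  have hs : x + y = x' + y' := by
    rcases lt_trichotomy (x + y) (x' + y') with h' | h' | h'
    · exact absurd h (key h').ne
    · exact h'
    · exact absurd h (key h').ne'
  have hx : x = x' := by
    unfold pair at h
    rw [hs] at h
    exact add_left_cancel h
  exact ⟨hx, add_left_cancel (hs.trans (by rw [hx]))⟩

open Classical in
/-- The first component of a pair. -/
noncomputable def fst (z : M) : M := if h : ∃ x y, z = pair x y then h.choose else 0

open Classical in
/-- The second component of a pair. -/
noncomputable def snd (z : M) : M := if h : ∃ x y, z = pair x y then h.choose_spec.choose else 0

theorem fst_pair (S : Type) [Membership M S] [IsModel M S] (x y : M) : fst (pair x y) = x := by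
  have h : ∃ x' y', pair x y = pair x' y' := ⟨x, y, rfl⟩
  rw [fst, dif_pos h]
  exact (pair_inj S h.choose_spec.choose_spec).1.symm

theorem snd_pair (S : Type) [Membership M S] [IsModel M S] (x y : M) : snd (pair x y) = y := by
  have h : ∃ x' y', pair x y = pair x' y' := ⟨x, y, rfl⟩
  rw [snd, dif_pos h]
  exact (pair_inj S h.choose_spec.choose_spec).2.symm

/-- Components are at most the code, so being a pair is a bounded condition. Hence `fst` and `snd`
have bounded graphs, including the default value `0` off the pairs. -/
theorem Bdd.exists_pair {R : M → M → M → Prop}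
    (hR : Bdd S fun v => R (v 0) (v 1) (v 2)) :
    Bdd S fun v => (∃ x y, v 1 = pair x y ∧ R x y (v 0)) ∨
      (¬ ∃ x y, v 1 = pair x y) ∧ v 0 = 0 := by
  have hp : ∀ {f g : (ℕ → M) → M}, Poly S f → Poly S g → Poly S fun v => pair (f v) (g v) :=
    fun hf hg => .add (.mul (hf.add hg) (hf.add hg)) hf
  have h₁ : Bdd S fun v : ℕ → M =>
      ∃ x, x < v 1 + 1 ∧ ∃ y, y < v 1 + 1 ∧ v 1 = pair x y ∧ R x y (v 0) :=
    .bex (P := fun x v => ∃ y, y < v 1 + 1 ∧ v 1 = pair x y ∧ R x y (v 0))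
      (.add (.var 1) (.const 1))
      (.bex (P := fun y v => v 2 = pair (v 0) y ∧ R (v 0) y (v 1)) (.add (.var 2) (.const 1))
        (.and (.eq (.var 3) (hp (.var 1) (.var 0)))
          (hR.subst (f := fun i v => cons (v 1) (cons (v 0) fun _ => v 2) i)
            (Poly.cons' (.var 1) (Poly.cons' (.var 0) fun _ => .var 2)))))
  have h₂ : Bdd S fun v : ℕ → M => ∃ x, x < v 1 + 1 ∧ ∃ y, y < v 1 + 1 ∧ v 1 = pair x y :=
    .bex (P := fun x v => ∃ y, y < v 1 + 1 ∧ v 1 = pair x y) (.add (.var 1) (.const 1))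
      (.bex (P := fun y v => v 2 = pair (v 0) y) (.add (.var 2) (.const 1))
        (.eq (.var 3) (hp (.var 1) (.var 0))))
  refine (h₁.or (h₂.not.and (.eq (.var 0) (.const 0)))).congr fun v => ?_
  have e₁ : ∀ {x y z : M}, z = pair x y → x < z + 1 := fun h =>
    (lt_add_one_iff' S).2 (h ▸ left_le_pair _ _)
  have e₂ : ∀ {x y z : M}, z = pair x y → y < z + 1 := fun h =>
    (lt_add_one_iff' S).2 (h ▸ right_le_pair S _ _)
  refine or_congr ⟨?_, ?_⟩ (and_congr_left fun _ => not_congr ⟨?_, ?_⟩)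
  · rintro ⟨x, -, y, -, h⟩
    exact ⟨x, y, h⟩
  · rintro ⟨x, y, h⟩
    exact ⟨x, e₁ h.1, y, e₂ h.1, h⟩
  · rintro ⟨x, -, y, -, h⟩
    exact ⟨x, y, h⟩
  · rintro ⟨x, y, h⟩
    exact ⟨x, e₁ h, y, e₂ h, h⟩

theorem Fn.fst' {f : (ℕ → M) → M} (hf : Fn S f) : Fn S fun v => fst (f v) := by
  refine Fn.comp₁ (F := fst) (Fn.of_graph
    (R := fun z v => (∃ x y, v 0 = pair x y ∧ z = x) ∨
      (¬ ∃ x y, v 0 = pair x y) ∧ z = 0)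
    (Bdd.exists_pair (R := fun x _ z => z = x) (.eq (.var 2) (.var 0))).sig fun z v => ?_) hf
  by_cases h : ∃ x y, v 0 = pair x y
  · obtain ⟨x, y, h⟩ := h
    rw [h, fst_pair S]
    constructor
    · rintro (⟨x', y', h, rfl⟩ | h)
      · exact (pair_inj S h).1.symm
      · exact absurd ⟨x, y, rfl⟩ h.1
    · rintro rfl
      exact .inl ⟨z, y, rfl, rfl⟩
  · rw [fst, dif_neg h]
    simp only [h, not_false_eq_true, true_and, or_iff_right_iff_imp]
    rintro ⟨x, y, hz, -⟩
    exact absurd ⟨x, y, hz⟩ h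

theorem Fn.snd' {f : (ℕ → M) → M} (hf : Fn S f) : Fn S fun v => snd (f v) := by
  refine Fn.comp₁ (F := snd) (Fn.of_graph
    (R := fun z v => (∃ x y, v 0 = pair x y ∧ z = y) ∨
      (¬ ∃ x y, v 0 = pair x y) ∧ z = 0)
    (Bdd.exists_pair (R := fun _ y z => z = y) (.eq (.var 2) (.var 1))).sig fun z v => ?_) hf
  by_cases h : ∃ x y, v 0 = pair x y
  · obtain ⟨x, y, h⟩ := h
    rw [h, snd_pair S]
    constructor
    · rintro (⟨x', y', h, rfl⟩ | h)
      · exact (pair_inj S h).2.symm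
      · exact absurd ⟨x, y, rfl⟩ h.1
    · rintro rfl
      exact .inl ⟨x, z, rfl, rfl⟩
  · rw [snd, dif_neg h]
    simp only [h, not_false_eq_true, true_and, or_iff_right_iff_imp]
    rintro ⟨x, y, hz, -⟩
    exact absurd ⟨x, y, hz⟩ h

/-- A nonempty `Σ⁰₁` set is the range of a function. -/
theorem Sig.exists_range_eq {P : M → Prop} (h : Sig S fun v => P (v 0)) {a : M} (ha : P a) :
    ∃ g : M → M, (Fn S fun v => g (v 0)) ∧ (∀ i, P (g i)) ∧ ∀ x, P x → ∃ i, g i = x := by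
  classical
  obtain ⟨θ, hθ, h⟩ := h
  let T : M → M → Prop := fun z y => θ (cons z (cons y fun _ => 0))
  have hT : Bdd S fun v : ℕ → M => T (v 0) (v 1) :=
    hθ.subst (Poly.cons' (.var 0) (Poly.cons' (.var 1) fun _ => .const 0))
  have hPT : ∀ y, P y ↔ ∃ z, T z y := fun y => h (cons y fun _ => 0)
  -- The index `i` is read as a candidate with an alleged witness of membership; the given element
  -- `a` is the value when the witness fails.
  refine ⟨fun i => if T (snd i) (fst i) then fst i else a, ?_, fun i => ?_, fun x hx => ?_⟩
  · refine Fn.of_graph (R := fun y v => (T (snd (v 0))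
      (fst (v 0)) ∧ y = fst (v 0)) ∨
      (¬ T (snd (v 0)) (fst (v 0)) ∧ y = a))
      (.or (.and (Sig.comp₂ hT.sig (Fn.var 1).snd' (Fn.var 1).fst') (.eq (.var 0) (Fn.var 1).fst'))
        (.and (Sig.comp₂ (P := fun z y => ¬ T z y) hT.not.sig (Fn.var 1).snd' (Fn.var 1).fst')
          (.eq (.var 0) (.const a)))) fun y v => ?_
    dsimp only
    split_ifs with h' <;> simp [h']
  · dsimp only
    split_ifs with h'
    · exact (hPT _).2 ⟨_, h'⟩
    · exact ha
  · obtain ⟨z, hz⟩ := (hPT x).1 hx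
    exact ⟨pair x z, by simp [fst_pair S, snd_pair S, hz]⟩

/-- Comprehension for the graph of a function. -/
theorem Fn.exists_graph {f : M → M} (hf : Fn S fun v => f (v 0)) :
    ∃ X : S, ∀ u, u ∈ X ↔ u = pair (fst u) (f (fst u)) := by
  have h : Fn S fun v : ℕ → M =>
      pair (fst (v 0)) (f (fst (v 0))) :=
    Fn.pair' (Fn.var 0).fst' (Fn.comp₁ hf (Fn.var 0).fst')
  -- For a total function with `Σ⁰₁` graph both equality and inequality with a value are `Σ⁰₁`.
  exact Sig.comprehension (P := fun u => u = pair (fst u) (f (fst u)))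
    (.eq (.var 0) h) (.ne (.var 0) h)

end Sigma

/-! ### The ordered field of fractions of differences -/

section DifferenceRing

variable (M : Type) [CommSemiring M]

/-- Formal differences. -/
@[ext] structure PreDiff where
  pos : M
  neg : M

variable {M}

namespace PreDiff

instance : Zero (PreDiff M) := ⟨⟨0, 0⟩⟩
instance : One (PreDiff M) := ⟨⟨1, 0⟩⟩
instance : Add (PreDiff M) := ⟨fun x y => ⟨x.pos + y.pos, x.neg + y.neg⟩⟩
instance : Mul (PreDiff M) :=
  ⟨fun x y => ⟨x.pos * y.pos + x.neg * y.neg, x.pos * y.neg + x.neg * y.pos⟩⟩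

@[simp] theorem zero_pos : (0 : PreDiff M).pos = 0 := rfl
@[simp] theorem zero_neg : (0 : PreDiff M).neg = 0 := rfl
@[simp] theorem one_pos : (1 : PreDiff M).pos = 1 := rfl
@[simp] theorem one_neg : (1 : PreDiff M).neg = 0 := rfl
@[simp] theorem add_pos (x y : PreDiff M) : (x + y).pos = x.pos + y.pos := rfl
@[simp] theorem add_neg (x y : PreDiff M) : (x + y).neg = x.neg + y.neg := rfl
@[simp] theorem mul_pos (x y : PreDiff M) : (x * y).pos = x.pos * y.pos + x.neg * y.neg := rfl
@[simp] theorem mul_neg (x y : PreDiff M) : (x * y).neg = x.pos * y.neg + x.neg * y.pos := rfl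

instance : CommSemiring (PreDiff M) where
  add_assoc x y z := by ext <;> simp <;> ring
  zero_add x := by ext <;> simp
  add_zero x := by ext <;> simp
  add_comm x y := by ext <;> simp <;> ring
  mul_assoc x y z := by ext <;> simp <;> ring
  mul_comm x y := by ext <;> simp <;> ring
  one_mul x := by ext <;> simp
  mul_one x := by ext <;> simp
  zero_mul x := by ext <;> simp
  mul_zero x := by ext <;> simp
  left_distrib x y z := by ext <;> simp <;> ring
  right_distrib x y z := by ext <;> simp <;> ring
  nsmul := nsmulRec

end PreDiff

variable [IsCancelAdd M]

variable (M) in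
/-- Equality of differences. -/
def diffCon : RingCon (PreDiff M) where
  r x y := x.pos + y.neg = y.pos + x.neg
  iseqv :=
    { refl := fun _ => rfl
      symm := fun h => h.symm
      trans := fun {x y z} h h' => by
        refine add_left_cancel (a := y.pos + y.neg) ?_
        calc y.pos + y.neg + (x.pos + z.neg) = (x.pos + y.neg) + (y.pos + z.neg) := by ring
          _ = (y.pos + x.neg) + (z.pos + y.neg) := by rw [h, h']
          _ = _ := by ring }
  add' := fun {a b c d} h h' => by
    simp only [PreDiff.add_pos, PreDiff.add_neg]
    calc a.pos + c.pos + (b.neg + d.neg) = (a.pos + b.neg) + (c.pos + d.neg) := by ring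
      _ = (b.pos + a.neg) + (d.pos + c.neg) := by rw [h, h']
      _ = _ := by ring
  mul' := fun {a b c d} h h' => by
    simp only [PreDiff.mul_pos, PreDiff.mul_neg]
    -- The added term completes both sides to combinations of the sums that occur in `h` and `h'`.
    refine add_left_cancel (a := b.neg * c.pos + b.pos * c.neg + (b.pos * c.pos + b.neg * c.neg)) ?_
    calc b.neg * c.pos + b.pos * c.neg + (b.pos * c.pos + b.neg * c.neg) +
        (a.pos * c.pos + a.neg * c.neg + (b.pos * d.neg + b.neg * d.pos)) =
        (a.pos + b.neg) * c.pos + (b.pos + a.neg) * c.neg +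
          b.pos * (c.pos + d.neg) + b.neg * (d.pos + c.neg) := by ring
      _ = (b.pos + a.neg) * c.pos + (a.pos + b.neg) * c.neg +
          b.pos * (d.pos + c.neg) + b.neg * (c.pos + d.neg) := by rw [h, h']
      _ = _ := by ring

variable (M) in
/-- The ring of differences. -/
abbrev DiffRing : Type := (diffCon M).Quotient

namespace DiffRing

instance : Neg (DiffRing M) := ⟨Quotient.map' (fun x => ⟨x.neg, x.pos⟩) fun x y h => by
  have h : x.pos + y.neg = y.pos + x.neg := h
  show x.neg + y.pos = y.neg + x.pos
  rw [add_comm, ← h, add_comm]⟩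

instance : CommRing (DiffRing M) where
  __ := (inferInstance : CommSemiring (DiffRing M))
  neg_add_cancel x := by
    induction x using Quotient.inductionOn' with
    | h x =>
    refine Quotient.sound' ?_
    show x.neg + x.pos + 0 = 0 + (x.pos + x.neg)
    ring
  zsmul := zsmulRec

variable (M) in
/-- The embedding of the semiring. -/
def of : M →+* DiffRing M where
  toFun x := (diffCon M).mk' ⟨x, 0⟩
  map_one' := rfl
  map_zero' := rfl
  map_add' x y := by
    rw [← map_add]
    congr 1
    ext <;> simp
  map_mul' x y := by
    rw [← map_mul]
    congr 1
    ext <;> simp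

theorem of_injective : Function.Injective (of M) := fun x y h => by
  have h : x + 0 = y + 0 := Quotient.exact' h
  simpa using h

theorem exists_eq_sub (x : DiffRing M) : ∃ a b, x = of M a - of M b := by
  induction x using Quotient.inductionOn' with
  | h x =>
  refine ⟨x.pos, x.neg, ?_⟩
  rw [sub_eq_add_neg]
  refine Quotient.sound' ?_
  show x.pos + (0 + x.neg) = x.pos + 0 + x.neg
  ring

end DiffRing

end DifferenceRing

section FractionField

variable {M : Type} [CommSemiring M] [LinearOrder M] [IsStrictOrderedRing M]
  [CanonicallyOrderedAdd M]

/-- Of two numbers the larger exceeds the smaller by a number, so every difference has a sign. This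
gives both the domain property and the order. -/
theorem DiffRing.exists_eq_or (x : DiffRing M) : ∃ a, x = of M a ∨ x = - of M a := by
  obtain ⟨a, b, rfl⟩ := x.exists_eq_sub
  rcases le_total a b with h | h
  · obtain ⟨c, rfl⟩ := exists_add_of_le h
    exact ⟨c, .inr (by simp)⟩
  · obtain ⟨c, rfl⟩ := exists_add_of_le h
    exact ⟨c, .inl (by simp)⟩

instance : IsDomain (DiffRing M) :=
  have : Nontrivial (DiffRing M) := ⟨⟨DiffRing.of M 0, DiffRing.of M 1,
    fun h => zero_ne_one (DiffRing.of_injective h)⟩⟩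
  have : NoZeroDivisors (DiffRing M) := ⟨fun {x y} h => by
    obtain ⟨a, ha⟩ := x.exists_eq_or
    obtain ⟨b, hb⟩ := y.exists_eq_or
    have : DiffRing.of M (a * b) = DiffRing.of M 0 := by
      rw [map_mul, map_zero]
      rcases ha with rfl | rfl <;> rcases hb with rfl | rfl <;> simpa using h
    rcases mul_eq_zero.1 (DiffRing.of_injective this) with rfl | rfl
    · left; simpa using ha
    · right; simpa using hb⟩
  NoZeroDivisors.to_isDomain _

variable (M) in
/-- The field of fractions of the differences. -/
def Frac : Type := FractionRing (DiffRing M)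

noncomputable instance : Field (Frac M) := inferInstanceAs (Field (FractionRing (DiffRing M)))

variable (M) in
/-- The embedding of the semiring. -/
noncomputable def fracHom : M →+* Frac M :=
  (algebraMap (DiffRing M) (FractionRing (DiffRing M))).comp (DiffRing.of M)

theorem fracHom_injective : Function.Injective (fracHom M) :=
  (IsFractionRing.injective (DiffRing M) (FractionRing (DiffRing M))).comp DiffRing.of_injective

theorem fracHom_ne_zero {a : M} (h : a ≠ 0) : fracHom M a ≠ 0 := fun h' =>
  h (fracHom_injective (h'.trans (map_zero _).symm))

theorem Frac.exists_eq_or (x : Frac M) : ∃ a b, b ≠ 0 ∧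
    (x = fracHom M a / fracHom M b ∨ x = -(fracHom M a / fracHom M b)) := by
  let j : DiffRing M →+* Frac M := algebraMap (DiffRing M) (FractionRing (DiffRing M))
  obtain ⟨p, q, hq, hx⟩ : ∃ p q, q ∈ nonZeroDivisors (DiffRing M) ∧ j p / j q = x :=
    IsFractionRing.div_surjective (A := DiffRing M) (K := FractionRing (DiffRing M)) x
  have hq' := nonZeroDivisors.ne_zero hq
  obtain ⟨a, ha⟩ := p.exists_eq_or
  obtain ⟨b, hb⟩ := q.exists_eq_or
  refine ⟨a, b, fun h => hq' ?_, ?_⟩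
  · simpa [h] using hb
  · have hj : ∀ x, fracHom M x = j (DiffRing.of M x) := fun _ => rfl
    rw [hj, hj, ← hx]
    rcases ha with rfl | rfl <;> rcases hb with rfl | rfl <;>
      simp [neg_div, div_neg]

/-- The nonnegative fractions. -/
noncomputable def fracCone : RingCone (Frac M) where
  carrier := {x | ∃ a b, b ≠ 0 ∧ x = fracHom M a / fracHom M b}
  mul_mem' := by
    rintro _ _ ⟨a, b, hb, rfl⟩ ⟨c, d, hd, rfl⟩
    exact ⟨a * c, b * d, mul_ne_zero hb hd, by rw [map_mul, map_mul, div_mul_div_comm]⟩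
  one_mem' := ⟨1, 1, one_ne_zero, by simp⟩
  add_mem' := by
    rintro _ _ ⟨a, b, hb, rfl⟩ ⟨c, d, hd, rfl⟩
    exact ⟨a * d + b * c, b * d, mul_ne_zero hb hd, by
      rw [div_add_div _ _ (fracHom_ne_zero hb) (fracHom_ne_zero hd)]; simp⟩
  zero_mem' := ⟨0, 1, one_ne_zero, by simp⟩
  eq_zero_of_mem_of_neg_mem' := by
    rintro _ ⟨a, b, hb, rfl⟩ ⟨c, d, hd, h⟩
    have h₁ : fracHom M (a * d + c * b) = 0 := by
      have hb' := fracHom_ne_zero hb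
      have hd' := fracHom_ne_zero hd
      field_simp at h
      simp only [map_add, map_mul]
      linear_combination -h
    -- In the semiring a sum vanishes only if both summands do, so a fraction that is nonnegative
    -- together with its negative has numerator `0`.
    have h₂ : a * d + c * b = 0 := by
      by_contra h'
      exact fracHom_ne_zero h' h₁
    have h₃ : a = 0 := (mul_eq_zero.1 (add_eq_zero.1 h₂).1).resolve_right hd
    simp [h₃]

open Classical in
noncomputable instance : LinearOrder (Frac M) :=
  haveI : HasMemOrNegMem (fracCone (M := M)) := ⟨fun x => by
    obtain ⟨a, b, hb, h | h⟩ := x.exists_eq_or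
    · exact .inl ⟨a, b, hb, h⟩
    · exact .inr ⟨a, b, hb, by rw [h, neg_neg]⟩⟩
  LinearOrder.mkOfAddGroupCone (fracCone (M := M))

theorem Frac.nonneg_iff {x : Frac M} : 0 ≤ x ↔ ∃ a b, b ≠ 0 ∧ x = fracHom M a / fracHom M b := by
  show x - 0 ∈ fracCone ↔ _
  rw [sub_zero]
  rfl

instance : IsStrictOrderedRing (Frac M) :=
  have : IsOrderedRing (Frac M) := IsOrderedRing.mkOfCone (fracCone (M := M))
  IsOrderedRing.toIsStrictOrderedRing _

theorem fracHom_nonneg (a : M) : 0 ≤ fracHom M a := Frac.nonneg_iff.2 ⟨a, 1, one_ne_zero, by simp⟩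

theorem fracHom_strictMono : StrictMono (fracHom M) :=
  Monotone.strictMono_of_injective (fun x y h => by
    obtain ⟨z, rfl⟩ := exists_add_of_le h
    rw [map_add]
    exact le_add_of_nonneg_right (fracHom_nonneg z)) fracHom_injective

end FractionField

/-! ### The notions of the statement in a structure -/

section Notions

variable {M : Type} [CommSemiring M] [LinearOrder M]

/-- The rational number `(pos - neg) / den`. -/
structure MRat (M : Type) where
  pos : M
  neg : M
  den : M

/-- Addition of rational numbers. -/
def MRat.add (x y : MRat M) : MRat M :=
  ⟨x.pos * y.den + y.pos * x.den, x.neg * y.den + y.neg * x.den, x.den * y.den⟩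

/-- The rational number `k / p`. -/
def MRat.frac (k p : M) : MRat M := ⟨k, 0, p⟩

/-- `x < y` for rational numbers. -/
def MRat.lt (x y : MRat M) : Prop :=
  x.pos * y.den + y.neg * x.den < y.pos * x.den + x.neg * y.den

/-- `z` codes a rational number that has the property `P`. -/
def HoldsRat (z : M) (P : MRat M → Prop) : Prop :=
  ∃ p q r, z = pair (pair p q) r ∧ P ⟨p, q, r + 1⟩

/-- A real quantity, given by its rational approximations. -/
structure MQuantity (M : Type) where
  approx : M → (MRat M → Prop) → Prop
  err : ℕ

namespace MQuantity

def ofGraph (G : M → M → Prop) : MQuantity M := ⟨fun n P => ∃ z, G n z ∧ HoldsRat z P, 2⟩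

def ofRat (x : MRat M) : MQuantity M := ⟨fun _ P => P x, 0⟩

def zero : MQuantity M := ofRat (.frac 0 1)

def add (x y : MQuantity M) : MQuantity M :=
  ⟨fun n P => x.approx n fun u => y.approx n fun v => P (u.add v), x.err + y.err⟩

end MQuantity

/-- For every `n` there is exactly one `z` with `G n z`. -/
def Total (G : M → M → Prop) : Prop := ∀ n, ∃ z, G n z ∧ ∀ w, G n w → w = z

variable {S : Type} [Membership M S]

/-- `f(i) = j`. -/
def App (f : S) (i j : M) : Prop := pair i j ∈ f

variable (M) in
/-- `f` is a function. -/
def IsFun (f : S) : Prop := (∀ u : M, u ∈ f → ∃ i j, u = pair i j) ∧ Total (App (M := M) f)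

variable (S) in
/-- `2 ^ n = p`. -/
def Pow2 (n p : M) : Prop :=
  ∃ f : S, IsFun M f ∧ App f (0 : M) 1 ∧
    (∀ i j : M, App f i j → App f (i + 1) (((2 : ℕ) : M) * j)) ∧ App f n p

namespace MQuantity

variable (S)

/-- `x < y`. -/
def lt (x y : MQuantity M) : Prop :=
  ∃ n p, Pow2 S n p ∧ x.approx n fun u => y.approx n fun v =>
    (u.add (.frac ((x.err + y.err : ℕ) : M) p)).lt v

def le (x y : MQuantity M) : Prop := ¬ lt S y x

def eq (x y : MQuantity M) : Prop := le S x y ∧ le S y x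

end MQuantity

variable (S) in
/-- The sequence with graph `G` is a real number. -/
def IsRealGraph (G : M → M → Prop) : Prop :=
  Total G ∧ ∀ n, ∃ z w p, G n z ∧ G (n + 1) w ∧ Pow2 S n p ∧
    HoldsRat z fun x => HoldsRat w fun y => x.lt (y.add (.frac 1 p)) ∧ y.lt (x.add (.frac 1 p))

variable (M) in
/-- `q` codes a positive real number. -/
def IsPosReal (q : S) : Prop :=
  IsFun M q ∧ IsRealGraph S (App (M := M) q) ∧ MQuantity.zero.lt S (.ofGraph (App (M := M) q))

/-- The sequence of rationals `d(a, b)`. -/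
def DGraph (D : S) (a b n z : M) : Prop := App D (pair (pair a b) n) z

/-- `d(a, b)` for `a, b ∈ A`. -/
def mdA (D : S) (a b : M) : MQuantity M := .ofGraph (DGraph D a b)

variable (M) in
/-- `(A, D)` is a code for a complete separable metric space. -/
def IsSpace (A D : S) : Prop :=
  (∀ u : M, u ∈ D → ∃ a b n z, a ∈ A ∧ b ∈ A ∧ u = pair (pair (pair a b) n) z) ∧
  (∀ a b : M, a ∈ A → b ∈ A → IsRealGraph S (DGraph D a b)) ∧
  (∀ a : M, a ∈ A → (mdA D a a).eq S .zero) ∧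
  (∀ a b : M, a ∈ A → b ∈ A → (mdA D a b).eq S (mdA D b a) ∧ MQuantity.zero.le S (mdA D b a)) ∧
  (∀ a b c : M, a ∈ A → b ∈ A → c ∈ A → (mdA D a b).le S ((mdA D a c).add (mdA D c b)))

variable (M) in
/-- `x` is a point of the space. -/
def IsPoint (A D x : S) : Prop :=
  IsFun M x ∧ ∀ n : M, ∃ a b p, App x n a ∧ App x (n + 1) b ∧ a ∈ A ∧ b ∈ A ∧ Pow2 S n p ∧
    (mdA D a b).lt S (.ofRat (.frac 1 p))

/-- The distance of two points. -/
def mdist (D : S) (x y : M → M → Prop) : MQuantity M :=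
  ⟨fun n P => ∃ a b, x n a ∧ y n b ∧ (mdA D a b).approx n P, 6⟩

variable (M) in
/-- `y ∈ B(x, q)`. -/
def InBall (D x q y : S) : Prop :=
  (mdist D (App (M := M) x) (App y)).lt S (.ofGraph (App q))

variable (M) in
/-- The space is perfect. -/
def IsPerfect (A D : S) : Prop :=
  ∀ x : S, IsPoint M A D x → ¬ ∃ q : S, IsPosReal M q ∧ ¬ ∃ y : S, IsPoint M A D y ∧
    MQuantity.zero.lt S (mdist D (App (M := M) x) (App y)) ∧ InBall M D x q y

variable (M) in
/-- `U` is a sequence of open sets. -/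
def IsOpenSeq (A U : S) : Prop :=
  (∀ u : M, u ∈ U → ∃ n m z, u = pair (pair n m) z) ∧
  (∀ n : M, Total fun m z => App U (pair n m) z) ∧
  (∀ n m : M, ∃ a z, App U (pair n m) (pair a z) ∧ a ∈ A ∧
    HoldsRat z fun r => (MRat.frac 0 1).lt r)

/-- `x ∈ U_n`. -/
def InOpen (D U : S) (n : M) (x : S) : Prop :=
  ∃ m a z, App U (pair n m) (pair a z) ∧
    HoldsRat z fun r => (mdist D (App x) fun _ b => b = a).lt S (.ofRat r)

variable (M) in
/-- `U` is an open covering of the space. -/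
def IsCovering (A D U : S) : Prop :=
  IsOpenSeq M A U ∧ ∀ x : S, IsPoint M A D x → ∃ n : M, InOpen D U n x

variable (M) in
/-- Every open covering has a Lebesgue number. -/
def HasLebesgue (A D : S) : Prop :=
  ∀ U : S, IsCovering M A D U → ∃ q : S, IsPosReal M q ∧ ∀ x : S, IsPoint M A D x →
    ∃ n : M, ∀ y : S, IsPoint M A D y → InBall M D x q y → InOpen D U n y

variable (M) in
/-- Every open covering has a finite subcovering. -/
def HasHeineBorel (A D : S) : Prop :=
  ∀ U : S, IsCovering M A D U → ∃ F : S, (∃ k : M, ∀ n : M, n ∈ F → n < k) ∧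
    ∀ x : S, IsPoint M A D x → ∃ n : M, n ∈ F ∧ InOpen D U n x

end Notions

/-! ### Evaluation of the statement -/

section Meaning

set_option linter.unusedSectionVars false

variable {M S : Type} [CommSemiring M] [LinearOrder M] [Membership M S]

variable (M S) in
/-- The numbers of quantifiers passed, and a valuation. -/
structure Env where
  d : ℕ
  e : ℕ
  v : ℕ → M
  w : ℕ → S

/-- Environments are ordered by passing to the scope of further quantifiers. -/
instance : Preorder (Env M S) where
  le Γ Δ := Γ.d ≤ Δ.d ∧ Γ.e ≤ Δ.e ∧ (∀ i, Δ.v (i + (Δ.d - Γ.d)) = Γ.v i) ∧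
    ∀ i, Δ.w (i + (Δ.e - Γ.e)) = Γ.w i
  le_refl Γ := ⟨le_rfl, le_rfl, by simp, by simp⟩
  le_trans := by
    rintro Γ Δ Θ ⟨h₁, h₂, h₃, h₄⟩ ⟨k₁, k₂, k₃, k₄⟩
    refine ⟨h₁.trans k₁, h₂.trans k₂, fun i => ?_, fun i => ?_⟩
    · rw [← h₃, ← k₃]
      congr 1
      omega
    · rw [← h₄, ← k₄]
      congr 1
      omega

variable {Γ Δ : Env M S}

/-- The environment in the scope of a quantifier over numbers. -/
def Env.push (Γ : Env M S) (x : M) : Env M S := ⟨Γ.d + 1, Γ.e, cons x Γ.v, Γ.w⟩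

/-- The environment in the scope of a quantifier over sets. -/
def Env.pushSet (Γ : Env M S) (X : S) : Env M S := ⟨Γ.d, Γ.e + 1, Γ.v, cons X Γ.w⟩

theorem Env.le_push (Γ : Env M S) (x : M) : Γ ≤ Γ.push x :=
  ⟨Nat.le_succ _, le_rfl, by simp [push], by simp [push]⟩

theorem Env.le_pushSet (Γ : Env M S) (X : S) : Γ ≤ Γ.pushSet X :=
  ⟨le_rfl, Nat.le_succ _, by simp [pushSet], by simp [pushSet]⟩

/-- The term `t` has the value `x` in `Γ` and its extensions. -/
def Den (Γ : Env M S) (t : Num) (x : M) : Prop := ∀ Δ, Γ ≤ Δ → (t Δ.d).eval Δ.v = x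

/-- The set variable `X` has the value `A`. -/
def DenSet (Γ : Env M S) (X : SetVar) (A : S) : Prop := ∀ Δ, Γ ≤ Δ → Δ.w (X Δ.e) = A

/-- The statement `φ` is true if and only if `P`. -/
def Means (Γ : Env M S) (φ : Stmt) (P : Prop) : Prop :=
  ∀ Δ, Γ ≤ Δ → ((φ Δ.d Δ.e).eval Δ.v Δ.w ↔ P)

/-- `Den`, `DenSet` and `Means` quantify over all extensions of the environment so that an
expression keeps its meaning under further quantifiers. -/
theorem Den.mono {t : Num} {x : M} (h : Den Γ t x) (hΓ : Γ ≤ Δ) : Den Δ t x :=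
  fun Θ hΘ => h Θ (hΓ.trans hΘ)

theorem DenSet.mono {X : SetVar} {A : S} (h : DenSet Γ X A) (hΓ : Γ ≤ Δ) : DenSet Δ X A :=
  fun Θ hΘ => h Θ (hΓ.trans hΘ)

/-- The case `i = 0` of the condition on valuations in the order. It is the passage from quantifier
depths to de Bruijn indices used in `allN` and `exN`. -/
theorem Env.den_push (Γ : Env M S) (x : M) :
    Den (Γ.push x) (fun d => .var (d - (Γ.d + 1))) x := fun Δ h => by
  have := h.2.2.1 0
  rwa [Nat.zero_add] at this

theorem Env.denSet_pushSet (Γ : Env M S) (X : S) :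
    DenSet (Γ.pushSet X) (fun e => e - (Γ.e + 1)) X := fun Δ h => by
  have := h.2.2.2 0
  rwa [Nat.zero_add] at this

namespace Den

variable {s t : Num} {x y : M}

theorem zero : Den Γ nZero (0 : M) := fun _ _ => rfl

theorem one : Den Γ nOne (1 : M) := fun _ _ => rfl

theorem add (hs : Den Γ s x) (ht : Den Γ t y) : Den Γ (nAdd s t) (x + y) :=
  fun Δ h => congrArg₂ (· + ·) (hs Δ h) (ht Δ h)

theorem mul (hs : Den Γ s x) (ht : Den Γ t y) : Den Γ (nMul s t) (x * y) :=
  fun Δ h => congrArg₂ (· * ·) (hs Δ h) (ht Δ h)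

theorem pair (hs : Den Γ s x) (ht : Den Γ t y) : Den Γ (nPair s t) (pair x y) :=
  ((hs.add ht).mul (hs.add ht)).add hs

theorem lit (k : ℕ) : Den Γ (nLit k) (k : M) := by
  induction k with
  | zero => exact Nat.cast_zero (R := M) ▸ zero
  | succ k ih => exact Nat.cast_succ (R := M) k ▸ ih.add one

end Den

namespace Means

variable {φ ψ : Stmt} {P Q : Prop} {s t : Num} {x y : M}

theorem not (h : Means Γ φ P) : Means Γ (sNot φ) (¬ P) := fun Δ hΔ => not_congr (h Δ hΔ)

theorem imp (h : Means Γ φ P) (h' : Means Γ ψ Q) : Means Γ (sImp φ ψ) (P → Q) :=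
  fun Δ hΔ => imp_congr (h Δ hΔ) (h' Δ hΔ)

theorem and (h : Means Γ φ P) (h' : Means Γ ψ Q) : Means Γ (sAnd φ ψ) (P ∧ Q) :=
  fun Δ hΔ => Formula.eval_and.trans (and_congr (h Δ hΔ) (h' Δ hΔ))

theorem eq (hs : Den Γ s x) (ht : Den Γ t y) : Means Γ (sEq s t) (x = y) := fun Δ hΔ => by
  show (s Δ.d).eval Δ.v = (t Δ.d).eval Δ.v ↔ _
  rw [hs Δ hΔ, ht Δ hΔ]

theorem lt (hs : Den Γ s x) (ht : Den Γ t y) : Means Γ (sLt s t) (x < y) := fun Δ hΔ => by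
  show (s Δ.d).eval Δ.v < (t Δ.d).eval Δ.v ↔ _
  rw [hs Δ hΔ, ht Δ hΔ]

theorem mem {X : SetVar} {A : S} (ht : Den Γ t x) (hX : DenSet Γ X A) :
    Means Γ (sMem t X) (x ∈ A) := fun Δ hΔ => by
  show (t Δ.d).eval Δ.v ∈ Δ.w (X Δ.e) ↔ _
  rw [ht Δ hΔ, hX Δ hΔ]

theorem allN {φ : Num → Stmt} {P : M → Prop}
    (h : ∀ {Δ t x}, Γ ≤ Δ → Den Δ t x → Means Δ (φ t) (P x)) : Means Γ (allN φ) (∀ x, P x) :=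
  fun Δ hΔ => forall_congr' fun x =>
    h (hΔ.trans (Δ.le_push x)) (Δ.den_push x) _ le_rfl

theorem exN {φ : Num → Stmt} {P : M → Prop}
    (h : ∀ {Δ t x}, Γ ≤ Δ → Den Δ t x → Means Δ (φ t) (P x)) : Means Γ (exN φ) (∃ x, P x) :=
  fun Δ hΔ => Formula.eval_ex.trans (exists_congr fun x =>
    h (hΔ.trans (Δ.le_push x)) (Δ.den_push x) _ le_rfl)

theorem allS {φ : SetVar → Stmt} {P : S → Prop}
    (h : ∀ {Δ X A}, Γ ≤ Δ → DenSet Δ X A → Means Δ (φ X) (P A)) : Means Γ (allS φ) (∀ A, P A) :=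
  fun Δ hΔ => forall_congr' fun X =>
    h (hΔ.trans (Δ.le_pushSet X)) (Δ.denSet_pushSet X) _ le_rfl

theorem exS {φ : SetVar → Stmt} {P : S → Prop}
    (h : ∀ {Δ X A}, Γ ≤ Δ → DenSet Δ X A → Means Δ (φ X) (P A)) : Means Γ (exS φ) (∃ A, P A) :=
  fun Δ hΔ => Formula.eval_exSet.trans (exists_congr fun X =>
    h (hΔ.trans (Δ.le_pushSet X)) (Δ.denSet_pushSet X) _ le_rfl)

end Means

/-- The graph `G` means the relation `R`. -/
def MeansGraph (Γ : Env M S) (G : Graph) (R : M → M → Prop) : Prop :=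
  ∀ {Δ s t x y}, Γ ≤ Δ → Den Δ s x → Den Δ t y → Means Δ (G s t) (R x y)

/-- The rational number `r` has the value `x`. -/
def DenRat (Γ : Env M S) (r : RatTerm) (x : MRat M) : Prop :=
  Den Γ r.pos x.pos ∧ Den Γ r.neg x.neg ∧ Den Γ r.den x.den

theorem DenRat.mono {r : RatTerm} {x : MRat M} (h : DenRat Γ r x) (hΓ : Γ ≤ Δ) : DenRat Δ r x :=
  ⟨h.1.mono hΓ, h.2.1.mono hΓ, h.2.2.mono hΓ⟩

theorem DenRat.add {r s : RatTerm} {x y : MRat M} (hr : DenRat Γ r x) (hs : DenRat Γ s y) :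
    DenRat Γ (r.add s) (x.add y) :=
  ⟨.add (.mul hr.1 hs.2.2) (.mul hs.1 hr.2.2), .add (.mul hr.2.1 hs.2.2) (.mul hs.2.1 hr.2.2),
    .mul hr.2.2 hs.2.2⟩

theorem DenRat.frac {s t : Num} {x y : M} (hs : Den Γ s x) (ht : Den Γ t y) :
    DenRat Γ (.frac s t) (.frac x y) := ⟨hs, .zero, ht⟩

theorem DenRat.lt {r s : RatTerm} {x y : MRat M} (hr : DenRat Γ r x) (hs : DenRat Γ s y) :
    Means Γ (r.lt s) (x.lt y) :=
  .lt (.add (.mul hr.1 hs.2.2) (.mul hs.2.1 hr.2.2)) (.add (.mul hs.1 hr.2.2) (.mul hr.2.1 hs.2.2))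

/-- The property `φ` of rational numbers means `P`. -/
def MeansProp (Γ : Env M S) (φ : RatTerm → Stmt) (P : MRat M → Prop) : Prop :=
  ∀ {Δ r x}, Γ ≤ Δ → DenRat Δ r x → Means Δ (φ r) (P x)

theorem MeansProp.mono {φ : RatTerm → Stmt} {P : MRat M → Prop} (h : MeansProp Γ φ P)
    (hΓ : Γ ≤ Δ) : MeansProp Δ φ P := fun hΔ => h (hΓ.trans hΔ)

/-- The quantity `X` means `Y`. -/
def MeansQuantity (Γ : Env M S) (X : Quantity) (Y : MQuantity M) : Prop :=
  X.err = Y.err ∧ ∀ {Δ t x φ P}, Γ ≤ Δ → Den Δ t x → MeansProp Δ φ P →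
    Means Δ (X.approx t φ) (Y.approx x P)

variable {f A D U x q y : SetVar} {F A' D' U' x' q' y' : S} {s t a b : Num} {m n a' b' : M}

theorem MeansGraph.sApp (hf : DenSet Γ f F) : MeansGraph Γ (sApp f) (App F) :=
  fun h hs ht => .mem (hs.pair ht) (hf.mono h)

theorem MeansGraph.sTotal {G : Graph} {R : M → M → Prop} (hG : MeansGraph Γ G R) :
    Means Γ (sTotal G) (Total R) :=
  .allN fun h₁ hn => .exN fun h₂ hz => .and (hG (h₁.trans h₂) (hn.mono h₂) hz)
    (.allN fun h₃ hw => .imp (hG (h₁.trans (h₂.trans h₃)) (hn.mono (h₂.trans h₃)) hw)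
      (.eq hw (hz.mono h₃)))

theorem Means.sFun (hf : DenSet Γ f F) : Means Γ (sFun f) (IsFun M F) :=
  .and (.allN fun h₁ hu => .imp (.mem hu (hf.mono h₁)) (.exN fun h₂ hi => .exN fun h₃ hj =>
    .eq (hu.mono (h₂.trans h₃)) ((hi.mono h₃).pair hj))) (MeansGraph.sTotal (MeansGraph.sApp hf))

theorem Means.sPow2 (hs : Den Γ s m) (ht : Den Γ t n) : Means Γ (sPow2 s t) (Pow2 S m n) :=
  .exS fun h hf => .and (.sFun hf) <| .and (MeansGraph.sApp hf le_rfl .zero .one) <|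
    .and (.allN fun h₁ hi => .allN fun h₂ hj =>
      .imp (MeansGraph.sApp hf (h₁.trans h₂) (hi.mono h₂) hj)
        (MeansGraph.sApp hf (h₁.trans h₂) ((hi.mono h₂).add .one) ((Den.lit 2).mul hj)))
    (MeansGraph.sApp hf le_rfl (hs.mono h) (ht.mono h))

theorem Means.sRat {φ : RatTerm → Stmt} {P : MRat M → Prop} (ht : Den Γ t m)
    (hφ : MeansProp Γ φ P) : Means Γ (sRat t φ) (HoldsRat m P) :=
  .exN fun h₁ hp => .exN fun h₂ hq => .exN fun h₃ hr =>
    .and (.eq (ht.mono (h₁.trans (h₂.trans h₃)))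
      (((hp.mono (h₂.trans h₃)).pair (hq.mono h₃)).pair hr))
      (hφ (h₁.trans (h₂.trans h₃)) ⟨hp.mono (h₂.trans h₃), hq.mono h₃, hr.add .one⟩)

namespace MeansQuantity

variable {X X' : Quantity} {Y Y' : MQuantity M}

theorem ofGraph {G : Graph} {R : M → M → Prop} (hG : MeansGraph Γ G R) :
    MeansQuantity Γ (.ofGraph G) (.ofGraph R) :=
  ⟨rfl, fun h ht hφ => .exN fun h₁ hz =>
    .and (hG (h.trans h₁) (ht.mono h₁) hz) (.sRat hz (hφ.mono h₁))⟩

theorem ofRat {r : RatTerm} {z : MRat M} (hr : DenRat Γ r z) :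
    MeansQuantity Γ (.ofRat r) (.ofRat z) := ⟨rfl, fun h _ hφ => hφ le_rfl (hr.mono h)⟩

theorem zero : MeansQuantity Γ .zero (.zero : MQuantity M) := ofRat (.frac .zero .one)

theorem add (h : MeansQuantity Γ X Y) (h' : MeansQuantity Γ X' Y') :
    MeansQuantity Γ (X.add X') (Y.add Y') :=
  ⟨congrArg₂ (· + ·) h.1 h'.1, fun k ht hφ => h.2 k ht fun k₁ hr =>
    h'.2 (k.trans k₁) (ht.mono k₁) fun k₂ hs => hφ (k₁.trans k₂) ((hr.mono k₂).add hs)⟩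

theorem lt (h : MeansQuantity Γ X Y) (h' : MeansQuantity Γ X' Y') :
    Means Γ (X.lt X') (Y.lt S Y') :=
  .exN fun k₁ hn => .exN fun k₂ hp => .and (.sPow2 (hn.mono k₂) hp) <|
    h.2 (k₁.trans k₂) (hn.mono k₂) fun k₃ hu =>
      h'.2 (k₁.trans (k₂.trans k₃)) (hn.mono (k₂.trans k₃)) fun k₄ hv =>
        have he : Den _ (nLit (X.err + X'.err)) ((Y.err + Y'.err : ℕ) : M) := by
          rw [h.1, h'.1]; exact .lit _
        DenRat.lt ((hu.mono k₄).add (.frac he (hp.mono (k₃.trans k₄)))) hv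

theorem le (h : MeansQuantity Γ X Y) (h' : MeansQuantity Γ X' Y') :
    Means Γ (X.le X') (Y.le S Y') := .not (h'.lt h)

theorem eq (h : MeansQuantity Γ X Y) (h' : MeansQuantity Γ X' Y') :
    Means Γ (X.eq X') (Y.eq S Y') := .and (h.le h') (h'.le h)

end MeansQuantity

theorem Means.sIsReal {G : Graph} {R : M → M → Prop} (hG : MeansGraph Γ G R) :
    Means Γ (sIsReal G) (IsRealGraph S R) :=
  .and hG.sTotal <| .allN fun h₁ hn => .exN fun h₂ hz => .exN fun h₃ hw => .exN fun h₄ hp =>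
    .and (hG (h₁.trans (h₂.trans (h₃.trans h₄))) (hn.mono (h₂.trans (h₃.trans h₄)))
      (hz.mono (h₃.trans h₄))) <|
    .and (hG (h₁.trans (h₂.trans (h₃.trans h₄))) ((hn.mono (h₂.trans (h₃.trans h₄))).add .one)
      (hw.mono h₄)) <|
    .and (.sPow2 (hn.mono (h₂.trans (h₃.trans h₄))) hp) <|
    .sRat (hz.mono (h₃.trans h₄)) fun h₅ hx => .sRat (hw.mono (h₄.trans h₅)) fun h₆ hy =>
      .and (DenRat.lt (hx.mono h₆) (.add hy (.frac .one (hp.mono (h₅.trans h₆)))))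
        (DenRat.lt hy (.add (hx.mono h₆) (.frac .one (hp.mono (h₅.trans h₆)))))

theorem Means.sPosReal (hq : DenSet Γ q q') : Means Γ (sPosReal q) (IsPosReal M q') :=
  .and (.sFun hq) <| .and (.sIsReal (MeansGraph.sApp hq)) <|
      MeansQuantity.lt .zero (MeansQuantity.ofGraph (MeansGraph.sApp hq))

theorem MeansGraph.dGraph (hD : DenSet Γ D D') (ha : Den Γ a a') (hb : Den Γ b b') :
    MeansGraph Γ (dGraph D a b) (DGraph D' a' b') := fun h hn hz =>
  MeansGraph.sApp (hD.mono h) le_rfl (((ha.mono h).pair (hb.mono h)).pair hn) hz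

theorem MeansQuantity.dA (hD : DenSet Γ D D') (ha : Den Γ a a') (hb : Den Γ b b') :
    MeansQuantity Γ (dA D a b) (mdA D' a' b') := MeansQuantity.ofGraph (MeansGraph.dGraph hD ha hb)

theorem Means.sSpace (hA : DenSet Γ A A') (hD : DenSet Γ D D') :
    Means Γ (sSpace A D) (IsSpace M A' D') := by
  refine .and ?_ (.and ?_ (.and ?_ (.and ?_ ?_)))
  · exact .allN fun h hu => .imp (.mem hu (hD.mono h)) <|
      .exN fun h₁ ha => .exN fun h₂ hb => .exN fun h₃ hn => .exN fun h₄ hz =>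
        have k₃ := h₃.trans h₄
        have k₂ := h₂.trans k₃
        have k₁ := h₁.trans k₂
        .and (.mem (ha.mono k₂) (hA.mono (h.trans k₁))) <|
        .and (.mem (hb.mono k₃) (hA.mono (h.trans k₁))) <|
        .eq (hu.mono k₁) ((((ha.mono k₂).pair (hb.mono k₃)).pair (hn.mono h₄)).pair hz)
  · exact .allN fun h₁ ha => .allN fun h₂ hb =>
      .imp (.mem (ha.mono h₂) (hA.mono (h₁.trans h₂))) <|
      .imp (.mem hb (hA.mono (h₁.trans h₂))) <|
      .sIsReal (MeansGraph.dGraph (hD.mono (h₁.trans h₂)) (ha.mono h₂) hb)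
  · exact .allN fun h₁ ha => .imp (.mem ha (hA.mono h₁))
      (MeansQuantity.eq (MeansQuantity.dA (hD.mono h₁) ha ha) .zero)
  · exact .allN fun h₁ ha => .allN fun h₂ hb =>
      have hD := hD.mono (h₁.trans h₂)
      have ha := ha.mono h₂
      .imp (.mem ha (hA.mono (h₁.trans h₂))) <|
      .imp (.mem hb (hA.mono (h₁.trans h₂))) <|
      .and (MeansQuantity.eq (MeansQuantity.dA hD ha hb) (MeansQuantity.dA hD hb ha))
          (MeansQuantity.le .zero (MeansQuantity.dA hD hb ha))
  · exact .allN fun h₁ ha => .allN fun h₂ hb => .allN fun h₃ hc =>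
      have hD := hD.mono (h₁.trans (h₂.trans h₃))
      have hA := hA.mono (h₁.trans (h₂.trans h₃))
      have ha := ha.mono (h₂.trans h₃)
      have hb := hb.mono h₃
      .imp (.mem ha hA) <| .imp (.mem hb hA) <| .imp (.mem hc hA) <|
      MeansQuantity.le (MeansQuantity.dA hD ha hb)
          (.add (MeansQuantity.dA hD ha hc) (MeansQuantity.dA hD hc hb))

theorem Means.sPoint (hA : DenSet Γ A A') (hD : DenSet Γ D D') (hx : DenSet Γ x x') :
    Means Γ (sPoint A D x) (IsPoint M A' D' x') :=
  .and (.sFun hx) <| .allN fun h₁ hn => .exN fun h₂ ha => .exN fun h₃ hb => .exN fun h₄ hp =>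
    have k₃ := h₃.trans h₄
    have k₂ := h₂.trans k₃
    have k₁ := h₁.trans k₂
    have ha := ha.mono k₃
    have hb := hb.mono h₄
    .and (MeansGraph.sApp (hx.mono k₁) le_rfl (hn.mono k₂) ha) <|
    .and (MeansGraph.sApp (hx.mono k₁) le_rfl ((hn.mono k₂).add .one) hb) <|
    .and (.mem ha (hA.mono k₁)) <| .and (.mem hb (hA.mono k₁)) <|
    .and (.sPow2 (hn.mono k₂) hp) <|
    MeansQuantity.lt (MeansQuantity.dA (hD.mono k₁) ha hb) (.ofRat (.frac .one hp))

theorem MeansQuantity.dist {G H : Graph} {R R' : M → M → Prop} (hD : DenSet Γ D D')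
    (hG : MeansGraph Γ G R) (hH : MeansGraph Γ H R') :
    MeansQuantity Γ (dist D G H) (mdist D' R R') :=
  ⟨rfl, fun h hn hφ => .exN fun h₁ ha => .exN fun h₂ hb =>
    have k₁ := h₁.trans h₂
    .and (hG (h.trans k₁) (hn.mono k₁) (ha.mono h₂)) <|
    .and (hH (h.trans k₁) (hn.mono k₁) hb) <|
    (MeansQuantity.dA (hD.mono (h.trans k₁)) (ha.mono h₂) hb).2 le_rfl (hn.mono k₁) (hφ.mono k₁)⟩

theorem Means.sBall (hD : DenSet Γ D D') (hx : DenSet Γ x x') (hq : DenSet Γ q q')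
    (hy : DenSet Γ y y') : Means Γ (sBall D x q y) (InBall M D' x' q' y') :=
  MeansQuantity.lt (MeansQuantity.dist hD (MeansGraph.sApp hx) (MeansGraph.sApp hy))
      (MeansQuantity.ofGraph (MeansGraph.sApp hq))

theorem Means.sPerfect (hA : DenSet Γ A A') (hD : DenSet Γ D D') :
    Means Γ (sPerfect A D) (IsPerfect M A' D') :=
  .allS fun h hx => .imp (.sPoint (hA.mono h) (hD.mono h) hx) <| .not <|
    .exS fun h₁ hq => .and (.sPosReal hq) <| .not <| .exS fun h₂ hy =>
      have hA := hA.mono (h.trans (h₁.trans h₂))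
      have hD := hD.mono (h.trans (h₁.trans h₂))
      have hx := hx.mono (h₁.trans h₂)
      .and (.sPoint hA hD hy) <|
      .and (MeansQuantity.lt .zero (MeansQuantity.dist hD (MeansGraph.sApp hx) (MeansGraph.sApp hy)))
          (.sBall hD hx (hq.mono h₂) hy)

theorem Means.sOpenSeq (hA : DenSet Γ A A') (hU : DenSet Γ U U') :
    Means Γ (sOpenSeq A U) (IsOpenSeq M A' U') := by
  refine .and ?_ (.and ?_ ?_)
  · exact .allN fun h hu => .imp (.mem hu (hU.mono h)) <|
      .exN fun h₁ hn => .exN fun h₂ hm => .exN fun h₃ hz =>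
        .eq (hu.mono (h₁.trans (h₂.trans h₃)))
          (((hn.mono (h₂.trans h₃)).pair (hm.mono h₃)).pair hz)
  · exact .allN fun h hn => MeansGraph.sTotal fun h₁ hm hz =>
      MeansGraph.sApp (hU.mono (h.trans h₁)) le_rfl ((hn.mono h₁).pair hm) hz
  · exact .allN fun h hn => .allN fun h₁ hm => .exN fun h₂ ha => .exN fun h₃ hz =>
      have k₂ := h₂.trans h₃
      have k₁ := h₁.trans k₂
      .and (MeansGraph.sApp (hU.mono (h.trans k₁)) le_rfl ((hn.mono k₁).pair (hm.mono k₂))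
        ((ha.mono h₃).pair hz)) <|
      .and (.mem (ha.mono h₃) (hA.mono (h.trans k₁))) <|
      .sRat hz fun _ hr => DenRat.lt (.frac .zero .one) hr

theorem Means.sMemOpen (hD : DenSet Γ D D') (hU : DenSet Γ U U') (ht : Den Γ t m)
    (hx : DenSet Γ x x') : Means Γ (sMemOpen D U t x) (InOpen D' U' m x') :=
  .exN fun h hm => .exN fun h₁ ha => .exN fun h₂ hz =>
    have k₁ := h₁.trans h₂
    have k := h.trans k₁
    .and (MeansGraph.sApp (hU.mono k) le_rfl
        ((ht.mono k).pair (hm.mono k₁)) ((ha.mono h₂).pair hz)) <|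
    .sRat hz fun h₃ hr => MeansQuantity.lt (MeansQuantity.dist (hD.mono (k.trans h₃))
        (MeansGraph.sApp (hx.mono (k.trans h₃)))
      fun h₄ _ hb => .eq hb (ha.mono (h₂.trans (h₃.trans h₄)))) (.ofRat hr)

theorem Means.sCovering (hA : DenSet Γ A A') (hD : DenSet Γ D D') (hU : DenSet Γ U U') :
    Means Γ (sCovering A D U) (IsCovering M A' D' U') :=
  .and (.sOpenSeq hA hU) <| .allS fun h hx => .imp (.sPoint (hA.mono h) (hD.mono h) hx) <|
    .exN fun h₁ hn => .sMemOpen (hD.mono (h.trans h₁)) (hU.mono (h.trans h₁)) hn (hx.mono h₁)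

theorem Means.sLebesgue (hA : DenSet Γ A A') (hD : DenSet Γ D D') :
    Means Γ (sLebesgue A D) (HasLebesgue M A' D') :=
  .allS fun h hU => .imp (.sCovering (hA.mono h) (hD.mono h) hU) <|
    .exS fun h₁ hq => .and (.sPosReal hq) <| .allS fun h₂ hx =>
      .imp (.sPoint (hA.mono (h.trans (h₁.trans h₂))) (hD.mono (h.trans (h₁.trans h₂))) hx) <|
      .exN fun h₃ hn => .allS fun h₄ hy =>
        have k₃ := h₃.trans h₄
        have k₂ := h₂.trans k₃
        have k₁ := h₁.trans k₂
        have hD := hD.mono (h.trans k₁)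
        .imp (.sPoint (hA.mono (h.trans k₁)) hD hy) <|
        .imp (.sBall hD (hx.mono k₃) (hq.mono k₂) hy) <|
        .sMemOpen hD (hU.mono k₁) (hn.mono h₄) hy

theorem Means.sHeineBorel (hA : DenSet Γ A A') (hD : DenSet Γ D D') :
    Means Γ (sHeineBorel A D) (HasHeineBorel M A' D') :=
  .allS fun h hU => .imp (.sCovering (hA.mono h) (hD.mono h) hU) <| .exS fun h₁ hF =>
    .and (.exN fun h₂ hk => .allN fun h₃ hn => .imp (.mem hn (hF.mono (h₂.trans h₃)))
      (.lt hn (hk.mono h₃))) <|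
    .allS fun h₂ hx =>
      have k₁ := h₁.trans h₂
      .imp (.sPoint (hA.mono (h.trans k₁)) (hD.mono (h.trans k₁)) hx) <|
      .exN fun h₃ hn => .and (.mem hn (hF.mono (h₂.trans h₃))) <|
        .sMemOpen (hD.mono (h.trans (k₁.trans h₃))) (hU.mono (k₁.trans h₃)) hn (hx.mono h₃)

/-- The truth of the sentence in a structure. -/
theorem eval_perfectLebesgueHeineBorel (v : ℕ → M) (w : ℕ → S) :
    perfectLebesgueHeineBorel.eval v w ↔ ∀ A D : S, IsSpace M A D → IsPerfect M A D →
      HasLebesgue M A D → HasHeineBorel M A D := by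
  have : Means (Γ := (⟨0, 0, v, w⟩ : Env M S)) (SecondOrderArithmetic.allS fun A =>
      SecondOrderArithmetic.allS fun D =>
        sImp (sSpace A D) (sImp (sPerfect A D) (sImp (sLebesgue A D) (sHeineBorel A D))))
      (∀ A D : S, IsSpace M A D → IsPerfect M A D → HasLebesgue M A D → HasHeineBorel M A D) :=
    .allS fun _ hA => .allS fun h₁ hD =>
      have hA := hA.mono h₁
      .imp (.sSpace hA hD) <| .imp (.sPerfect hA hD) <| .imp (.sLebesgue hA hD) (.sHeineBorel hA hD)
  rw [perfectLebesgueHeineBorel]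
  exact this ⟨0, 0, v, w⟩ le_rfl

end Meaning

/-! ### Rational numbers of a model -/

section Rationals

variable {M : Type} [CommSemiring M] [LinearOrder M] [IsStrictOrderedRing M]
  [CanonicallyOrderedAdd M]

theorem fracHom_pos {a : M} (h : 0 < a) : 0 < fracHom M a := by
  simpa using fracHom_strictMono h

/-- The value of a rational number. -/
noncomputable def MRat.val (x : MRat M) : Frac M :=
  (fracHom M x.pos - fracHom M x.neg) / fracHom M x.den

theorem MRat.val_add {x y : MRat M} (hx : 0 < x.den) (hy : 0 < y.den) :
    (x.add y).val = x.val + y.val := by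
  have hx' := (fracHom_pos hx).ne'
  have hy' := (fracHom_pos hy).ne'
  simp only [val, add, map_add, map_mul]
  field_simp
  ring

theorem MRat.val_frac (k p : M) : (MRat.frac k p).val = fracHom M k / fracHom M p := by
  simp [val, frac]

theorem MRat.lt_iff {x y : MRat M} (hx : 0 < x.den) (hy : 0 < y.den) :
    x.lt y ↔ x.val < y.val := by
  rw [val, val, div_lt_div_iff₀ (fracHom_pos hx) (fracHom_pos hy), lt,
    ← fracHom_strictMono.lt_iff_lt]
  simp only [map_add, map_mul]
  constructor <;> intro h <;> linarith

/-- The rational number coded by `z`. -/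
noncomputable def ratOf (z : M) : MRat M := ⟨fst (fst z), snd (fst z), snd z + 1⟩

theorem ratOf_den_pos (z : M) : 0 < (ratOf z).den :=
  zero_lt_one.trans_le le_add_self

/-- Pairing is injective, so the quantified numerator and denominator are functions of the code.
Being a code is separated from the property of the number coded. -/
theorem HoldsRat.elim {S : Type} [Membership M S] [IsModel M S] {z : M} {P : MRat M → Prop} :
    HoldsRat z P ↔ HoldsRat z (fun _ => True) ∧ P (ratOf z) := by
  constructor
  · rintro ⟨p, q, r, rfl, h⟩
    refine ⟨⟨p, q, r, rfl, trivial⟩, ?_⟩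
    rwa [ratOf, fst_pair S, fst_pair S, snd_pair S, snd_pair S]
  · rintro ⟨⟨p, q, r, rfl, -⟩, h⟩
    refine ⟨p, q, r, rfl, ?_⟩
    rwa [ratOf, fst_pair S, fst_pair S, snd_pair S, snd_pair S] at h

/-- The value of the rational number coded by `z`. -/
noncomputable def ratVal (z : M) : Frac M := (ratOf z).val

variable {S : Type} [Membership M S] [IsModel M S]

variable (S) in
/-- Functions to the rational numbers with numerators and denominators that have `Σ⁰₁` graphs. -/
def RatFn (q : (ℕ → M) → Frac M) : Prop :=
  ∃ a b c : (ℕ → M) → M, Fn S a ∧ Fn S b ∧ Fn S c ∧ (∀ v, 0 < c v) ∧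
    ∀ v, q v = (fracHom M (a v) - fracHom M (b v)) / fracHom M (c v)

namespace RatFn

variable {q r : (ℕ → M) → Frac M}

theorem ratVal {f : (ℕ → M) → M} (hf : Fn S f) : RatFn S fun v => ratVal (f v) :=
  ⟨_, _, _, hf.fst'.fst', hf.fst'.snd', hf.snd'.add (.const 1), fun v => ratOf_den_pos (f v),
    fun _ => rfl⟩

theorem add (hq : RatFn S q) (hr : RatFn S r) : RatFn S fun v => q v + r v := by
  obtain ⟨a, b, c, ha, hb, hc, h, hq⟩ := hq
  obtain ⟨a', b', c', ha', hb', hc', h', hr⟩ := hr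
  refine ⟨_, _, _, (ha.mul hc').add (ha'.mul hc), (hb.mul hc').add (hb'.mul hc), hc.mul hc',
    fun v => mul_pos (h v) (h' v), fun v => ?_⟩
  have hx' := (fracHom_pos (h v)).ne'
  have hy' := (fracHom_pos (h' v)).ne'
  simp only [hq, hr, map_add, map_mul]
  field_simp
  ring

theorem neg (hq : RatFn S q) : RatFn S fun v => - q v := by
  obtain ⟨a, b, c, ha, hb, hc, h, hq⟩ := hq
  exact ⟨b, a, c, hb, ha, hc, h, fun v => by simp only [hq]; rw [← neg_div, neg_sub]⟩

theorem sub (hq : RatFn S q) (hr : RatFn S r) : RatFn S fun v => q v - r v := by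
  simpa only [sub_eq_add_neg] using hq.add hr.neg

theorem const (x : Frac M) : RatFn S fun _ => x := by
  obtain ⟨a, b, hb, h⟩ := x.exists_eq_or
  have hb := pos_iff_ne_zero.2 hb
  rcases h with h | h
  · exact ⟨_, _, _, .const a, .const 0, .const b, fun _ => hb, fun _ => by rw [h]; simp⟩
  · exact ⟨_, _, _, .const 0, .const a, .const b, fun _ => hb, fun _ => by
      rw [h]; simp [neg_div]⟩

theorem two_mul (hq : RatFn S q) : RatFn S fun v => 2 * q v := by
  simpa only [_root_.two_mul] using hq.add hq

/-- Clearing denominators and moving negative terms to the other side leaves an inequality between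
numbers of the model. -/
theorem lt (hq : RatFn S q) (hr : RatFn S r) : Sig S fun v => q v < r v := by
  obtain ⟨a, b, c, ha, hb, hc, h, hq⟩ := hq
  obtain ⟨a', b', c', ha', hb', hc', h', hr⟩ := hr
  refine (Sig.lt ((ha.mul hc').add (hb'.mul hc)) ((ha'.mul hc).add (hb.mul hc'))).congr fun v => ?_
  rw [hq, hr, ← fracHom_strictMono.lt_iff_lt,
    div_lt_div_iff₀ (fracHom_pos (h v)) (fracHom_pos (h' v))]
  simp only [map_add, map_mul]
  constructor <;> intro h <;> linarith

theorem le (hq : RatFn S q) (hr : RatFn S r) : Sig S fun v => q v ≤ r v := by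
  obtain ⟨a, b, c, ha, hb, hc, h, hq⟩ := hq
  obtain ⟨a', b', c', ha', hb', hc', h', hr⟩ := hr
  refine (Sig.le ((ha.mul hc').add (hb'.mul hc)) ((ha'.mul hc).add (hb.mul hc'))).congr fun v => ?_
  rw [hq, hr, ← fracHom_strictMono.le_iff_le,
    div_le_div_iff₀ (fracHom_pos (h v)) (fracHom_pos (h' v))]
  simp only [map_add, map_mul]
  constructor <;> intro h <;> linarith

end RatFn

/-! Functions coded by sets -/

theorem IsFun.exists_eq {f : S} (hf : IsFun M f) : ∃ F : M → M, (Fn S fun v => F (v 0)) ∧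
    ∀ n w, App f n w ↔ w = F n := by
  choose F hF using hf.2
  have h : ∀ n w, App f n w ↔ w = F n := fun n w => ⟨(hF n).2 w, fun h => h ▸ (hF n).1⟩
  exact ⟨F, Fn.of_graph (R := fun w v => App f (v 0) w)
    (Sig.mem (Fn.pair' (.var 1) (.var 0)) f) fun w v => h _ _, h⟩

theorem Fn.exists_isFun {F : M → M} (hF : Fn S fun v => F (v 0)) :
    ∃ f : S, IsFun M f ∧ ∀ n w, App f n w ↔ w = F n := by
  obtain ⟨X, hX⟩ := Fn.exists_graph hF
  have h : ∀ n w, App X n w ↔ w = F n := fun n w => by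
    rw [App, hX, fst_pair S]
    exact ⟨fun h => (pair_inj S h).2, fun h => by rw [h]⟩
  exact ⟨X, ⟨fun u hu => ⟨_, _, (hX u).1 hu⟩, fun n => ⟨F n, (h _ _).2 rfl, fun w => (h _ _).1⟩⟩, h⟩

/-! Powers of two -/

variable (S) in
/-- `e` is the function `n ↦ 2 ^ n`. -/
structure IsExp (e : M → M) : Prop where
  fn : Fn S fun v => e (v 0)
  zero : e 0 = 1
  succ (n : M) : e (n + 1) = 2 * e n
  pow2_iff (n p : M) : Pow2 S n p ↔ p = e n

/-- A single instance of `Pow2` already provides a code of the whole exponential function, so no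
primitive recursion has to be carried out in the model. Any other code agrees with it by induction.
-/
theorem exists_isExp {n p : M} (h : Pow2 S n p) : ∃ e : M → M, IsExp S e := by
  obtain ⟨f, hf, h0, hs, -⟩ := h
  obtain ⟨e, he, hfe⟩ := hf.exists_eq
  have e0 : e 0 = 1 := ((hfe _ _).1 h0).symm
  have es : ∀ n, e (n + 1) = 2 * e n := fun n => by
    have := ((hfe _ _).1 (hs n (e n) ((hfe _ _).2 rfl))).symm
    simpa using this
  refine ⟨e, he, e0, es, fun n p => ⟨?_, ?_⟩⟩
  · rintro ⟨g, hg, g0, gs, gp⟩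
    have key : ∀ n, App g n (e n) := Sig.induction (S := S) (P := fun n => App g n (e n))
      (Sig.mem (Fn.pair' (.var 0) he) g) (by rwa [e0]) fun n hn => by
        rw [es]
        simpa using gs n _ hn
    obtain ⟨q, -, hq⟩ := hg.2 n
    rw [hq p gp, hq _ (key n)]
  · rintro rfl
    exact ⟨f, hf, h0, hs, (hfe _ _).2 rfl⟩

/-- `2 ^ (-n)`. -/
noncomputable def eps (e : M → M) (n : M) : Frac M := 1 / fracHom M (e n)

theorem one_le_of_pos' (S : Type) [Membership M S] [IsModel M S] {x : M} (h : 0 < x) : 1 ≤ x := by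
  have := (lt_add_one_iff' S (x := 1) (y := x)).1 (by simpa using h)
  exact this

namespace IsExp

variable {e : M → M}

theorem lt_self (he : IsExp S e) (n : M) : n < e n := by
  refine Sig.induction (S := S) (P := fun n => n < e n) (Sig.lt (.var 0) he.fn) ?_ ?_ n
  · rw [he.zero]; exact zero_lt_one
  · intro n hn
    rw [he.succ, _root_.two_mul]
    exact add_lt_add_of_lt_of_le hn (one_le_of_pos' S (zero_le.trans_lt hn))

theorem pos (he : IsExp S e) (n : M) : 0 < e n := zero_le.trans_lt (he.lt_self n)

theorem eps_pos (he : IsExp S e) (n : M) : 0 < eps e n := one_div_pos.2 (fracHom_pos (he.pos n))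

theorem eps_succ (he : IsExp S e) (n : M) : eps e (n + 1) = eps e n / 2 := by
  have := (fracHom_pos (he.pos n)).ne'
  rw [eps, eps, he.succ, map_mul, map_ofNat]
  field_simp

theorem mono (he : IsExp S e) : Monotone e := fun n m h => by
  obtain ⟨k, rfl⟩ := exists_add_of_le h
  refine Sig.induction (S := S) (P := fun k => e n ≤ e (n + k))
    (Sig.le (.const _) (Fn.comp₁ he.fn (Fn.add (.const n) (.var 0)))) (by simp) (fun k hk => ?_) k
  rw [← add_assoc, he.succ, _root_.two_mul]
  exact hk.trans le_self_add

theorem eps_anti (he : IsExp S e) : Antitone (eps e) := fun n _ h =>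
  one_div_le_one_div_of_le (fracHom_pos (he.pos n)) (fracHom_strictMono.monotone (he.mono h))

/-- The Archimedean property relative to the model: a positive `a / b` is at least `1 / b`, and `b <
2 ^ b`. -/
theorem exists_eps_lt (he : IsExp S e) {x : Frac M} (hx : 0 < x) : ∃ n, eps e n < x := by
  obtain ⟨a, b, hb, rfl⟩ := Frac.nonneg_iff.1 hx.le
  have hb := pos_iff_ne_zero.2 hb
  have ha : 0 < a := pos_iff_ne_zero.2 fun h => by simp [h] at hx
  have h1 : 1 ≤ fracHom M a := by
    simpa using fracHom_strictMono.monotone (one_le_of_pos' S ha)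
  refine ⟨b, (one_div_lt_one_div_of_lt (fracHom_pos hb)
    (fracHom_strictMono (he.lt_self b))).trans_le ?_⟩
  exact div_le_div_of_nonneg_right h1 (fracHom_pos hb).le

theorem ratFn (he : IsExp S e) {f : (ℕ → M) → M} (hf : Fn S f) : RatFn S fun v => eps e (f v) :=
  ⟨_, _, _, .const 1, .const 0, Fn.comp₁ he.fn hf, fun _ => he.pos _, fun _ => by simp [eps]⟩

end IsExp

end Rationals

/-! ### Real numbers -/

section Reals

set_option linter.unusedSectionVars false

variable {M : Type} [CommSemiring M] [LinearOrder M] [IsStrictOrderedRing M]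
  [CanonicallyOrderedAdd M]

variable (M) in
/-- An ultrafilter that contains the final segments. -/
noncomputable def ultra : Ultrafilter M :=
  haveI : (Filter.atTop : Filter M).NeBot := Filter.atTop_neBot
  Ultrafilter.of Filter.atTop

variable (M) in
/-- An ordered field in which sequences of rational numbers have limits, up to infinitesimals. -/
abbrev Lim : Type := (ultra M : Filter M).Germ (Frac M)

/-- The limit of a sequence. -/
noncomputable def lim (f : M → Frac M) : Lim M := (f : Lim M)

/-- Rational numbers as limits. -/
noncomputable def cst : Frac M →+* Lim M where
  toFun x := ((x : Frac M) : Lim M)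
  map_one' := rfl
  map_zero' := rfl
  map_add' _ _ := rfl
  map_mul' _ _ := rfl

theorem cst_strictMono : StrictMono (cst (M := M)) := fun _ _ h => Filter.Germ.const_lt h

@[simp] theorem cst_lt {x y : Frac M} : cst x < cst y ↔ x < y := cst_strictMono.lt_iff_lt

@[simp] theorem cst_le {x y : Frac M} : cst x ≤ cst y ↔ x ≤ y := cst_strictMono.le_iff_le

theorem eventually_ultra {p : M → Prop} {N : M} (h : ∀ n, N ≤ n → p n) :
    ∀ᶠ n in (ultra M : Filter M), p n :=
  haveI : (Filter.atTop : Filter M).NeBot := Filter.atTop_neBot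
  (Ultrafilter.of_le Filter.atTop) (Filter.eventually_atTop.2 ⟨N, h⟩)

theorem lim_le {f : M → Frac M} {c : Frac M} (N : M) (h : ∀ n, N ≤ n → f n ≤ c) :
    lim f ≤ cst c := Filter.Germ.coe_le.2 (eventually_ultra h)

theorem le_lim {f : M → Frac M} {c : Frac M} (N : M) (h : ∀ n, N ≤ n → c ≤ f n) :
    cst c ≤ lim f := Filter.Germ.coe_le.2 (eventually_ultra h)

/-! ### Comparison of limits up to infinitesimals, and its agreement with the order of coded reals.
-/

variable {e : M → M}

/-- `X < Y`, and the difference is not infinitesimal. -/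
def Ll (e : M → M) (X Y : Lim M) : Prop := ∃ n, X + cst (eps e n) < Y

/-- `X ≤ Y` up to an infinitesimal. -/
def Ls (e : M → M) (X Y : Lim M) : Prop := ∀ n, X ≤ Y + cst (eps e n)

theorem not_ll {X Y : Lim M} : ¬ Ll e X Y ↔ Ls e Y X := by simp [Ll, Ls]

/-- The approximations of the quantity `Q` converge to `X`. -/
def Approx (e : M → M) (Q : MQuantity M) (X : Lim M) : Prop :=
  ∃ q : M → MRat M, (∀ n, 0 < (q n).den) ∧ (∀ n P, Q.approx n P ↔ P (q n)) ∧
    ∀ n, |X - cst (q n).val| ≤ Q.err * cst (eps e n)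

variable {S : Type} [Membership M S] [IsModel M S]

theorem IsExp.cst_eps_pos (he : IsExp S e) (n : M) : 0 < cst (eps e n) := by
  rw [← map_zero cst]
  exact cst_lt.2 (he.eps_pos n)

theorem IsExp.cst_eps_anti (he : IsExp S e) {m n : M} (h : m ≤ n) :
    cst (eps e n) ≤ cst (eps e m) := cst_le.2 (he.eps_anti h)

theorem IsExp.cst_eps_succ (he : IsExp S e) (n : M) :
    cst (eps e (n + 1)) = cst (eps e n) / 2 := by
  rw [he.eps_succ, map_div₀, map_ofNat]

theorem IsExp.exists_mul_eps_lt (he : IsExp S e) (k : ℕ) {x : Frac M} (hx : 0 < x) :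
    ∃ n, k * eps e n < x := by
  have hk : (0 : Frac M) < k + 1 := by positivity
  obtain ⟨n, hn⟩ := he.exists_eps_lt (div_pos hx hk)
  refine ⟨n, ?_⟩
  rw [lt_div_iff₀ hk] at hn
  have := he.eps_pos n
  linarith

theorem IsExp.ll_cst (he : IsExp S e) {x y : Frac M} (h : x < y) : Ll e (cst x) (cst y) := by
  obtain ⟨n, hn⟩ := he.exists_eps_lt (sub_pos.2 h)
  refine ⟨n, ?_⟩
  rw [← map_add, cst_lt]
  linarith

theorem Ll.lt (he : IsExp S e) {X Y : Lim M} (h : Ll e X Y) : X < Y := by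
  obtain ⟨n, hn⟩ := h
  have := he.cst_eps_pos n
  linarith

theorem Ls.of_le (he : IsExp S e) {X Y : Lim M} (h : X ≤ Y) : Ls e X Y := fun n => by
  have := he.cst_eps_pos n
  linarith

theorem Ls.trans (he : IsExp S e) {X Y Z : Lim M} (h : Ls e X Y) (h' : Ls e Y Z) : Ls e X Z :=
  fun n => by
    have h₁ := h (n + 1)
    have h₂ := h' (n + 1)
    rw [he.cst_eps_succ] at h₁ h₂
    linarith

theorem Ls.add (he : IsExp S e) {X Y X' Y' : Lim M} (h : Ls e X Y) (h' : Ls e X' Y') :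
    Ls e (X + X') (Y + Y') := fun n => by
  have h₁ := h (n + 1)
  have h₂ := h' (n + 1)
  rw [he.cst_eps_succ] at h₁ h₂
  linarith

theorem Ls.trans_ll (he : IsExp S e) {X Y Z : Lim M} (h : Ls e X Y) (h' : Ll e Y Z) : Ll e X Z := by
  obtain ⟨n, hn⟩ := h'
  have h₁ := h (n + 1)
  refine ⟨n + 1, ?_⟩
  rw [he.cst_eps_succ] at h₁ ⊢
  linarith

theorem Ll.trans_ls (he : IsExp S e) {X Y Z : Lim M} (h : Ll e X Y) (h' : Ls e Y Z) : Ll e X Z := by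
  obtain ⟨n, hn⟩ := h
  have h₁ := h' (n + 1)
  refine ⟨n + 1, ?_⟩
  rw [he.cst_eps_succ] at h₁ ⊢
  linarith

theorem Ll.ls (he : IsExp S e) {X Y : Lim M} (h : Ll e X Y) : Ls e X Y := .of_le he (h.lt he).le

theorem Ll.trans_le {X Y Z : Lim M} (h : Ll e X Y) (h' : Y ≤ Z) : Ll e X Z :=
  h.imp fun _ h => h.trans_le h'

theorem ll_of_le_of_ll {X Y Z : Lim M} (h : X ≤ Y) (h' : Ll e Y Z) : Ll e X Z :=
  h'.imp fun n hn => by linarith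

/-- A gap between approximations that exceeds the total error separates the limits by a rational
margin; conversely, a margin `2^{-m}` shows in the approximations once the errors are small against
it. -/
theorem Approx.lt_iff (he : IsExp S e) {Q R : MQuantity M} {X Y : Lim M} (hQ : Approx e Q X)
    (hR : Approx e R Y) : Q.lt S R ↔ Ll e X Y := by
  obtain ⟨q, hq, hq', hX⟩ := hQ
  obtain ⟨r, hr, hr', hY⟩ := hR
  have key : Q.lt S R ↔ ∃ n, (q n).val + (Q.err + R.err : ℕ) * eps e n < (r n).val := by
    refine exists_congr fun n => ?_
    simp only [hq', hr', he.pow2_iff]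
    rw [exists_eq_left, MRat.lt_iff (mul_pos (hq n) (he.pos n)) (hr n),
      MRat.val_add (hq n) (he.pos n), MRat.val_frac, eps, map_natCast, mul_one_div]
  rw [key]
  constructor
  · rintro ⟨n, hn⟩
    obtain ⟨m, hm⟩ := he.ll_cst hn
    refine ⟨m, ?_⟩
    have h₁ := abs_le.1 (hX n)
    have h₂ := abs_le.1 (hY n)
    rw [map_add, map_mul, map_natCast, Nat.cast_add] at hm
    linarith [h₁.1, h₁.2, h₂.1, h₂.2]
  · rintro ⟨m, hm⟩
    -- The errors count twice: once in passing from limits to approximations, once as the gap that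
    -- the definition of `<` demands.
    obtain ⟨n, hn⟩ := he.exists_mul_eps_lt (2 * (Q.err + R.err)) (he.eps_pos m)
    refine ⟨n, ?_⟩
    have h₁ := abs_le.1 (hX n)
    have h₂ := abs_le.1 (hY n)
    rw [← cst_lt] at hn ⊢
    simp only [map_add, map_mul, map_natCast, Nat.cast_add, Nat.cast_mul, Nat.cast_ofNat,
      map_ofNat] at hn ⊢
    linarith [h₁.1, h₁.2, h₂.1, h₂.2]

theorem Approx.le_iff (he : IsExp S e) {Q R : MQuantity M} {X Y : Lim M} (hQ : Approx e Q X)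
    (hR : Approx e R Y) : Q.le S R ↔ Ls e X Y := by
  rw [MQuantity.le, Approx.lt_iff he hR hQ, not_ll]

theorem Approx.ofRat {x : MRat M} (hx : 0 < x.den) : Approx e (.ofRat x) (cst x.val) :=
  ⟨fun _ => x, fun _ => hx, fun _ _ => Iff.rfl, fun _ => by simp [MQuantity.ofRat]⟩

theorem Approx.zero : Approx e .zero (0 : Lim M) := by
  have : Approx e .zero (cst (MRat.frac (0 : M) 1).val) := Approx.ofRat (zero_lt_one (α := M))
  simpa [MRat.val_frac] using this

theorem Approx.add {Q R : MQuantity M} {X Y : Lim M} (hQ : Approx e Q X)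
    (hR : Approx e R Y) : Approx e (Q.add R) (X + Y) := by
  obtain ⟨q, hq, hq', hX⟩ := hQ
  obtain ⟨r, hr, hr', hY⟩ := hR
  refine ⟨fun n => (q n).add (r n), fun n => mul_pos (hq n) (hr n), fun n P => ?_, fun n => ?_⟩
  · simp only [MQuantity.add, hq', hr']
  · rw [MRat.val_add (hq n) (hr n), map_add, MQuantity.add, Nat.cast_add, add_mul, add_sub_add_comm]
    exact (abs_add_le _ _).trans (add_le_add (hX n) (hY n))

/-- The geometric sum of the steps from `n` to `m`. Its exact value, not just the bound `2 *
2^{-n}`, is what the induction reproduces; `hq` makes the induction predicate `Σ⁰₁`. -/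
theorem abs_sub_le_of_succ (he : IsExp S e) {q : M → Frac M} (hq : RatFn S fun v => q (v 0))
    (h : ∀ n, |q n - q (n + 1)| < eps e n) {n m : M} (hnm : n ≤ m) :
    |q n - q m| ≤ 2 * eps e n - 2 * eps e m := by
  obtain ⟨k, rfl⟩ := exists_add_of_le hnm
  have hq' : RatFn S fun v => q (n + v 0) := by
    obtain ⟨a, b, c, ha, hb, hc, hpos, hq⟩ := hq
    have hs : ∀ {f : (ℕ → M) → M}, Fn S f → Fn S fun v => f fun i => n + v i := fun hf =>
      hf.subst fun i => .add (.const n) (.var i)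
    exact ⟨_, _, _, hs ha, hs hb, hs hc, fun v => hpos _,
      fun v => hq fun i => n + v i⟩
  have hr : RatFn S fun v => 2 * eps e n - 2 * eps e (n + v 0) :=
    (RatFn.const _).sub (he.ratFn (Fn.add (.const n) (.var 0))).two_mul
  have key : -(2 * eps e n - 2 * eps e (n + k)) ≤ q n - q (n + k) ∧
      q n - q (n + k) ≤ 2 * eps e n - 2 * eps e (n + k) := by
    refine Sig.induction (S := S) (P := fun k => -(2 * eps e n - 2 * eps e (n + k)) ≤
      q n - q (n + k) ∧ q n - q (n + k) ≤ 2 * eps e n - 2 * eps e (n + k))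
      (.and (hr.neg.le ((RatFn.const _).sub hq')) (((RatFn.const _).sub hq').le hr))
      (by simp) (fun k hk => ?_) k
    have := abs_lt.1 (h (n + k))
    rw [← add_assoc, he.eps_succ]
    constructor <;> linarith [hk.1, hk.2, this.1, this.2]
  exact abs_le.2 key

/-- Bounds valid on a final segment pass to the germ, since the ultrafilter contains all final
segments. -/
theorem abs_lim_sub_le (he : IsExp S e) {q : M → Frac M}
    (h : ∀ n m, n ≤ m → |q n - q m| ≤ 2 * eps e n - 2 * eps e m) (n : M) :
    |lim q - cst (q n)| ≤ 2 * cst (eps e n) := by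
  have h₁ : lim q ≤ cst (q n + 2 * eps e n) := lim_le n fun m hm => by
    have := abs_le.1 (h n m hm)
    linarith [this.1, he.eps_pos m]
  have h₂ : cst (q n - 2 * eps e n) ≤ lim q := le_lim n fun m hm => by
    have := abs_le.1 (h n m hm)
    linarith [this.2, he.eps_pos m]
  simp only [map_add, map_sub, map_mul, map_ofNat] at h₁ h₂
  exact abs_le.2 ⟨by linarith, by linarith⟩

/-- A real number is approximated by its sequence. -/
theorem IsRealGraph.approx (he : IsExp S e) {G : M → M → Prop} (hG : IsRealGraph S G) {z : M → M}
    (hz : ∀ n w, G n w ↔ w = z n) (hfn : Fn S fun v => z (v 0)) :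
    (∀ n, |lim (fun n => ratVal (z n)) - cst (ratVal (z n))| ≤ 2 * cst (eps e n)) ∧
      (∀ n P, (MQuantity.ofGraph G).approx n P ↔ P (ratOf (z n))) ∧
      Approx e (.ofGraph G) (lim fun n => ratVal (z n)) := by
  have h : ∀ n, HoldsRat (z n) (fun _ => True) ∧
      |ratVal (z n) - ratVal (z (n + 1))| < eps e n := fun n => by
    obtain ⟨w, w', p, hw, hw', hp, hr⟩ := hG.2 n
    rw [hz] at hw hw'
    rw [he.pow2_iff] at hp
    subst hw hw' hp
    rw [HoldsRat.elim (S := S)] at hr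
    obtain ⟨hr₁, hr⟩ := hr
    rw [HoldsRat.elim (S := S)] at hr
    obtain ⟨-, hr, hr'⟩ := hr
    have d₁ := ratOf_den_pos (z n)
    have d₂ := ratOf_den_pos (z (n + 1))
    rw [MRat.lt_iff d₁ (mul_pos d₂ (he.pos n)), MRat.val_add d₂ (he.pos n), MRat.val_frac,
      map_one] at hr
    rw [MRat.lt_iff d₂ (mul_pos d₁ (he.pos n)), MRat.val_add d₁ (he.pos n), MRat.val_frac,
      map_one] at hr'
    refine ⟨hr₁, abs_lt.2 ⟨?_, ?_⟩⟩
    · change (ratOf (z (n + 1))).val < _ at hr'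
      unfold ratVal eps
      linarith
    · unfold ratVal eps
      linarith
  have hl := abs_lim_sub_le he (q := fun n => ratVal (z n)) fun n m =>
    abs_sub_le_of_succ he (q := fun n => ratVal (z n)) (RatFn.ratVal hfn) fun n => (h n).2
  have ha : ∀ n P, (MQuantity.ofGraph G).approx n P ↔ P (ratOf (z n)) := fun n P => by
    simp only [MQuantity.ofGraph, hz, exists_eq_left]
    rw [HoldsRat.elim (S := S)]
    simp [(h n).1]
  exact ⟨hl, ha, fun n => ratOf (z n), fun n => ratOf_den_pos _, ha, hl⟩

end Reals

/-! ### Distances in a complete separable metric space -/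

section Distances

set_option linter.unusedSectionVars false

variable {M : Type} [CommSemiring M] [LinearOrder M] [IsStrictOrderedRing M]
  [CanonicallyOrderedAdd M] {S : Type} [Membership M S] [IsModel M S] {e : M → M}

theorem RatFn.tail {q : (ℕ → M) → Frac M} (hq : RatFn S q) :
    RatFn S fun v => q fun i => v (i + 1) := by
  obtain ⟨a, b, c, ha, hb, hc, h, hq⟩ := hq
  exact ⟨_, _, _, ha.tail, hb.tail, hc.tail, fun v => h _, fun v => hq _⟩

theorem Ls.refl (he : IsExp S e) (X : Lim M) : Ls e X X := .of_le he le_rfl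

theorem Ll.add (he : IsExp S e) {X Y X' Y' : Lim M} (h : Ll e X Y) (h' : Ls e X' Y') :
    Ll e (X + X') (Y + Y') := by
  obtain ⟨n, hn⟩ := h
  have h₁ := h' (n + 1)
  refine ⟨n + 1, ?_⟩
  rw [he.cst_eps_succ] at h₁ ⊢
  linarith

open Classical in
/-- The code of the `n`-th approximation of `d(a, b)`. -/
noncomputable def distCode (D : S) (a b n : M) : M :=
  if h : ∃ z, DGraph D a b n z then h.choose else 0

/-- The `n`-th approximation of `d(a, b)`. -/
noncomputable def distApprox (D : S) (a b n : M) : Frac M := ratVal (distCode D a b n)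

/-- The distance of the points `x` and `y`. -/
noncomputable def pointDist (D : S) (x y : M → M) : Lim M :=
  lim fun n => distApprox D (x n) (y n) n

/-- The distance of `a` and `b`. -/
noncomputable def baseDist (D : S) (a b : M) : Lim M := pointDist D (fun _ => a) (fun _ => b)

/-- `d(a, b) < r`. -/
def Near (D : S) (e : M → M) (a b : M) (r : Frac M) : Prop :=
  ∃ j, distApprox D a b j + 2 * eps e j < r

/-- `r < d(a, b)`. -/
def Far (D : S) (e : M → M) (a b : M) (r : Frac M) : Prop :=
  ∃ j, r + 2 * eps e j < distApprox D a b j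

variable {A D : S} {a b c : M}

namespace IsSpace

theorem dGraph_iff (hS : IsSpace M A D) (ha : a ∈ A) (hb : b ∈ A) (n w : M) :
    DGraph D a b n w ↔ w = distCode D a b n := by
  obtain ⟨z, hz, hz'⟩ := (hS.2.1 a b ha hb).1 n
  have h : ∃ z, DGraph D a b n z := ⟨z, hz⟩
  rw [distCode, dif_pos h, hz' _ h.choose_spec]
  exact ⟨hz' _, fun h => h ▸ hz⟩

/-- By the first clause of `IsSpace` the set `D` holds no entries outside `A`, so the default value
`0` is taken exactly there. Membership in `A` and its negation are both `Σ⁰₁`, so the case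
distinction is too. -/
theorem fn_distCode (hS : IsSpace M A D) {f g h : (ℕ → M) → M} (hf : Fn S f) (hg : Fn S g)
    (hh : Fn S h) : Fn S fun v => distCode D (f v) (g v) (h v) := by
  refine Fn.of_graph (R := fun y v => (f v ∈ A ∧ g v ∈ A ∧ DGraph D (f v) (g v) (h v) y) ∨
    (f v ∉ A ∨ g v ∉ A) ∧ y = 0) ?_ fun y v => ?_
  · exact .or (.and (.mem hf.tail A) (.and (.mem hg.tail A)
      (.mem (.pair' (.pair' (.pair' hf.tail hg.tail) hh.tail) (.var 0)) D)))
      (.and (.or (.not_mem hf.tail A) (.not_mem hg.tail A)) (.eq (.var 0) (.const 0)))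
  · by_cases h₁ : f v ∈ A
    · by_cases h₂ : g v ∈ A
      · simp [h₁, h₂, hS.dGraph_iff]
      · have : ¬ ∃ z, DGraph D (f v) (g v) (h v) z := fun ⟨z, hz⟩ => by
          obtain ⟨a, b, n, z', -, hb, hu⟩ := hS.1 _ hz
          exact h₂ ((pair_inj S (pair_inj S (pair_inj S hu).1).1).2 ▸ hb)
        simp [h₂, distCode, this]
    · have : ¬ ∃ z, DGraph D (f v) (g v) (h v) z := fun ⟨z, hz⟩ => by
        obtain ⟨a, b, n, z', ha, -, hu⟩ := hS.1 _ hz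
        exact h₁ ((pair_inj S (pair_inj S (pair_inj S hu).1).1).1 ▸ ha)
      simp [h₁, distCode, this]

theorem ratFn_distApprox (hS : IsSpace M A D) {f g h : (ℕ → M) → M} (hf : Fn S f) (hg : Fn S g)
    (hh : Fn S h) : RatFn S fun v => distApprox D (f v) (g v) (h v) :=
  .ratVal (hS.fn_distCode hf hg hh)

theorem sig_near (hS : IsSpace M A D) (he : IsExp S e) {f g : (ℕ → M) → M}
    {q : (ℕ → M) → Frac M} (hf : Fn S f) (hg : Fn S g) (hq : RatFn S q) :
    Sig S fun v => Near D e (f v) (g v) (q v) :=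
  Sig.ex (P := fun j v => distApprox D (f v) (g v) j + 2 * eps e j < q v)
    (RatFn.lt (.add (hS.ratFn_distApprox hf.tail hg.tail (.var 0)) (he.ratFn (.var 0)).two_mul)
        hq.tail)

theorem sig_far (hS : IsSpace M A D) (he : IsExp S e) {f g : (ℕ → M) → M}
    {q : (ℕ → M) → Frac M} (hf : Fn S f) (hg : Fn S g) (hq : RatFn S q) :
    Sig S fun v => Far D e (f v) (g v) (q v) :=
  Sig.ex (P := fun j v => q v + 2 * eps e j < distApprox D (f v) (g v) j)
    (RatFn.lt (hq.tail.add (he.ratFn (.var 0)).two_mul)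
        (hS.ratFn_distApprox hf.tail hg.tail (.var 0)))

theorem approx (hS : IsSpace M A D) (he : IsExp S e) (ha : a ∈ A) (hb : b ∈ A) :
    (∀ n, |baseDist D a b - cst (distApprox D a b n)| ≤ 2 * cst (eps e n)) ∧
      (∀ n P, (mdA D a b).approx n P ↔ P (ratOf (distCode D a b n))) ∧
      Approx e (mdA D a b) (baseDist D a b) :=
  IsRealGraph.approx he (hS.2.1 a b ha hb) (hS.dGraph_iff ha hb)
    (hS.fn_distCode (.const a) (.const b) (.var 0))

/-- The bridge between estimates with limits, which are not definable in the model, and a `Σ⁰₁`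
relation. -/
theorem near_iff (hS : IsSpace M A D) (he : IsExp S e) (ha : a ∈ A) (hb : b ∈ A) {r : Frac M} :
    Near D e a b r ↔ Ll e (baseDist D a b) (cst r) := by
  have h := fun n => abs_le.1 ((hS.approx he ha hb).1 n)
  constructor
  · rintro ⟨j, hj⟩
    refine ll_of_le_of_ll ?_ (he.ll_cst hj)
    rw [map_add, map_mul, map_ofNat]
    linarith [(h j).2]
  · rintro ⟨n, hn⟩
    -- The error of the approximation and the gap in `Near` are each `2 * 2^{-(n+2)}`; together they
    -- make `2^{-n}`.
    refine ⟨n + 1 + 1, ?_⟩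
    have := (h (n + 1 + 1)).1
    rw [← cst_lt, map_add, map_mul, map_ofNat]
    rw [he.cst_eps_succ, he.cst_eps_succ] at this ⊢
    linarith

theorem far_iff (hS : IsSpace M A D) (he : IsExp S e) (ha : a ∈ A) (hb : b ∈ A) {r : Frac M} :
    Far D e a b r ↔ Ll e (cst r) (baseDist D a b) := by
  have h := fun n => abs_le.1 ((hS.approx he ha hb).1 n)
  constructor
  · rintro ⟨j, hj⟩
    have := he.ll_cst (lt_sub_iff_add_lt.2 hj)
    refine this.trans_le ?_
    rw [map_sub, map_mul, map_ofNat]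
    linarith [(h j).1]
  · rintro ⟨n, hn⟩
    refine ⟨n + 1 + 1, ?_⟩
    have := (h (n + 1 + 1)).2
    rw [← cst_lt, map_add, map_mul, map_ofNat]
    rw [he.cst_eps_succ, he.cst_eps_succ] at this ⊢
    linarith

theorem dist_self (hS : IsSpace M A D) (he : IsExp S e) (ha : a ∈ A) : Ls e (baseDist D a a) 0 :=
  ((hS.approx he ha ha).2.2.le_iff he .zero).1 (hS.2.2.1 a ha).1

theorem dist_comm (hS : IsSpace M A D) (he : IsExp S e) (ha : a ∈ A) (hb : b ∈ A) :
    Ls e (baseDist D a b) (baseDist D b a) :=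
  ((hS.approx he ha hb).2.2.le_iff he (hS.approx he hb ha).2.2).1 (hS.2.2.2.1 a b ha hb).1.1

theorem dist_triangle (hS : IsSpace M A D) (he : IsExp S e) (ha : a ∈ A) (hb : b ∈ A)
    (hc : c ∈ A) : Ls e (baseDist D a b) (baseDist D a c + baseDist D c b) :=
  ((hS.approx he ha hb).2.2.le_iff he
    ((hS.approx he ha hc).2.2.add (hS.approx he hc hb).2.2)).1 (hS.2.2.2.2 a b c ha hb hc)

end IsSpace

/-! ### Points as functions, and the error of the approximations to their distances. -/

/-- `x` is the sequence of a point of the space. -/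
structure IsPointFn (A D : S) (e x : M → M) : Prop where
  fn : Fn S fun v => x (v 0)
  mem (n : M) : x n ∈ A
  ll (n : M) : Ll e (baseDist D (x n) (x (n + 1))) (cst (eps e n))

theorem IsSpace.isPointFn_const (hS : IsSpace M A D) (he : IsExp S e) (ha : a ∈ A) :
    IsPointFn A D e fun _ => a :=
  ⟨.const a, fun _ => ha, fun n => (hS.dist_self he ha).trans_ll he <| by
    simpa using he.ll_cst (he.eps_pos n)⟩

theorem IsExp.approx_frac (he : IsExp S e) (n : M) :
    Approx e (.ofRat (.frac 1 (e n))) (cst (eps e n)) := by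
  have := Approx.ofRat (e := e) (x := .frac 1 (e n)) (he.pos n)
  rwa [MRat.val_frac, map_one] at this

theorem IsSpace.exists_isPointFn (hS : IsSpace M A D) (he : IsExp S e) {X : S}
    (hX : IsPoint M A D X) : ∃ x : M → M, IsPointFn A D e x ∧ ∀ n w, App X n w ↔ w = x n := by
  obtain ⟨x, hx, hXx⟩ := hX.1.exists_eq
  have h : ∀ n, x n ∈ A ∧ Ll e (baseDist D (x n) (x (n + 1))) (cst (eps e n)) := fun n => by
    obtain ⟨a, b, p, ha, hb, haA, hbA, hp, hlt⟩ := hX.2 n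
    rw [hXx] at ha hb
    rw [he.pow2_iff] at hp
    subst ha hb hp
    exact ⟨haA, ((hS.approx he haA hbA).2.2.lt_iff he (he.approx_frac n)).1 hlt⟩
  exact ⟨x, ⟨hx, fun n => (h n).1, fun n => (h n).2⟩, hXx⟩

theorem IsSpace.exists_isPoint (hS : IsSpace M A D) (he : IsExp S e) {x : M → M}
    (hx : IsPointFn A D e x) : ∃ X : S, IsPoint M A D X ∧ ∀ n w, App X n w ↔ w = x n := by
  obtain ⟨X, hX, h⟩ := Fn.exists_isFun hx.fn
  exact ⟨X, ⟨hX, fun n => ⟨x n, x (n + 1), e n, (h _ _).2 rfl, (h _ _).2 rfl, hx.mem _, hx.mem _,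
    (he.pow2_iff _ _).2 rfl,
    ((hS.approx he (hx.mem _) (hx.mem _)).2.2.lt_iff he (he.approx_frac n)).2 (hx.ll n)⟩⟩, h⟩

variable {x y : M → M}

theorem IsPointFn.ls_of_le (hx : IsPointFn A D e x) (hS : IsSpace M A D) (he : IsExp S e)
    {n m : M} (hnm : n ≤ m) :
    Ls e (baseDist D (x n) (x m)) (cst (2 * eps e n - 2 * eps e m)) := by
  obtain ⟨k, rfl⟩ := exists_add_of_le hnm
  have hk : Fn S fun v : ℕ → M => n + v 0 := .add (.const n) (.var 0)
  -- For `k = 0` the radius would be `0` and the strict relation `Near` false, so this case is kept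
  -- apart.
  have key : k = 0 ∨ Near D e (x n) (x (n + k)) (2 * eps e n - 2 * eps e (n + k)) := by
    refine Sig.induction (S := S) (P := fun k => k = 0 ∨
      Near D e (x n) (x (n + k)) (2 * eps e n - 2 * eps e (n + k)))
      (.or (.eq (.var 0) (.const 0)) (hS.sig_near he (.const _) (Fn.comp₁ hx.fn hk)
        ((RatFn.const _).sub (he.ratFn hk).two_mul))) (.inl rfl) (fun k hk => .inr ?_) k
    rw [hS.near_iff he (hx.mem _) (hx.mem _), ← add_assoc, he.eps_succ]
    rcases hk with rfl | hk
    · have := hx.ll n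
      rw [add_zero]
      convert this using 2
      ring
    · rw [hS.near_iff he (hx.mem _) (hx.mem _)] at hk
      have := (hS.dist_triangle he (hx.mem n) (hx.mem (n + k + 1)) (hx.mem (n + k))).trans_ll he
        (hk.add he ((hx.ll (n + k)).ls he))
      rw [← map_add] at this
      convert this using 2
      ring
  rcases key with rfl | key
  · simpa using hS.dist_self he (hx.mem n)
  · exact ((hS.near_iff he (hx.mem _) (hx.mem _)).1 key).ls he

theorem IsPointFn.ls_of_le' (hx : IsPointFn A D e x) (hS : IsSpace M A D) (he : IsExp S e)
    {n m : M} (hnm : n ≤ m) :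
    Ls e (baseDist D (x m) (x n)) (cst (2 * eps e n - 2 * eps e m)) :=
  (hS.dist_comm he (hx.mem _) (hx.mem _)).trans he (hx.ls_of_le hS he hnm)

theorem IsSpace.dist_triangle₂ (hS : IsSpace M A D) (he : IsExp S e) {a b a' b' : M} (ha : a ∈ A)
    (hb : b ∈ A) (ha' : a' ∈ A) (hb' : b' ∈ A) {X Y Z : Lim M} (h₁ : Ls e (baseDist D a a') X)
    (h₂ : Ls e (baseDist D a' b') Y) (h₃ : Ls e (baseDist D b' b) Z) :
    Ls e (baseDist D a b) (X + Y + Z) :=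
  (hS.dist_triangle he ha hb hb').trans he
    (((hS.dist_triangle he ha hb' ha').trans he (h₁.add he h₂)).add he h₃)

/-- The constant is `6 = 2 + 2 + 2`: one tail for each of the two points and the error of the
approximation at stage `n`. -/
theorem IsSpace.abs_pointDist_sub_le (hS : IsSpace M A D) (he : IsExp S e)
    (hx : IsPointFn A D e x) (hy : IsPointFn A D e y) (n : M) :
    |pointDist D x y - cst (distApprox D (x n) (y n) n)| ≤ 6 * cst (eps e n) := by
  have h := fun n => abs_le.1 ((hS.approx he (hx.mem n) (hy.mem n)).1 n)
  have h₁ : pointDist D x y ≤ cst (distApprox D (x n) (y n) n + 6 * eps e n) :=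
    lim_le n fun m hm => by
      -- The terms `-2 * 2^{-m}` in the two tail bounds absorb the approximation error `2 * 2^{-m}`
      -- at stage `m` and the slack `2^{-m}` in `Ls`.
      have := hS.dist_triangle₂ he (hx.mem m) (hy.mem m) (hx.mem n) (hy.mem n)
        (hx.ls_of_le' hS he hm) (.refl he _) (hy.ls_of_le hS he hm) m
      have hn := (h n).2
      have hm' := (h m).1
      rw [← cst_le]
      have := he.cst_eps_pos m
      simp only [map_add, map_sub, map_mul, map_ofNat] at *
      linarith
  have h₂ : cst (distApprox D (x n) (y n) n - 6 * eps e n) ≤ pointDist D x y :=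
    le_lim n fun m hm => by
      have := hS.dist_triangle₂ he (hx.mem n) (hy.mem n) (hx.mem m) (hy.mem m)
        (hx.ls_of_le hS he hm) (.refl he _) (hy.ls_of_le' hS he hm) m
      have hn := (h n).1
      have hm' := (h m).2
      rw [← cst_le]
      have := he.cst_eps_pos m
      simp only [map_add, map_sub, map_mul, map_ofNat] at *
      linarith
  simp only [map_add, map_sub, map_mul, map_ofNat] at h₁ h₂
  exact abs_le.2 ⟨by linarith, by linarith⟩

theorem IsSpace.abs_pointDist_sub_dist_le (hS : IsSpace M A D) (he : IsExp S e)
    (hx : IsPointFn A D e x) (hy : IsPointFn A D e y) (n : M) :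
    |pointDist D x y - baseDist D (x n) (y n)| ≤ 8 * cst (eps e n) := by
  have h₁ := abs_le.1 ((hS.approx he (hx.mem n) (hy.mem n)).1 n)
  have h₂ := abs_le.1 (hS.abs_pointDist_sub_le he hx hy n)
  exact abs_le.2 ⟨by linarith, by linarith⟩

theorem IsSpace.approx_mdist (hS : IsSpace M A D) (he : IsExp S e) (hx : IsPointFn A D e x)
    (hy : IsPointFn A D e y) {G H : M → M → Prop} (hG : ∀ n w, G n w ↔ w = x n)
    (hH : ∀ n w, H n w ↔ w = y n) : Approx e (mdist D G H) (pointDist D x y) := by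
  refine ⟨fun n => ratOf (distCode D (x n) (y n) n), fun n => ratOf_den_pos _, fun n P => ?_,
    fun n => hS.abs_pointDist_sub_le he hx hy n⟩
  simp only [mdist, hG, hH]
  simp [(hS.approx he (hx.mem n) (hy.mem n)).2.1]

end Distances

/-! ### Lebesgue spaces without isolated points -/

section HeineBorel

set_option linter.unusedSectionVars false

variable {M : Type} [CommSemiring M] [LinearOrder M] [IsStrictOrderedRing M]
  [CanonicallyOrderedAdd M] {S : Type} [Membership M S] [IsModel M S] {e : M → M}

theorem IsExp.exists_ratCode (he : IsExp S e) (n : M) :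
    ∃ z : M, HoldsRat z (fun _ => True) ∧ ratVal z = eps e n := by
  obtain ⟨p, hp⟩ := exists_add_of_le (one_le_of_pos' S (he.pos n))
  refine ⟨pair (pair 1 0) p, ⟨1, 0, p, rfl, trivial⟩, ?_⟩
  rw [ratVal, ratOf, fst_pair S, fst_pair S, snd_pair S, snd_pair S, add_comm p 1, ← hp]
  simp [MRat.val, eps]

/-- Positive real numbers are positive as limits. -/
theorem IsPosReal.exists_approx (he : IsExp S e) {q : S} (hq : IsPosReal M q) :
    ∃ X, Approx e (.ofGraph (App (M := M) q)) X ∧ Ll e 0 X := by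
  obtain ⟨F, hF, h⟩ := hq.1.exists_eq
  have hX := (IsRealGraph.approx he hq.2.1 h hF).2.2
  exact ⟨_, hX, (Approx.zero.lt_iff he hX).1 hq.2.2⟩

theorem IsExp.exists_isPosReal (he : IsExp S e) (k : M) :
    ∃ q : S, IsPosReal M q ∧ Approx e (.ofGraph (App (M := M) q)) (cst (eps e k)) := by
  obtain ⟨z, hz, hzk⟩ := he.exists_ratCode k
  obtain ⟨q, hq, h⟩ := Fn.exists_isFun (S := S) (F := fun _ => z) (.const z)
  have hr : IsRealGraph S (App (M := M) q) := by
    refine ⟨hq.2, fun n => ⟨z, z, e n, (h _ _).2 rfl, (h _ _).2 rfl, (he.pow2_iff _ _).2 rfl, ?_⟩⟩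
    have hd := ratOf_den_pos z
    have hlt : (ratOf z).lt ((ratOf z).add (.frac 1 (e n))) := by
      rw [MRat.lt_iff hd (mul_pos hd (he.pos n)), MRat.val_add hd (he.pos n), MRat.val_frac,
        map_one]
      exact lt_add_of_pos_right _ (he.eps_pos n)
    rw [HoldsRat.elim (S := S)]
    refine ⟨hz, ?_⟩
    rw [HoldsRat.elim (S := S)]
    exact ⟨hz, hlt, hlt⟩
  have hX := (IsRealGraph.approx he hr h (.const z)).2.2
  change Approx e _ (cst (ratVal z)) at hX
  rw [hzk] at hX
  refine ⟨q, ⟨hq, hr, (Approx.zero.lt_iff he hX).2 ?_⟩, hX⟩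
  simpa using he.ll_cst (he.eps_pos k)

variable {A D U : S}

/-- The codes of the balls of a sequence of open sets. -/
structure IsBallCode (A U : S) (c : M → M → M) : Prop where
  fn : Fn S fun v => c (v 0) (v 1)
  app_iff (n m w : M) : App U (pair n m) w ↔ w = c n m
  eq_pair (n m : M) : c n m = pair (fst (c n m)) (snd (c n m))
  mem (n m : M) : fst (c n m) ∈ A
  rat (n m : M) : HoldsRat (snd (c n m)) fun _ => True
  pos (n m : M) : 0 < ratVal (snd (c n m))

theorem IsOpenSeq.exists_isBallCode (hU : IsOpenSeq M A U) : ∃ c : M → M → M, IsBallCode A U c := by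
  choose c hc hc' using hU.2.1
  have h : ∀ n m w, App U (pair n m) w ↔ w = c n m := fun n m w =>
    ⟨hc' n m w, fun h => h ▸ hc n m⟩
  have key : ∀ n m, c n m = pair (fst (c n m)) (snd (c n m)) ∧ fst (c n m) ∈ A ∧
      HoldsRat (snd (c n m)) (fun _ => True) ∧ 0 < ratVal (snd (c n m)) := fun n m => by
    obtain ⟨a, z, haz, ha, hz⟩ := hU.2.2 n m
    rw [h] at haz
    rw [← haz, fst_pair S, snd_pair S]
    rw [HoldsRat.elim (S := S)] at hz
    refine ⟨rfl, ha, hz.1, ?_⟩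
    have := (MRat.lt_iff (x := .frac 0 1) zero_lt_one (ratOf_den_pos z)).1 hz.2
    rwa [MRat.val_frac, map_zero, zero_div] at this
  exact ⟨c, Fn.of_graph (R := fun y v => App U (pair (v 0) (v 1)) y)
    (Sig.mem (.pair' (.pair' (.var 1) (.var 2)) (.var 0)) U) (fun y v => h _ _ _), h,
    fun n m => (key n m).1, fun n m => (key n m).2.1, fun n m => (key n m).2.2.1,
    fun n m => (key n m).2.2.2⟩

theorem IsSpace.inOpen_iff (hS : IsSpace M A D) (he : IsExp S e) {c : M → M → M}
    (hc : IsBallCode A U c) {x : M → M} (hx : IsPointFn A D e x) {X : S}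
    (hX : ∀ n w, App X n w ↔ w = x n) (n : M) :
    InOpen D U n X ↔
      ∃ m, Ll e (pointDist D x fun _ => fst (c n m)) (cst (ratVal (snd (c n m)))) := by
  refine exists_congr fun m => ?_
  have key := (hS.approx_mdist he hx (hS.isPointFn_const he (hc.mem n m)) hX
    (H := fun _ b => b = fst (c n m)) fun _ _ => Iff.rfl).lt_iff he
      (Approx.ofRat (ratOf_den_pos (snd (c n m))))
  rw [ratVal, ← key]
  constructor
  · rintro ⟨a, z, h, hz⟩
    rw [hc.app_iff] at h
    rw [← h, fst_pair S, snd_pair S]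
    exact (HoldsRat.elim (S := S).1 hz).2
  · intro h
    exact ⟨_, _, (hc.app_iff _ _ _).2 (hc.eq_pair n m).symm,
      HoldsRat.elim (S := S).2 ⟨hc.rat n m, h⟩⟩

theorem IsSpace.inBall_iff (hS : IsSpace M A D) (he : IsExp S e) {x y : M → M}
    (hx : IsPointFn A D e x) (hy : IsPointFn A D e y) {X Y q : S} {Q : Lim M}
    (hX : ∀ n w, App X n w ↔ w = x n) (hY : ∀ n w, App Y n w ↔ w = y n)
    (hq : Approx e (.ofGraph (App (M := M) q)) Q) :
    InBall M D X q Y ↔ Ll e (pointDist D x y) Q :=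
  (hS.approx_mdist he hx hy hX hY).lt_iff he hq

/-- The points of the space are not isolated. -/
theorem IsPerfect.exists_near (hP : IsPerfect M A D) (hS : IsSpace M A D) (he : IsExp S e) {a : M}
    (ha : a ∈ A) (k : M) : ∃ b ∈ A, Far D e a b 0 ∧ Near D e a b (eps e k) := by
  have hx := hS.isPointFn_const he ha
  obtain ⟨X, hX, hXx⟩ := hS.exists_isPoint he hx
  obtain ⟨q, hq, hqk⟩ := he.exists_isPosReal (S := S) k
  have := hP X hX
  push Not at this
  obtain ⟨Y, hY, h₁, h₂⟩ := this q hq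
  obtain ⟨y, hy, hYy⟩ := hS.exists_isPointFn he hY
  rw [Approx.zero.lt_iff he (hS.approx_mdist he hx hy hXx hYy)] at h₁
  rw [hS.inBall_iff he hx hy hXx hYy hqk] at h₂
  obtain ⟨n, hn⟩ := h₁
  obtain ⟨m, hm⟩ := h₂
  -- The near point given by perfectness is replaced by a term of its sequence. Four extra halvings
  -- turn the error `8 * 2^{-(n+m+4)}` into half of `2^{-(n+m)}`, which is at most half of either
  -- margin.
  have hnm := abs_le.1 (hS.abs_pointDist_sub_dist_le he hx hy (n + m + 1 + 1 + 1 + 1))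
  have h₁ := he.cst_eps_anti (le_self_add : n ≤ n + m)
  have h₂ := he.cst_eps_anti (le_add_self : m ≤ n + m)
  have h₃ := he.cst_eps_pos (n + m)
  have hyA := hy.mem (n + m + 1 + 1 + 1 + 1)
  simp only [he.cst_eps_succ] at hnm
  refine ⟨_, hyA, (hS.far_iff he ha hyA).2 ⟨n + m + 1, ?_⟩,
    (hS.near_iff he ha hyA).2 ⟨n + m + 1, ?_⟩⟩ <;> rw [he.cst_eps_succ]
  · rw [map_zero]
    linarith [hnm.1, hnm.2]
  · linarith [hnm.1, hnm.2]

/-- If finitely many open sets do not cover the space then they do not cover its dense set. -/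
theorem IsSpace.exists_forall_far (hS : IsSpace M A D) (he : IsExp S e) {c : M → M → M}
    (hc : IsBallCode A U c) {X : S} (hX : IsPoint M A D X) {k : M}
    (h : ∀ n < k, ¬ InOpen D U n X) :
    ∃ a ∈ A, ∀ n < k, ∀ m, Far D e a (fst (c n m)) (ratVal (snd (c n m)) - eps e k) := by
  obtain ⟨x, hx, hXx⟩ := hS.exists_isPointFn he hX
  -- At this index the replacement costs `8/16` of `2^{-k}` and the slack in `Ls` another `1/16`, so
  -- the deficit stays below `2^{-k}`.
  refine ⟨x (k + 1 + 1 + 1 + 1), hx.mem _, fun n hn m => ?_⟩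
  have := h n hn
  rw [hS.inOpen_iff he hc hx hXx] at this
  push Not at this
  have := not_ll.1 (this m) (k + 1 + 1 + 1 + 1)
  rw [hS.far_iff he (hx.mem _) (hc.mem _ _)]
  refine ⟨k + 1 + 1 + 1 + 1, ?_⟩
  have h' := (abs_le.1 (hS.abs_pointDist_sub_dist_le he hx (hS.isPointFn_const he (hc.mem n m))
    (k + 1 + 1 + 1 + 1))).2
  have h₃ := he.cst_eps_pos k
  rw [map_sub]
  simp only [he.cst_eps_succ] at this h' ⊢
  linarith

/-! ### Escaping pairs, good balls and the contradiction with a Lebesgue number. -/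

/-- Pairs of distinct points at small distances that avoid larger and larger parts of `U`. -/
structure IsEscape (A D : S) (e : M → M) (c : M → M → M) (b b' : M → M) : Prop where
  fn : Fn S fun v => b (v 0)
  fn' : Fn S fun v => b' (v 0)
  mem (k : M) : b k ∈ A
  mem' (k : M) : b' k ∈ A
  far (k n m : M) : n < k → m < k →
    Far D e (b k) (fst (c n m)) (ratVal (snd (c n m)) - eps e k)
  pos (k : M) : Far D e (b k) (b' k) 0
  near (k : M) : Near D e (b k) (b' k) (eps e k)

theorem IsSpace.exists_isEscape (hS : IsSpace M A D) (he : IsExp S e) (hP : IsPerfect M A D)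
    {c : M → M → M} (hc : IsBallCode A U c)
    (h : ∀ k, ∃ X, IsPoint M A D X ∧ ∀ n < k, ¬ InOpen D U n X) :
    ∃ b b' : M → M, IsEscape A D e c b b' := by
  -- `exists_forall_far` gives the estimate for all `m`; restricting it to `m < k` makes `R` a `Σ⁰₁`
  -- relation, to which choice applies.
  let R : M → M → Prop := fun y k => fst y ∈ A ∧ snd y ∈ A ∧
    (∀ n, n < k → ∀ m, m < k →
      Far D e (fst y) (fst (c n m)) (ratVal (snd (c n m)) - eps e k)) ∧
    Far D e (fst y) (snd y) 0 ∧ Near D e (fst y) (snd y) (eps e k)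
  have hR : Sig S fun v => R (v 0) (v 1) := by
    have hy : Fn S fun v : ℕ → M => v 0 := .var 0
    have hc' : Fn S fun v : ℕ → M => c (v 1) (v 0) := Fn.comp₂ hc.fn (.var 1) (.var 0)
    refine .and (.mem hy.fst' A) (.and (.mem hy.snd' A) (.and ?_ (.and ?_ ?_)))
    · exact .ball' (P := fun n v => ∀ m, m < v 1 →
        Far D e (fst (v 0)) (fst (c n m)) (ratVal (snd (c n m)) - eps e (v 1))) (.var 1)
        (.ball' (P := fun m v => Far D e (fst (v 1)) (fst (c (v 0) m))
          (ratVal (snd (c (v 0) m)) - eps e (v 2))) (.var 2)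
          (hS.sig_far he (Fn.var 2).fst' hc'.fst'
            ((RatFn.ratVal hc'.snd').sub (he.ratFn (.var 3)))))
    · exact hS.sig_far he hy.fst' hy.snd' (.const 0)
    · exact hS.sig_near he hy.fst' hy.snd' (he.ratFn (.var 1))
  obtain ⟨g, hg, hgR⟩ := Sig.exists_choice hR fun k => by
    obtain ⟨X, hX, hXk⟩ := h k
    obtain ⟨a, ha, hak⟩ := hS.exists_forall_far he hc hX hXk
    obtain ⟨b, hb, h₁, h₂⟩ := hP.exists_near hS he ha k
    refine ⟨pair a b, ?_⟩
    simp only [R, fst_pair S, snd_pair S]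
    exact ⟨ha, hb, fun n hn m _ => hak n hn m, h₁, h₂⟩
  exact ⟨fun k => fst (g k), fun k => snd (g k), hg.fst', hg.snd', fun k => (hgR k).1,
    fun k => (hgR k).2.1, fun k n m hn hm => (hgR k).2.2.1 n hn m hm, fun k => (hgR k).2.2.2.1,
    fun k => (hgR k).2.2.2.2⟩

/-- `w` codes a ball in `U` that is too small for the pairs that it meets. -/
def IsGoodBall (A D : S) (e : M → M) (c : M → M → M) (b b' : M → M) (w : M) : Prop :=
  (∃ p q r, w = pair p (pair (pair q r) (snd (snd w)))) ∧ fst w ∈ A ∧ 0 < ratVal (snd w) ∧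
    ∃ n m j, Near D e (fst w) (fst (c n m)) (ratVal (snd (c n m)) - eps e j - ratVal (snd w)) ∧
      ∀ k, k < n + m + j + 1 → Far D e (b k) (b' k) (2 * ratVal (snd w))

variable {c : M → M → M} {b b' : M → M}

theorem IsSpace.sig_isGoodBall (hS : IsSpace M A D) (he : IsExp S e) (hc : IsBallCode A U c)
    (hb : IsEscape A D e c b b') : Sig S fun v => IsGoodBall A D e c b b' (v 0) := by
  have hw : ∀ i, RatFn S fun v : ℕ → M => ratVal (snd (v i)) := fun i => .ratVal (Fn.var i).snd'
  refine .and ?_ (.and (.mem (Fn.var 0).fst' A) (.and (RatFn.lt (.const 0) (hw 0)) ?_))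
  · exact .ex (P := fun p v => ∃ q r, v 0 = pair p (pair (pair q r) (snd (snd (v 0)))))
      (.ex (P := fun q v => ∃ r, v 1 = pair (v 0) (pair (pair q r) (snd (snd (v 1)))))
      (.ex (P := fun r v => v 2 = pair (v 1) (pair (pair (v 0) r) (snd (snd (v 2)))))
      (.eq (.var 3) (.pair' (.var 2) (.pair' (.pair' (.var 1) (.var 0)) (Fn.var 3).snd'.snd')))))
  · have hc' : Fn S fun v : ℕ → M => c (v 2) (v 1) := Fn.comp₂ hc.fn (.var 2) (.var 1)
    exact .ex (P := fun n v => ∃ m j, Near D e (fst (v 0)) (fst (c n m))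
        (ratVal (snd (c n m)) - eps e j - ratVal (snd (v 0))) ∧
        ∀ k, k < n + m + j + 1 → Far D e (b k) (b' k) (2 * ratVal (snd (v 0))))
      (.ex (P := fun m v => ∃ j, Near D e (fst (v 1)) (fst (c (v 0) m))
        (ratVal (snd (c (v 0) m)) - eps e j - ratVal (snd (v 1))) ∧
        ∀ k, k < v 0 + m + j + 1 → Far D e (b k) (b' k) (2 * ratVal (snd (v 1))))
      (.ex (P := fun j v => Near D e (fst (v 2)) (fst (c (v 1) (v 0)))
        (ratVal (snd (c (v 1) (v 0))) - eps e j - ratVal (snd (v 2))) ∧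
        ∀ k, k < v 1 + v 0 + j + 1 → Far D e (b k) (b' k) (2 * ratVal (snd (v 2))))
      (.and (hS.sig_near he (Fn.var 3).fst' hc'.fst'
        (((RatFn.ratVal hc'.snd').sub (he.ratFn (.var 0))).sub (hw 3)))
        (.ball' (P := fun k v => Far D e (b k) (b' k) (2 * ratVal (snd (v 3))))
          (((Fn.add (.var 2) (.var 1)).add (.var 0)).add (.const 1))
          (hS.sig_far he (Fn.comp₁ hb.fn (.var 0)) (Fn.comp₁ hb.fn' (.var 0))
            (hw 4).two_mul)))))

/-- The good balls cover the space. -/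
theorem IsSpace.exists_isGoodBall (hS : IsSpace M A D) (he : IsExp S e) (hc : IsBallCode A U c)
    (hb : IsEscape A D e c b b') {x : M → M} (hx : IsPointFn A D e x) {n m : M}
    (h : Ll e (pointDist D x fun _ => fst (c n m)) (cst (ratVal (snd (c n m))))) :
    ∃ w, IsGoodBall A D e c b b' w ∧
        Ll e (pointDist D x fun _ => fst w) (cst (ratVal (snd w))) := by
  obtain ⟨i, hi⟩ := h
  -- The point has room `2^{-i} = 4 * 2^{-j}` inside the ball. That pays for the `2^{-j}` in the
  -- definition of a good ball, for the new radius and for the approximation errors.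
  set j := i + 1 + 1 with hj
  -- Each of the finitely many relevant pairs has positive distance; collection yields one `T` such
  -- that `2 * 2^{-T}` is below all of them. The radius will be `2^{-(T+j)}`.
  obtain ⟨T, hT⟩ := Sig.exists_bound_of_forall_lt (S := S)
    (R := fun k t => Far D e (b k) (b' k) (2 * eps e t)) (a := n + m + j + 1)
    (hS.sig_far he (Fn.comp₁ hb.fn (.var 0)) (Fn.comp₁ hb.fn' (.var 0)) (he.ratFn (.var 1)).two_mul)
    fun k _ => by
      obtain ⟨t, ht⟩ := (hS.far_iff he (hb.mem k) (hb.mem' k)).1 (hb.pos k)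
      refine ⟨t + 1 + 1, (hS.far_iff he (hb.mem k) (hb.mem' k)).2 ⟨t + 1 + 1, ?_⟩⟩
      have := he.cst_eps_pos t
      rw [map_zero] at ht
      rw [map_mul, map_ofNat, he.cst_eps_succ, he.cst_eps_succ]
      linarith
  obtain ⟨z, hz, hzt⟩ := he.exists_ratCode (T + j)
  obtain ⟨p, q, r, hpqr, -⟩ := hz
  -- The centre is the `N`-th term of the point; `8 * 2^{-N}` is half of the radius, so the point
  -- lies in the new ball.
  set N := T + j + 1 + 1 + 1 + 1 with hN
  have hNt : cst (eps e N) = cst (eps e (T + j)) / 2 / 2 / 2 / 2 := by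
    simp only [hN, he.cst_eps_succ]
  have hTj := he.cst_eps_anti (le_add_self : j ≤ T + j)
  have hji : cst (eps e j) = cst (eps e i) / 2 / 2 := by simp only [hj, he.cst_eps_succ]
  have hpos := he.cst_eps_pos (T + j)
  have hposi := he.cst_eps_pos i
  refine ⟨pair (x N) z, ⟨⟨x N, p, q, ?_⟩, ?_, ?_, n, m, j, ?_, fun k hk => ?_⟩, ?_⟩ <;>
    simp only [fst_pair S, snd_pair S, hzt]
  · rw [hpqr, snd_pair S]
  · exact hx.mem N
  · exact he.eps_pos _
  · rw [hS.near_iff he (hx.mem N) (hc.mem n m)]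
    have := (abs_le.1 (hS.abs_pointDist_sub_dist_le he hx (hS.isPointFn_const he (hc.mem n m)) N)).1
    refine ⟨j + 1, ?_⟩
    rw [map_sub, map_sub, he.cst_eps_succ]
    linarith
  · obtain ⟨t, ht, h⟩ := hT k hk
    rw [hS.far_iff he (hb.mem k) (hb.mem' k)] at h ⊢
    refine ll_of_le_of_ll (cst_le.2 ?_) h
    linarith [he.eps_anti (ht.le.trans (le_self_add : T ≤ T + j))]
  · have h₁ := (abs_le.1 (hS.abs_pointDist_sub_dist_le he hx
      (hS.isPointFn_const he (hx.mem N)) N)).2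
    have h₂ := hS.dist_self he (hx.mem N) N
    refine ⟨N, ?_⟩
    linarith

/-- The set with the elements of `P` has a code. -/
theorem exists_isBallCode_of_forall {g : M → M} (hg : Fn S fun v => g (v 0))
    (h : ∀ i, g i = pair (fst (g i)) (snd (g i)) ∧ fst (g i) ∈ A ∧
      HoldsRat (snd (g i)) (fun _ => True) ∧ 0 < ratVal (snd (g i))) :
    ∃ V : S, IsOpenSeq M A V ∧ IsBallCode A V fun n _ => g n := by
  have hu : Fn S fun v : ℕ → M =>
      pair (pair (fst (fst (v 0))) (snd (fst (v 0)))) (g (fst (fst (v 0)))) :=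
    .pair' (.pair' (Fn.var 0).fst'.fst' (Fn.var 0).fst'.snd')
      (Fn.comp₁ hg (Fn.var 0).fst'.fst')
  -- The `n`-th open set consists of the single ball `g n`, repeated for every second index.
  obtain ⟨V, hV⟩ := Sig.comprehension (S := S)
    (P := fun u => u = pair (pair (fst (fst u)) (snd (fst u))) (g (fst (fst u))))
    (.eq (.var 0) hu) (.ne (.var 0) hu)
  have hV' : ∀ n m w, App V (pair n m) w ↔ w = g n := fun n m w => by
    rw [App, hV, fst_pair S, fst_pair S, snd_pair S]
    exact ⟨fun h => (pair_inj S h).2, fun h => h ▸ rfl⟩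
  refine ⟨V, ⟨fun u hu => ⟨_, _, _, (hV u).1 hu⟩,
    fun n m => ⟨g n, (hV' n m _).2 rfl, fun w => (hV' n m w).1⟩, fun n m =>
      ⟨_, _, (hV' n m _).2 (h n).1.symm, (h n).2.1, HoldsRat.elim (S := S).2 ⟨(h n).2.2.1, ?_⟩⟩⟩,
    hg, hV', fun n _ => (h n).1, fun n _ => (h n).2.1, fun n _ => (h n).2.2.1,
    fun n _ => (h n).2.2.2⟩
  have := (h n).2.2.2
  rw [MRat.lt_iff zero_lt_one (ratOf_den_pos _), MRat.val_frac, map_zero, zero_div]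
  exact this

/-- A Lebesgue number shows that an escape sequence is impossible. -/
theorem IsSpace.false_of_isEscape (hS : IsSpace M A D) (he : IsExp S e) (hL : HasLebesgue M A D)
    (hU : IsCovering M A D U) (hc : IsBallCode A U c) (hb : IsEscape A D e c b b') : False := by
  have hcov : ∀ {x X}, IsPointFn A D e x → IsPoint M A D X → (∀ n w, App X n w ↔ w = x n) →
      ∃ w, IsGoodBall A D e c b b' w ∧
        Ll e (pointDist D x fun _ => fst w) (cst (ratVal (snd w))) := fun hx hX hXx => by
    obtain ⟨n, hn⟩ := hU.2 _ hX
    obtain ⟨m, hm⟩ := (hS.inOpen_iff he hc hx hXx n).1 hn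
    exact hS.exists_isGoodBall he hc hb hx hm
  have hconst : ∀ {a}, a ∈ A → ∃ X, IsPoint M A D X ∧ ∀ n w : M, App X n w ↔ w = a := fun ha =>
    hS.exists_isPoint he (hS.isPointFn_const he ha)
  -- The enumeration needs a nonempty set; a good ball around the point `b 0` is at hand.
  obtain ⟨w₀, hw₀⟩ : ∃ w, IsGoodBall A D e c b b' w := by
    obtain ⟨X, hX, hXx⟩ := hconst (hb.mem 0)
    obtain ⟨w, hw, -⟩ := hcov (hS.isPointFn_const he (hb.mem 0)) hX hXx
    exact ⟨w, hw⟩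
  obtain ⟨g, hg, hgood, hsurj⟩ := Sig.exists_range_eq (hS.sig_isGoodBall he hc hb) hw₀
  obtain ⟨V, hV, hVc⟩ := exists_isBallCode_of_forall (A := A) hg fun i => by
    obtain ⟨⟨p, q, r, h⟩, hA, hpos, -⟩ := hgood i
    have h₁ : fst (g i) = p := by rw [h, fst_pair S]
    have h₂ : snd (g i) = pair (pair q r) (snd (snd (g i))) := by
      conv_lhs => rw [h, snd_pair S]
    exact ⟨by rw [h₁, h₂]; exact h, hA, ⟨_, _, _, h₂, trivial⟩, hpos⟩
  obtain ⟨q, hq, hVq⟩ := hL V ⟨hV, fun X hX => by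
    obtain ⟨x, hx, hXx⟩ := hS.exists_isPointFn he hX
    obtain ⟨w, hw, hxw⟩ := hcov hx hX hXx
    obtain ⟨i, rfl⟩ := hsurj w hw
    exact ⟨i, (hS.inOpen_iff he hVc hx hXx i).2 ⟨0, hxw⟩⟩⟩
  -- As `Q` is not infinitesimal, some `2^{-n}` lies below it; the `n`-th pair is then within the
  -- Lebesgue number.
  obtain ⟨Q, hQ, n, hn⟩ := hq.exists_approx he
  rw [zero_add] at hn
  have hx := hS.isPointFn_const he (hb.mem n)
  have hy := hS.isPointFn_const he (hb.mem' n)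
  obtain ⟨X, hX, hXx⟩ := hconst (hb.mem n)
  obtain ⟨Y, hY, hYy⟩ := hconst (hb.mem' n)
  obtain ⟨i, hi⟩ := hVq X hX
  obtain ⟨-, hA, -, n', m, j, hnear, hfar⟩ := hgood i
  set a := fst (g i)
  set s := ratVal (snd (g i))
  obtain ⟨-, hxa⟩ := (hS.inOpen_iff he hVc hx hXx i).1 <| hi X hX <|
    (hS.inBall_iff he hx hx hXx hXx hQ).2 <| (hS.dist_self he (hb.mem n)).trans_ll he <|
      ((by simpa using he.ll_cst (he.eps_pos n) : Ll e 0 (cst (eps e n))).trans_le hn.le)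
  obtain ⟨-, hya⟩ := (hS.inOpen_iff he hVc hy hYy i).1 <| hi Y hY <|
    (hS.inBall_iff he hx hy hXx hYy hQ).2 <|
      ((hS.near_iff he (hb.mem n) (hb.mem' n)).1 (hb.near n)).trans_le hn.le
  change Ll e (baseDist D (b n) a) (cst s) at hxa
  change Ll e (baseDist D (b' n) a) (cst s) at hya
  -- For small `n` the good ball is too small to hold both points of the pair. For large `n` it lies
  -- so deep inside the ball `(n', m)` of `U` that `b n` should have avoided it.
  rcases lt_or_ge n (n' + m + j + 1) with h | h
  · have h₁ := (hS.far_iff he (hb.mem n) (hb.mem' n)).1 (hfar n h)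
    have h₂ := (hS.dist_triangle he (hb.mem n) (hb.mem' n) hA).trans he
      ((hxa.ls he).add he ((hS.dist_comm he hA (hb.mem' n)).trans he (hya.ls he)))
    rw [← map_add, ← two_mul] at h₂
    exact lt_irrefl _ ((h₁.trans_ls he h₂).lt he)
  · have hnk : ∀ k, k ≤ n' + m + j → k < n := fun k hk =>
      (hk.trans_lt (lt_add_one _)).trans_le h
    have h₁ := (hS.far_iff he (hb.mem n) (hc.mem n' m)).1 (hb.far n n' m
      (hnk _ (le_self_add.trans le_self_add)) (hnk _ (le_add_self.trans le_self_add)))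
    have h₂ := (hS.dist_triangle he (hb.mem n) (hc.mem n' m) hA).trans he
      ((hxa.ls he).add he (((hS.near_iff he hA (hc.mem n' m)).1 hnear).ls he))
    rw [← map_add] at h₂
    have h₃ := cst_lt.1 ((h₁.trans_ls he h₂).lt he)
    linarith [he.eps_anti (hnk j le_add_self).le]

theorem hasHeineBorel_of_isPerfect_of_hasLebesgue (hS : IsSpace M A D) (hP : IsPerfect M A D)
    (hL : HasLebesgue M A D) : HasHeineBorel M A D := by
  intro U hU
  by_contra hF
  -- The initial segment below `k` is a set of the model by comprehension, hence an admissible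
  -- choice of the finite set `F`.
  have h : ∀ k, ∃ X, IsPoint M A D X ∧ ∀ n < k, ¬ InOpen D U n X := fun k => by
    obtain ⟨F, hFk⟩ := Sig.comprehension (S := S) (P := fun n => n < k)
      (.lt (.var 0) (.const k)) ((Sig.le (.const k) (.var 0)).congr fun v => not_lt.symm)
    by_contra! hc
    exact hF ⟨F, ⟨k, fun n => (hFk n).1⟩, fun X hX => by
      obtain ⟨n, hn, hX⟩ := hc X hX
      exact ⟨n, (hFk n).2 hn, hX⟩⟩
  -- For `k = 0` nothing is avoided; this only yields some point, and the code of a point supplies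
  -- an instance of `Pow2` and thereby the exponential function.
  obtain ⟨X, hX, -⟩ := h 0
  obtain ⟨a, a', p, -, -, -, -, hp, -⟩ := hX.2 0
  obtain ⟨e, he⟩ := exists_isExp hp
  obtain ⟨c, hc⟩ := hU.1.exists_isBallCode
  obtain ⟨b, b', hb⟩ := hS.exists_isEscape he hP hc h
  exact hS.false_of_isEscape he hL hU hc hb

end HeineBorel

end SecondOrderArithmetic

/-- `RCA₀` proves that every complete separable metric space which is perfect and Lebesgue is
Heine-Borel compact. -/
theorem mainTheorem8 :
    SecondOrderArithmetic.Proves SecondOrderArithmetic.RCA0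
      SecondOrderArithmetic.perfectLebesgueHeineBorel := by
  refine SecondOrderArithmetic.derives_of_forall_model
    fun M S _ _ _ _ _ _ _ _ _ hM v w => ?_
  have : SecondOrderArithmetic.IsModel M S := ⟨hM, inferInstance, inferInstance, inferInstance⟩
  let _ := SecondOrderArithmetic.IsModel.commSemiring (M := M) S
  let _ := SecondOrderArithmetic.IsModel.linearOrder (M := M) S
  have := SecondOrderArithmetic.isStrictOrderedRing_of_isModel (M := M) S
  have := SecondOrderArithmetic.canonicallyOrderedAdd_of_isModel (M := M) S
  exact (SecondOrderArithmetic.eval_perfectLebesgueHeineBorel (M := M) (S := S) v w).2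
    fun A D hS hP hL => SecondOrderArithmetic.hasHeineBorel_of_isPerfect_of_hasLebesgue hS hP hL
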